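/- **Model.** For each $i\ge 1$ let $b_i,h_i>0$, $\sigma_{p,i},\sigma_{f,i}>0$ be known, $\theta_i\in\mathbb R$ unknown, $\tilde b_i=b_i/(b_i+h_i)$, and let $X_1,X_2,\dots$ be independent with $X_i\sim N(\theta_i,\sigma_{p,i})$ (mean, variance). Let $\phi,\Phi$ be the standard normal density and distribution function, and $G(w,\beta)=\phi(w)+w\Phi(w)-\beta w$. For $\tau\in[0,\infty]$ put $\alpha_i(\tau)=\tau/(\tau+\sigma_{p,i})$ (with $\alpha_i(\infty)=1$), and for $\eta\in\mathbb R$ $$\hat q_i(\eta,\tau)=\alpha_i(\tau)X_i+(1-\alpha_i(\tau))\eta+\sqrt{\sigma_{f,i}+\alpha_i(\tau)\sigma_{p,i}}\;\Phi^{-1}(\tilde b_i).$$ The loss is $L_n(\theta,\hat q)=\frac1n\sum_{i=1}^n l_i(\theta_i,\hat q_i)$ with $l_i(\theta_i,q)=\mathbb E_{Y\sim N(\theta_i,\sigma_{f,i})}[b_i(Y-q)^++h_i(q-Y)^+]$. **Assumptions.** (A1) $0<\inf_i\tilde b_i\le\sup_i\tilde b_i<1$ and $\sup_i(b_i+h_i)<\infty$.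 (A2) $\limsup_n\frac1n\sum_{i\le n}|\theta_i|<\infty$. (A3) $\sup_i\sigma_{p,i}/\sigma_{f,i}<1/(4e)$, $\sup_i\sigma_{f,i}<\infty$, $\inf_i\sigma_{p,i}>0$. In addition, the ratios $\tilde b_i$ are not all equal. **Risk estimate.** Fix constants $\gamma(i)$ with $\inf_i\gamma(i)>0$ and $\gamma(i)<1/\sqrt{4e}-\sqrt{\sigma_{p,i}/\sigma_{f,i}}$ for all $i$. Put $\lambda_n(i)=\gamma(i)\sqrt{2\log n}$, $K_n(i)=1+\lceil e^2(\gamma(i)+\sqrt{2\sigma_{p,i}/\sigma_{f,i}})^2\,2\log n\rceil$, $$c_i(\tau)=\sqrt{\frac{\sigma_{f,i}+\alpha_i(\tau)\sigma_{p,i}}{\sigma_{f,i}+\alpha_i(\tau)^2\sigma_{p,i}}}\,\Phi^{-1}(\tilde b_i),\qquad d_i(\tau)=-\frac{1-\alpha_i(\tau)}{\sqrt{\sigma_{f,i}+\sigma_{p,i}\alpha_i(\tau)^2}},\qquad s_i(\tau)=\sqrt{2\sigma_{p,i}d_i(\tau)^2}.$$ With $H_k$ the probabilists' Hermite polynomials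 and $G'$ the derivative of $G$ in its first argument, let $$S_i(u)=G(0,\tilde b_i)+G'(0,\tilde b_i)u+\phi(0)\sum_{k=0}^{K_n(i)-2}\frac{(-1)^kH_k(0)}{(k+2)!}\,s_i(\tau)^{k+2}H_{k+2}\!\Big(\frac{u}{s_i(\tau)}\Big),$$ where $s^{k}H_{k}(u/s)$ is read as its limit $u^{k}$ at $s=0$, and let $\tilde S_i=\operatorname{sign}(S_i)\min\{|S_i|,n\}$. For $x,z\in\mathbb R$ put $u=c_i(\tau)+d_i(\tau)(x+\sqrt{\sigma_{p,i}}z)$, $v=c_i(\tau)+d_i(\tau)(x-\sqrt{\sigma_{p,i}}z)$, and let $\hat T_i(x,z,\tau)$ be $-\tilde b_iu$ if $v<-\lambda_n(i)$, $\tilde S_i(u)$ if $|v|\le\lambda_n(i)$, and $(1-\tilde b_i)u$ if $v>\lambda_n(i)$. With $\hat T_i(x,\tau)=\mathbb E_{Z\sim N(0,1)}\hat T_i(x,Z,\tau)$, define $$\widehat{\mathrm{ARE}}{}^D_n(\eta,\tau)=\frac1n\sum_{i=1}^n(b_i+h_i)\sqrt{\sigma_{f,i}+\sigma_{p,i}\alpha_i(\tau)^2}\;\hat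 T_i(X_i-\eta,\tau).$$ **Grid.** Let $n\ge3$, $a_n=\log\log n$, and let $\hat M_n=[\hat m_n(\alpha_1),\hat m_n(\alpha_2)]$, where $\hat m_n(\alpha)$ is the empirical $\alpha$-quantile of $X_1,\dots,X_n$ (the least $t$ such that at least $\alpha n$ of them are $\le t$), $\alpha_1=\min_{i\le n}\tilde b_i$, $\alpha_2=\max_{i\le n}\tilde b_i$. Fix constants $C_1,\dots,C_4$ with $b_i+h_i\le C_1$, $\max(\sigma_{p,i},\sigma_{p,i}^{-1})\le C_2$, $(\sigma_{p,i}/\sigma_{f,i})\,|\Phi^{-1}(\tilde b_j)|\le C_3$ for all $i,j$, and $C_4>0$. Put $\delta_{n,1}=(2C_1a_n)^{-1}$, $\delta_{n,2}=\{2C_1C_2(2\phi(0)+C_3+\sqrt{a_n}\,C_4+a_n+a_n^2)\}^{-1}$, $\Lambda_{n,1}=\{-a_n+k\delta_{n,1}:k=0,1,2,\dots\}\cap[-a_n,a_n]$ and $\Lambda_{n,2}=\{\tau:\tau/(\tau+1)=k\delta_{n,2},\ 0\le k<\lceil1/\delta_{n,2}\rceil\}$. **Theorem.** For $n\ge 3$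 let $(\hat\eta^D_n,\hat\tau^D_n)$ be any minimizer of $\widehat{\mathrm{ARE}}{}^D_n$ over $(\Lambda_{n,1}\cap\hat M_n)\times\Lambda_{n,2}$ (chosen arbitrarily when this set is empty), and let $(\eta^{\mathsf{DOR}}_n,\tau^{\mathsf{DOR}}_n)$ be any minimizer of $L_n(\theta,\hat q(\eta,\tau))$ over $\eta\in\hat M_n$, $\tau\in[0,\infty]$. Under the assumptions above, for every fixed $\epsilon>0$, $$\lim_{n\to\infty}P\Big\{L_n\big(\theta,\hat q(\hat\eta^D_n,\hat\tau^D_n)\big)\ \ge\ L_n\big(\theta,\hat q(\eta^{\mathsf{DOR}}_n,\tau^{\mathsf{DOR}}_n)\big)+\epsilon\Big\}=0.$$ -/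

import Mathlib

open Filter Topology MeasureTheory ProbabilityTheory
open scoped ENNReal

namespace ARE

noncomputable section

/-! ### The standard normal distribution and the function `G` -/

/-- The standard normal density. -/
def stdPdf (x : ℝ) : ℝ := gaussianPDFReal 0 1 x

/-- The standard normal distribution function. -/
def stdCdf (x : ℝ) : ℝ := cdf (gaussianReal 0 1) x

/-- The standard normal quantile function (the inverse of `stdCdf` on `(0, 1)`). -/
def stdQuantile (p : ℝ) : ℝ := sInf {x : ℝ | p ≤ stdCdf x}

/-- `G(w, β) = φ(w) + w Φ(w) - β w`. -/
def G (w β : ℝ) : ℝ := stdPdf w + w * stdCdf w - β * w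

/-! ### The predictive model -/

/-- The known constants of one coordinate: the weights `b`, `h` of the check loss and the
past and future variances `σp`, `σf`. -/
structure Coord where
  b : ℝ
  h : ℝ
  σp : ℝ
  σf : ℝ

/-- The critical ratio `b / (b + h)`. -/
def Coord.ratio (p : Coord) : ℝ := p.b / (p.b + p.h)

/-- The predictive check loss of the prediction `q`: the expectation of
`b (Y - q)⁺ + h (q - Y)⁺` for `Y` normal with mean `θ` and variance `σf`. -/
def Coord.loss (p : Coord) (θ q : ℝ) : ℝ :=
  ∫ y, (p.b * max (y - q) 0 + p.h * max (q - y) 0) ∂(gaussianReal θ p.σf.toNNReal)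

/-- The shrinkage factor `τ / (τ + σp)`, for `τ ∈ [0, ∞]`; it is `1` at `τ = ∞`. -/
def Coord.shrink (p : Coord) (τ : ℝ≥0∞) : ℝ :=
  if τ = ∞ then 1 else τ.toReal / (τ.toReal + p.σp)

/-- The shrinkage predictor of one coordinate with location `η` and scale `τ`, from the past
observation `x`. -/
def Coord.predictor (p : Coord) (η : ℝ) (τ : ℝ≥0∞) (x : ℝ) : ℝ :=
  p.shrink τ * x + (1 - p.shrink τ) * η
    + √(p.σf + p.shrink τ * p.σp) * stdQuantile p.ratio

/-- The average predictive loss over the first `n` coordinates of the shrinkage rule with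
hyperparameters `(η, τ)`, when the past data are `x`. -/
def avgLoss (p : ℕ → Coord) (θ : ℕ → ℝ) (n : ℕ) (x : ℕ → ℝ) (η : ℝ) (τ : ℝ≥0∞) : ℝ :=
  (1 / (n : ℝ)) * ∑ i ∈ Finset.range n, (p i).loss (θ i) ((p i).predictor η τ (x i))

/-- Assumption A1: the critical ratios stay away from `0` and `1`, and `b + h` is bounded. -/
structure AssumptionA1 (p : ℕ → Coord) : Prop where
  b_pos : ∀ i, 0 < (p i).b
  h_pos : ∀ i, 0 < (p i).h
  ratio_lower : ∃ c : ℝ, 0 < c ∧ ∀ i, c ≤ (p i).ratio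
  ratio_upper : ∃ c : ℝ, c < 1 ∧ ∀ i, (p i).ratio ≤ c
  weight_bdd : ∃ C : ℝ, ∀ i, (p i).b + (p i).h ≤ C

/-- Assumption A2: the averages of `|θ_i|` have a finite limsup. -/
def AssumptionA2 (θ : ℕ → ℝ) : Prop :=
  IsBoundedUnder (· ≤ ·) atTop (fun n : ℕ => (1 / (n : ℝ)) * ∑ i ∈ Finset.range n, |θ i|)

/-- Assumption A3: `sup σp / σf < 1 / (4 e)`, with `inf σp > 0` and `sup σf < ∞`. -/
structure AssumptionA3 (p : ℕ → Coord) : Prop where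
  σf_pos : ∀ i, 0 < (p i).σf
  σp_lower : ∃ c : ℝ, 0 < c ∧ ∀ i, c ≤ (p i).σp
  σf_upper : ∃ C : ℝ, ∀ i, (p i).σf ≤ C
  var_ratio : ∃ κ : ℝ, κ < 1 / (4 * Real.exp 1) ∧ ∀ i, (p i).σp / (p i).σf ≤ κ

/-! ### The asymptotic risk estimate -/

/-- `√(σf + σp α²)` with `α` the shrinkage factor at `τ`. -/
def Coord.scale (p : Coord) (τ : ℝ≥0∞) : ℝ := √(p.σf + p.σp * p.shrink τ ^ 2)

/-- The intercept `c(τ)`: the risk at mean `θ`, with `η = 0`, is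
`(b + h) * scale * G (c(τ) + d(τ) θ, ratio)`. -/
def Coord.c (p : Coord) (τ : ℝ≥0∞) : ℝ :=
  √((p.σf + p.shrink τ * p.σp) / (p.σf + p.shrink τ ^ 2 * p.σp)) * stdQuantile p.ratio

/-- The slope `d(τ)`. -/
def Coord.d (p : Coord) (τ : ℝ≥0∞) : ℝ := -((1 - p.shrink τ) / p.scale τ)

/-- `s ^ k H_k (u / s)`, with `H_k` the probabilists' Hermite polynomial, as a polynomial in `u`
and `s`; it is `u ^ k` at `s = 0`, the limit as `s → 0`. -/
def scaledHermite (k : ℕ) (s u : ℝ) : ℝ :=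
  ∑ j ∈ Finset.range (k + 1), ((Polynomial.hermite k).coeff j : ℝ) * u ^ j * s ^ (k - j)

theorem scaledHermite_eq (k : ℕ) {s : ℝ} (hs : s ≠ 0) (u : ℝ) :
    scaledHermite k s u = s ^ k * Polynomial.aeval (u / s) (Polynomial.hermite k) := by
  rw [Polynomial.aeval_eq_sum_range, Polynomial.natDegree_hermite, Finset.mul_sum]
  refine Finset.sum_congr rfl fun j hj => ?_
  have hjk : j ≤ k := Nat.lt_succ_iff.mp (Finset.mem_range.mp hj)
  rw [zsmul_eq_mul, div_pow, ← Nat.sub_add_cancel hjk, pow_add, Nat.add_sub_cancel]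
  field_simp

theorem scaledHermite_zero (k : ℕ) (u : ℝ) : scaledHermite k 0 u = u ^ k := by
  unfold scaledHermite
  rw [Finset.sum_eq_single k]
  · simp
  · intro j hj hne
    have hjk : j < k := lt_of_le_of_ne (Nat.lt_succ_iff.mp (Finset.mem_range.mp hj)) hne
    rw [zero_pow (Nat.sub_ne_zero_of_lt hjk), mul_zero]
  · intro hk
    simp at hk

/-- The threshold `γ √(2 log n)`. -/
def threshold (γ : ℝ) (n : ℕ) : ℝ := γ * √(2 * Real.log n)

/-- The truncation order `K = 1 + ⌈e² (γ + √(2 σp / σf))² (2 log n)⌉`. -/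
def Coord.order (p : Coord) (γ : ℝ) (n : ℕ) : ℕ :=
  1 + ⌈Real.exp 2 * (γ + √(2 * p.σp / p.σf)) ^ 2 * (2 * Real.log n)⌉₊

/-- The estimate `S(u)` of the Taylor polynomial of `G(·, ratio)` of order `K` at `0`; the sum
is over `0 ≤ k ≤ K - 2`. -/
def Coord.S (p : Coord) (γ : ℝ) (n : ℕ) (τ : ℝ≥0∞) (u : ℝ) : ℝ :=
  G 0 p.ratio + deriv (fun w => G w p.ratio) 0 * u
    + stdPdf 0 * ∑ k ∈ Finset.range (p.order γ n - 1),
        (-1) ^ k * (((Polynomial.hermite k).eval 0 : ℤ) : ℝ) / ((k + 2).factorial : ℝ)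
          * scaledHermite (k + 2) (√(2 * p.σp * p.d τ ^ 2)) u

/-- `S(u)` truncated to `[-n, n]`. -/
def Coord.Strunc (p : Coord) (γ : ℝ) (n : ℕ) (τ : ℝ≥0∞) (u : ℝ) : ℝ :=
  SignType.sign (p.S γ n τ u) * min |p.S γ n τ u| n

/-- The randomized threshold estimate: `z` is the added noise, and `u`, `v` are the two
transformed pseudo-samples. -/
def Coord.That (p : Coord) (γ : ℝ) (n : ℕ) (τ : ℝ≥0∞) (x z : ℝ) : ℝ :=
  let u := p.c τ + p.d τ * (x + √p.σp * z)
  let v := p.c τ + p.d τ * (x - √p.σp * z)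
  if v < -threshold γ n then -p.ratio * u
  else if v ≤ threshold γ n then p.Strunc γ n τ u
  else (1 - p.ratio) * u

/-- The threshold estimate averaged over standard normal noise `z`. -/
def Coord.ThatRB (p : Coord) (γ : ℝ) (n : ℕ) (τ : ℝ≥0∞) (x : ℝ) : ℝ :=
  ∫ z, p.That γ n τ x z ∂(gaussianReal 0 1)

/-- The asymptotic risk estimate for shrinkage towards the origin. -/
def riskEst (p : ℕ → Coord) (γ : ℕ → ℝ) (n : ℕ) (x : ℕ → ℝ) (τ : ℝ≥0∞) : ℝ :=
  (1 / (n : ℝ)) * ∑ i ∈ Finset.range n,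
    ((p i).b + (p i).h) * (p i).scale τ * (p i).ThatRB (γ i) n τ (x i)

/-- The asymptotic risk estimate for shrinkage towards `η`: the former one at the data
`x - η`. -/
def riskEstD (p : ℕ → Coord) (γ : ℕ → ℝ) (n : ℕ) (x : ℕ → ℝ) (η : ℝ) (τ : ℝ≥0∞) : ℝ :=
  riskEst p γ n (fun i => x i - η) τ

/-! ### The range of locations and the grid -/

/-- The empirical `α`-quantile of `x 0, …, x (n - 1)`: the least `t` such that a fraction of at
least `α` of these numbers is at most `t`. -/
def empQuantile (n : ℕ) (x : ℕ → ℝ) (α : ℝ) : ℝ :=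
  sInf {t : ℝ | α ≤ (((Finset.range n).filter fun i => x i ≤ t).card : ℝ) / n}

/-- The interval between the empirical quantiles at the least and the greatest of the first `n`
critical ratios. -/
def locRange (p : ℕ → Coord) (n : ℕ) (x : ℕ → ℝ) : Set ℝ :=
  Set.Icc (empQuantile n x (⨅ i : Fin n, (p i).ratio))
    (empQuantile n x (⨆ i : Fin n, (p i).ratio))

/-- `a_n = log log n`. -/
def a (n : ℕ) : ℝ := Real.log (Real.log n)

/-- The spacing of the grid of locations. -/
def spacing₁ (C₁ : ℝ) (n : ℕ) : ℝ := (2 * C₁ * a n)⁻¹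

/-- The spacing of the grid of the transformed scales `τ / (τ + 1)`. -/
def spacing₂ (C₁ C₂ C₃ C₄ : ℝ) (n : ℕ) : ℝ :=
  (2 * C₁ * C₂ * (2 * stdPdf 0 + C₃ + √(a n) * C₄ + a n + a n ^ 2))⁻¹

/-- The equispaced grid of locations in `[-a_n, a_n]`, starting at `-a_n`. -/
def grid₁ (C₁ : ℝ) (n : ℕ) : Set ℝ :=
  {η | η ∈ Set.Icc (-a n) (a n) ∧ ∃ k : ℕ, η = -a n + k * spacing₁ C₁ n}

/-- The grid of scales: `τ / (τ + 1)` runs through `k δ` for `0 ≤ k < ⌈1 / δ⌉`, where `δ` is the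
spacing. -/
def grid₂ (C₁ C₂ C₃ C₄ : ℝ) (n : ℕ) : Set ℝ≥0∞ :=
  {τ | ∃ k : ℕ, k < ⌈1 / spacing₂ C₁ C₂ C₃ C₄ n⌉₊ ∧
    τ = ENNReal.ofReal
      (k * spacing₂ C₁ C₂ C₃ C₄ n / (1 - k * spacing₂ C₁ C₂ C₃ C₄ n))}

/-- The data-restricted product grid over which the risk estimate is minimized. -/
def searchGrid (p : ℕ → Coord) (C₁ C₂ C₃ C₄ : ℝ) (n : ℕ) (x : ℕ → ℝ) : Set (ℝ × ℝ≥0∞) :=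
  (grid₁ C₁ n ∩ locRange p n x) ×ˢ grid₂ C₁ C₂ C₃ C₄ n

/-- `m` is an argmin of `f` over `s`. -/
def IsArgmin {α : Type*} (f : α → ℝ) (s : Set α) (m : α) : Prop :=
  m ∈ s ∧ ∀ y ∈ s, f m ≤ f y

end

end ARE

namespace ARE

open scoped NNReal

/-! The theorem follows from uniform consistency of the risk estimate on the grid together with the
fact that restricting the oracle problem to the grid costs o(1).

One coordinate. The risk of the shrinkage rule is (b + h) · `scale` · G(m, β), with β the critical
ratio and m = c + d(θ - η). The two pseudo-samples u and v are independent normals with mean m and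
the same variance, which A3 keeps below 3/16. The sample v decides which estimate is used, and u
supplies its value. In the middle region the Hermite sum S estimates a Taylor polynomial of G
without bias; in the tails G is close to one of its asymptotes -βm and (1 - β)m. The bias is
O(exp(-λ²/8) + n^(-2/5)), with λ the threshold, and the variance is O(n^(3/5)); the latter exponent
is below 1 because γ² ≤ 1/(4e). See `abs_integral_thresh_sub_le`, `integral_thresh_sub_sq_le` and
`Coord.Regular.err_moments`.

Grid. Chebyshev's inequality bounds the probability of a deviation at one grid point by O(n^(-2/5)).
The grid has O((log n)^4) points, so a union bound gives `tendsto_measure_grid_deviation`.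

Discretization. With high probability the average of |X_i| is at most a constant R. Then L_n is
Lipschitz in η and τ/(τ + 1) (`abs_avgLoss_sub_le`), and the empirical quantiles lie in a fixed
interval [-r, r], eventually inside [-a_n, a_n]. A grid point near the oracle inside the random
range exists once that range is at least one spacing long. If it were shorter, a fixed fraction of
all pairs of observations would lie within one spacing of each other, because the critical ratios
are not all equal; since normal densities are bounded, this has vanishing probability
(`card_pairs_of_empQuantile_lt`, `measure_card_pairs_le`). The deterministic conclusion is
`avgLoss_lt_of_accurate`. -/

/-! ### The standard normal law and the function `G`. -/

theorem stdPdf_eq (x : ℝ) : stdPdf x = (√(2 * Real.pi))⁻¹ * Real.exp (-x ^ 2 / 2) := by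
  simp [stdPdf, gaussianPDFReal]

theorem stdPdf_nonneg (x : ℝ) : 0 ≤ stdPdf x := gaussianPDFReal_nonneg _ _ _

theorem stdPdf_zero_pos : 0 < stdPdf 0 := gaussianPDFReal_pos _ _ _ one_ne_zero

theorem stdPdf_le_exp (x : ℝ) : stdPdf x ≤ Real.exp (-x ^ 2 / 2) := by
  rw [stdPdf_eq]
  have h : (√(2 * Real.pi))⁻¹ ≤ 1 := by
    apply inv_le_one_of_one_le₀
    rw [Real.one_le_sqrt]
    linarith [Real.pi_gt_three]
  exact mul_le_of_le_one_left (Real.exp_pos _).le h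

theorem stdPdf_le_one (x : ℝ) : stdPdf x ≤ 1 :=
  (stdPdf_le_exp x).trans (Real.exp_le_one_iff.mpr (by nlinarith [sq_nonneg x]))

theorem hasDerivAt_stdPdf (x : ℝ) : HasDerivAt stdPdf (-x * stdPdf x) x := by
  have h : HasDerivAt (fun x : ℝ => (√(2 * Real.pi))⁻¹ * Real.exp (-x ^ 2 / 2))
      ((√(2 * Real.pi))⁻¹ * (Real.exp (-x ^ 2 / 2) * (-(2 * x) / 2))) x := by
    have h1 : HasDerivAt (fun x : ℝ => -x ^ 2 / 2) (-(2 * x) / 2) x := by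
      simpa using ((hasDerivAt_pow 2 x).neg).div_const 2
    exact (h1.exp).const_mul _
  have h2 : stdPdf = fun x : ℝ => (√(2 * Real.pi))⁻¹ * Real.exp (-x ^ 2 / 2) := funext stdPdf_eq
  rw [h2]
  convert h using 1
  ring

theorem continuous_stdPdf : Continuous stdPdf :=
  continuous_iff_continuousAt.mpr fun x => (hasDerivAt_stdPdf x).continuousAt

theorem integrable_stdPdf : Integrable stdPdf := integrable_gaussianPDFReal 0 1

theorem stdCdf_eq_integral (x : ℝ) : stdCdf x = ∫ t in Set.Iic x, stdPdf t := by
  rw [stdCdf, cdf_eq_real, Measure.real, gaussianReal_apply_eq_integral _ one_ne_zero]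
  exact ENNReal.toReal_ofReal (integral_nonneg fun t => stdPdf_nonneg t)

theorem hasDerivAt_stdCdf (x : ℝ) : HasDerivAt stdCdf (stdPdf x) x := by
  have h : stdCdf = fun y => stdCdf 0 + ∫ t in (0 : ℝ)..y, stdPdf t := by
    funext y
    rw [stdCdf_eq_integral, stdCdf_eq_integral,
      ← intervalIntegral.integral_Iic_sub_Iic integrable_stdPdf.integrableOn
        integrable_stdPdf.integrableOn]
    ring
  rw [h]
  exact (continuous_stdPdf.integral_hasStrictDerivAt 0 x).hasDerivAt.const_add _

theorem stdCdf_nonneg (x : ℝ) : 0 ≤ stdCdf x := cdf_nonneg _ _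

theorem stdCdf_le_one (x : ℝ) : stdCdf x ≤ 1 := cdf_le_one _ _

/-- `φ(w) + w Φ(w)`, the mean of the positive part of a normal variable with mean `w` and unit
variance. -/
noncomputable def posMean (w : ℝ) : ℝ := stdPdf w + w * stdCdf w

theorem G_eq (w β : ℝ) : G w β = posMean w - β * w := rfl

theorem hasDerivAt_posMean (w : ℝ) : HasDerivAt posMean (stdCdf w) w := by
  have h := (hasDerivAt_stdPdf w).add ((hasDerivAt_id w).mul (hasDerivAt_stdCdf w))
  exact h.congr_deriv (by simp only [id]; ring)

theorem hasDerivAt_G (w β : ℝ) : HasDerivAt (fun w => G w β) (stdCdf w - β) w := by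
  have h := (hasDerivAt_posMean w).sub ((hasDerivAt_id w).const_mul β)
  exact h.congr_deriv (by ring)

theorem integrable_id_gaussianReal (m : ℝ) (v : ℝ≥0) :
    Integrable (fun x : ℝ => x) (gaussianReal m v) :=
  (memLp_id_gaussianReal' 1 ENNReal.one_ne_top).integrable le_rfl

theorem tendsto_stdPdf_atBot : Tendsto stdPdf atBot (𝓝 0) := by
  have h : Tendsto (fun x : ℝ => Real.exp (-x ^ 2 / 2)) atBot (𝓝 0) := by
    apply Real.tendsto_exp_atBot.comp
    have h2 : Tendsto (fun x : ℝ => x * x) atBot atTop := tendsto_id.atBot_mul_atBot₀ tendsto_id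
    have h3 := tendsto_neg_atTop_atBot.comp (h2.atTop_div_const (show (0:ℝ) < 2 by norm_num))
    refine h3.congr fun x => ?_
    simp only [Function.comp]
    ring
  exact squeeze_zero stdPdf_nonneg stdPdf_le_exp h

/-- On z ≤ w the integrand φ(z)(w - z) has the antiderivative wΦ(z) + φ(z), which vanishes at -∞. -/
theorem integral_max_sub_gaussianReal (w : ℝ) :
    ∫ z, max (w - z) 0 ∂(gaussianReal 0 1) = posMean w := by
  have hint : Integrable (fun z : ℝ => max (w - z) 0) (gaussianReal 0 1) :=
    ((integrable_const w).sub (integrable_id_gaussianReal 0 1)).pos_part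
  have hint2 : Integrable (fun z : ℝ => stdPdf z * (w - z)) := by
    have h := ((integrable_const w).sub (integrable_id_gaussianReal 0 1))
    rw [gaussianReal_of_var_ne_zero 0 one_ne_zero] at h
    have := (integrable_withDensity_iff_integrable_smul₀' (measurable_gaussianPDF 0 1).aemeasurable
      (ae_of_all _ fun x => gaussianPDF_lt_top)).mp h
    simpa [toReal_gaussianPDF, stdPdf] using this
  rw [integral_gaussianReal_eq_integral_smul one_ne_zero]
  have h1 : ∀ z, gaussianPDFReal 0 1 z • max (w - z) 0
      = (Set.Iic w).indicator (fun z => stdPdf z * (w - z)) z := by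
    intro z
    by_cases hz : z ≤ w
    · rw [Set.indicator_of_mem (by exact hz), max_eq_left (by linarith)]
      rfl
    · rw [Set.indicator_of_notMem (by exact hz), max_eq_right (by linarith)]
      simp
  simp_rw [h1]
  rw [integral_indicator measurableSet_Iic]
  have hder : ∀ z ∈ Set.Iic w,
      HasDerivAt (fun z => w * stdCdf z + stdPdf z) (stdPdf z * (w - z)) z := by
    intro z _
    exact (((hasDerivAt_stdCdf z).const_mul w).add (hasDerivAt_stdPdf z)).congr_deriv (by ring)
  have hlim : Tendsto (fun z => w * stdCdf z + stdPdf z) atBot (𝓝 0) := by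
    have := ((tendsto_cdf_atBot (gaussianReal 0 1)).const_mul w).add tendsto_stdPdf_atBot
    rw [mul_zero, add_zero] at this
    exact this
  rw [integral_Iic_of_hasDerivAt_of_tendsto' hder hint2.integrableOn hlim]
  rw [sub_zero, posMean, add_comm]

theorem posMean_nonneg (w : ℝ) : 0 ≤ posMean w := by
  rw [← integral_max_sub_gaussianReal]
  exact integral_nonneg fun z => le_max_right _ _

/-- Reflect z to -z and use y⁺ - (-y)⁺ = y. The identity lets `G` be compared with either asymptote:
G(m, β) equals -βm + `posMean m` and also (1 - β)m + `posMean (-m)`. -/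
theorem posMean_neg (w : ℝ) : posMean (-w) = posMean w - w := by
  have hint : ∀ w : ℝ, Integrable (fun z : ℝ => max (w - z) 0) (gaussianReal 0 1) := fun w =>
    ((integrable_const w).sub (integrable_id_gaussianReal 0 1)).pos_part
  have hsub : Integrable (fun z : ℝ => w - z) (gaussianReal 0 1) :=
    (integrable_const w).sub (integrable_id_gaussianReal 0 1)
  have h1 : ∫ z, max (-w - z) 0 ∂(gaussianReal 0 1) = ∫ z, max (-w - -z) 0 ∂(gaussianReal 0 1) := by
    conv_lhs => rw [← neg_zero (G := ℝ), ← gaussianReal_map_neg]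
    rw [integral_map measurable_neg.aemeasurable]
    · simp
    · exact Continuous.aestronglyMeasurable (by fun_prop)
  rw [← integral_max_sub_gaussianReal, ← integral_max_sub_gaussianReal, h1]
  have h2 : ∀ z : ℝ, max (-w - -z) 0 = max (w - z) 0 - (w - z) := by
    intro z
    rcases le_total (w - z) 0 with h | h
    · rw [max_eq_left (by linarith), max_eq_right h]; ring
    · rw [max_eq_right (by linarith), max_eq_left h]; ring
  simp_rw [h2]
  rw [integral_sub (hint w) hsub, integral_sub (integrable_const w) (integrable_id_gaussianReal 0 1)]
  simp [integral_id_gaussianReal]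

theorem posMean_le_stdPdf {w : ℝ} (hw : w ≤ 0) : posMean w ≤ stdPdf w := by
  have := mul_nonpos_of_nonpos_of_nonneg hw (stdCdf_nonneg w)
  unfold posMean
  linarith

theorem posMean_le_of_nonneg {w : ℝ} (hw : 0 ≤ w) : posMean w ≤ 1 + w := by
  have := mul_le_of_le_one_right hw (stdCdf_le_one w)
  unfold posMean
  linarith [stdPdf_le_one w]

/-- The mean of the positive part of a normal variable with mean `s w` and variance `s²`. -/
theorem integral_max_gaussianReal (w : ℝ) {s : ℝ} (hs : 0 ≤ s) :
    ∫ y, max y 0 ∂(gaussianReal (s * w) (s ^ 2).toNNReal) = s * posMean w := by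
  have hmap : (gaussianReal 0 1).map (fun z => s * (w - z))
      = gaussianReal (s * w) (s ^ 2).toNNReal := by
    have : (fun z : ℝ => s * (w - z)) = (fun y => s * y) ∘ (fun z => w - z) := rfl
    rw [this, ← Measure.map_map (by fun_prop) (by fun_prop), gaussianReal_map_const_sub,
      gaussianReal_map_const_mul]
    congr 1
    · simp
    · ext; simp [sq_nonneg]
  rw [← hmap, integral_map (by fun_prop)
    (Continuous.aestronglyMeasurable (by fun_prop)), ← integral_max_sub_gaussianReal,
    ← integral_const_mul]
  refine integral_congr_ae (ae_of_all _ fun z => ?_)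
  simp only
  rw [mul_max_of_nonneg _ _ hs, mul_zero]

/-! ### Gaussian tail bounds. -/

/-- Chernoff bound for the upper tail of a normal law. -/
theorem gaussianReal_real_Ici_le (m : ℝ) {v : ℝ≥0} (hv : v ≠ 0) {t : ℝ} (ht : m ≤ t) :
    (gaussianReal m v).real (Set.Ici t) ≤ Real.exp (-(t - m) ^ 2 / (2 * v)) := by
  have hv0 : (0 : ℝ) < v := by positivity
  have h := measure_ge_le_exp_mul_mgf (μ := gaussianReal m v) (X := id) t
    (t := (t - m) / v) (div_nonneg (by linarith) hv0.le)
    (integrable_exp_mul_gaussianReal _)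
  rw [mgf_id_gaussianReal, ← Real.exp_add] at h
  refine le_trans (le_of_eq ?_) (h.trans (le_of_eq ?_))
  · rfl
  · congr 1
    field_simp
    ring

theorem gaussianReal_real_Iic_le (m : ℝ) {v : ℝ≥0} (hv : v ≠ 0) {t : ℝ} (ht : t ≤ m) :
    (gaussianReal m v).real (Set.Iic t) ≤ Real.exp (-(t - m) ^ 2 / (2 * v)) := by
  have h := gaussianReal_real_Ici_le (-m) hv (t := -t) (by linarith)
  have h2 : gaussianReal m v (Set.Iic t) = gaussianReal (-m) v (Set.Ici (-t)) := by
    rw [← gaussianReal_map_neg, Measure.map_apply measurable_neg measurableSet_Ici]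
    congr 1
    ext x
    simp
  rw [Measure.real, h2]
  refine h.trans (le_of_eq ?_)
  congr 2
  ring

/-- The probability that a normal variable with mean `m` and variance at most `3 / 16` lies in
`[-l, l]`. -/
theorem gaussianReal_real_Icc_le (m : ℝ) {v : ℝ≥0} (hv : v ≠ 0) (hv2 : (v : ℝ) ≤ 3 / 16) (l : ℝ) :
    (gaussianReal m v).real (Set.Icc (-l) l) ≤ Real.exp (-(8 / 3) * (max (|m| - l) 0) ^ 2) := by
  have hv0 : (0 : ℝ) < v := by positivity
  rcases le_total (|m| - l) 0 with h | h
  · rw [max_eq_right h]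
    simp [measureReal_le_one]
  rw [max_eq_left h]
  -- The constant 8/3 is 1/(2v) at the extreme variance v = 3/16.
  have key : ∀ y : ℝ, -y ^ 2 / (2 * v) ≤ -(8 / 3) * y ^ 2 := by
    intro y
    rw [div_le_iff₀ (by positivity)]
    nlinarith [sq_nonneg y]
  rcases le_total 0 m with hm | hm
  · rw [abs_of_nonneg hm] at *
    have h1 := gaussianReal_real_Iic_le m hv (t := l) (by linarith)
    refine (measureReal_mono (Set.Icc_subset_Iic_self)).trans (h1.trans ?_)
    apply Real.exp_le_exp.mpr
    refine (key _).trans (le_of_eq (by ring))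
  · rw [abs_of_nonpos hm] at *
    have h1 := gaussianReal_real_Ici_le m hv (t := -l) (by linarith)
    refine (measureReal_mono (Set.Icc_subset_Ici_self)).trans (h1.trans ?_)
    apply Real.exp_le_exp.mpr
    refine (key _).trans (le_of_eq (by ring))

/-! ### Independence of the two pseudo-samples. -/

/-- Adding and subtracting independent normal variables with equal variances gives independent
normal variables. -/
theorem map_add_sub_gaussianReal (θ c d : ℝ) {σ : ℝ} (hσ : 0 ≤ σ) :
    ((gaussianReal θ σ.toNNReal).prod (gaussianReal 0 1)).map
      (fun w : ℝ × ℝ => (c + d * (w.1 + √σ * w.2), c + d * (w.1 - √σ * w.2)))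
    = (gaussianReal (c + d * θ) (2 * σ * d ^ 2).toNNReal).prod
        (gaussianReal (c + d * θ) (2 * σ * d ^ 2).toNNReal) := by
  set P := (gaussianReal θ σ.toNNReal).prod (gaussianReal 0 1)
  have h1 : HasLaw (fun w : ℝ × ℝ => w.1) (gaussianReal θ σ.toNNReal) P :=
    ⟨by fun_prop, by simp [P]⟩
  have h2 : HasLaw (fun w : ℝ × ℝ => w.2) (gaussianReal 0 1) P :=
    ⟨by fun_prop, by simp [P]⟩
  have hind : IndepFun (fun w : ℝ × ℝ => w.1) (fun w : ℝ × ℝ => w.2) P :=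
    indepFun_prod (X := id) (Y := id) measurable_id measurable_id
  have hvar : (2 * σ * d ^ 2).toNNReal
      = (d ^ 2).toNNReal * σ.toNNReal + (d ^ 2).toNNReal * σ.toNNReal := by
    ext
    simp only [NNReal.coe_add, NNReal.coe_mul, Real.coe_toNNReal _ hσ,
      Real.coe_toNNReal _ (sq_nonneg d), Real.coe_toNNReal _ (show 0 ≤ 2 * σ * d ^ 2 by positivity)]
    ring
  -- Allowing either square root r of σ treats both marginals at once.
  have hlaw : ∀ r : ℝ, r ^ 2 = σ → P.map (fun w : ℝ × ℝ => c + d * (w.1 + r * w.2))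
      = gaussianReal (c + d * θ) (2 * σ * d ^ 2).toNNReal := by
    intro r hr
    have hl1 := gaussianReal_const_add (gaussianReal_const_mul h1 d) c
    have hl2 := gaussianReal_const_mul h2 (d * r)
    have hi : IndepFun (fun w : ℝ × ℝ => c + d * w.1) (fun w : ℝ × ℝ => d * r * w.2) P :=
      hind.comp (φ := fun x => c + d * x) (ψ := fun x => d * r * x) (by fun_prop) (by fun_prop)
    have h := gaussianReal_add_gaussianReal_of_indepFun hi hl1.map_eq hl2.map_eq
    convert h using 2
    · ext w
      simp only [Pi.add_apply]
      ring
    · ring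
    · rw [hvar]
      congr 1
      · ext; simp [sq_nonneg]
      · ext
        simp only [NNReal.coe_mul, Real.coe_toNNReal _ hσ, Real.coe_toNNReal _ (sq_nonneg d),
          NNReal.coe_mk, NNReal.coe_one]
        rw [mul_pow, hr, mul_one]
  have hG1 := h1.hasGaussianLaw
  have hG2 := h2.hasGaussianLaw
  have hm1 : MemLp (fun w : ℝ × ℝ => w.1) 2 P := hG1.memLp_two
  have hm2 : MemLp (fun w : ℝ × ℝ => w.2) 2 P := hG2.memLp_two
  have hjoint : HasGaussianLaw (fun w : ℝ × ℝ => (w.1 + √σ * w.2, w.1 - √σ * w.2)) P := by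
    have h := hind.hasGaussianLaw hG1 hG2
    exact h.map (((ContinuousLinearMap.fst ℝ ℝ ℝ) + √σ • (ContinuousLinearMap.snd ℝ ℝ ℝ)).prod
      ((ContinuousLinearMap.fst ℝ ℝ ℝ) - √σ • (ContinuousLinearMap.snd ℝ ℝ ℝ)))
  -- Joint normality reduces independence to zero covariance, and the covariance is Var X - σ Var Z
  -- = σ - σ.
  have hcov : cov[fun w : ℝ × ℝ => w.1 + √σ * w.2, fun w : ℝ × ℝ => w.1 - √σ * w.2; P] = 0 := by
    have hc12 := hind.covariance_eq_zero hm1 hm2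
    have e1 : (fun w : ℝ × ℝ => w.1 + √σ * w.2)
      = (fun w : ℝ × ℝ => w.1) + (fun w : ℝ × ℝ => √σ * w.2) := rfl
    have e2 : (fun w : ℝ × ℝ => w.1 - √σ * w.2)
      = (fun w : ℝ × ℝ => w.1) - (fun w : ℝ × ℝ => √σ * w.2) := rfl
    have hm2' : MemLp (fun w : ℝ × ℝ => √σ * w.2) 2 P := hm2.const_mul _
    have hv1 : Var[fun w : ℝ × ℝ => w.1; P] = σ := by
      rw [h1.variance_eq, variance_id_gaussianReal, Real.coe_toNNReal _ hσ]
    have hv2 : Var[fun w : ℝ × ℝ => w.2; P] = 1 := by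
      rw [h2.variance_eq, variance_id_gaussianReal, NNReal.coe_one]
    rw [e1, e2, covariance_add_left hm1 hm2' (hm1.sub hm2'),
      covariance_sub_right hm1 hm1 hm2', covariance_sub_right hm2' hm1 hm2',
      covariance_const_mul_right, covariance_const_mul_left, covariance_const_mul_left,
      covariance_const_mul_right, covariance_self hm1.aemeasurable, covariance_self hm2.aemeasurable,
      hv1, hv2, hc12, covariance_comm, hc12]
    linear_combination Real.mul_self_sqrt hσ * (-1 : ℝ)
  have hi2 := (hjoint.indepFun_of_covariance_eq_zero hcov).comp
    (φ := fun x => c + d * x) (ψ := fun x => c + d * x) (by fun_prop) (by fun_prop)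
  have := (indepFun_iff_map_prod_eq_prod_map_map (by fun_prop) (by fun_prop)).mp hi2
  have hl1 := hlaw (√σ) (Real.sq_sqrt hσ)
  have hl2 := hlaw (-√σ) (by rw [neg_sq, Real.sq_sqrt hσ])
  have e1 : (fun x : ℝ => c + d * x) ∘ (fun w : ℝ × ℝ => w.1 + √σ * w.2)
      = fun w : ℝ × ℝ => c + d * (w.1 + √σ * w.2) := rfl
  have e2 : (fun x : ℝ => c + d * x) ∘ (fun w : ℝ × ℝ => w.1 - √σ * w.2)
      = fun w : ℝ × ℝ => c + d * (w.1 + -√σ * w.2) := by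
    ext w
    simp only [Function.comp]
    ring
  rw [e1, e2, hl1, hl2] at this
  rw [← this]
  congr 1
  ext w
  · rfl
  · simp only
    ring

/-! ### Stein's identity and moments of the Hermite polynomials of variance v. -/

open Polynomial in
theorem integrable_eval_gaussianReal (m : ℝ) (v : ℝ≥0) (q : ℝ[X]) :
    Integrable (fun x => q.eval x) (gaussianReal m v) := by
  induction q using Polynomial.induction_on' with
  | add p q hp hq =>
    simp_rw [eval_add]
    exact hp.add hq
  | monomial n a =>
    simp_rw [eval_monomial]
    refine Integrable.const_mul ?_ a
    have h := (memLp_id_gaussianReal' (μ := m) (v := v) n (by simp)).integrable_norm_pow'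
    simp only [id, ← norm_pow] at h
    exact (integrable_norm_iff (by fun_prop)).mp h

theorem hasDerivAt_gaussianPDFReal (m : ℝ) {v : ℝ≥0} (x : ℝ) :
    HasDerivAt (gaussianPDFReal m v) (-((x - m) / v) * gaussianPDFReal m v x) x := by
  have h1 : HasDerivAt (fun x : ℝ => -(x - m) ^ 2 / (2 * v)) (-(2 * (x - m)) / (2 * v)) x := by
    simpa using ((((hasDerivAt_id x).sub_const m).pow 2).neg).div_const (2 * (v : ℝ))
  have h2 := (h1.exp).const_mul (√(2 * Real.pi * v))⁻¹
  refine h2.congr_deriv ?_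
  rw [gaussianPDFReal]
  by_cases hv : (v : ℝ) = 0
  · simp [hv]
  · field_simp

theorem integrable_smul_gaussianPDFReal {m : ℝ} {v : ℝ≥0} (hv : v ≠ 0) {f : ℝ → ℝ}
    (hf : Integrable f (gaussianReal m v)) : Integrable (fun x => f x * gaussianPDFReal m v x) := by
  rw [gaussianReal_of_var_ne_zero m hv] at hf
  have := (integrable_withDensity_iff_integrable_smul₀' (measurable_gaussianPDF m v).aemeasurable
    (ae_of_all _ fun x => gaussianPDF_lt_top)).mp hf
  simpa [toReal_gaussianPDF, mul_comm] using this

open Polynomial in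
/-- Stein's identity for polynomials. -/
theorem integral_sub_mul_eval_gaussianReal (m : ℝ) {v : ℝ≥0} (hv : v ≠ 0) (q : ℝ[X]) :
    ∫ x, (x - m) * q.eval x ∂(gaussianReal m v)
      = v * ∫ x, (derivative q).eval x ∂(gaussianReal m v) := by
  have hv0 : (v : ℝ) ≠ 0 := by exact_mod_cast hv
  have hI := integrable_smul_gaussianPDFReal hv
    (integrable_eval_gaussianReal m v ((X - C m) * q))
  simp only [eval_mul, eval_sub, eval_X, eval_C] at hI
  have h := integral_mul_deriv_eq_deriv_mul_of_integrable
    (u := fun x => q.eval x) (v := gaussianPDFReal m v)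
    (u' := fun x => (derivative q).eval x)
    (v' := fun x => -((x - m) / v) * gaussianPDFReal m v x)
    (fun x _ => q.hasDerivAt x) (fun x _ => hasDerivAt_gaussianPDFReal m x)
    (by
      refine (hI.const_mul (-(v : ℝ)⁻¹)).congr (ae_of_all _ fun x => ?_)
      simp only [Pi.mul_apply]
      field_simp)
    (integrable_smul_gaussianPDFReal hv (integrable_eval_gaussianReal m v (derivative q)))
    (integrable_smul_gaussianPDFReal hv (integrable_eval_gaussianReal m v q))
  rw [integral_gaussianReal_eq_integral_smul hv, integral_gaussianReal_eq_integral_smul hv]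
  have e1 : ∫ x, gaussianPDFReal m v x • ((x - m) * q.eval x)
      = -v * ∫ x, q.eval x * (-((x - m) / v) * gaussianPDFReal m v x) := by
    rw [← integral_const_mul]
    refine integral_congr_ae (ae_of_all _ fun x => ?_)
    simp only [smul_eq_mul]
    field_simp
  rw [e1, h]
  have e2 : ∫ x, gaussianPDFReal m v x • (derivative q).eval x
      = ∫ x, (derivative q).eval x * gaussianPDFReal m v x := by
    refine integral_congr_ae (ae_of_all _ fun x => ?_)
    simp only [smul_eq_mul, mul_comm]
  rw [e2]
  ring

open Polynomial in
/-- The Hermite polynomials for the variance `v`. -/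
noncomputable def hermiteVar (v : ℝ) : ℕ → ℝ[X]
  | 0 => 1
  | k + 1 => X * hermiteVar v k - C v * derivative (hermiteVar v k)

-- Identifies the recursive family with s^k H_k(x/s), so that `scaledHermite` can be handled through
-- the recursion.
open Polynomial in
theorem hermiteVar_sq (s : ℝ) (hs : s ≠ 0) (k : ℕ) :
    hermiteVar (s ^ 2) k
      = C (s ^ k) * ((hermite k).map (Int.castRingHom ℝ)).comp (C s⁻¹ * X) := by
  induction k with
  | zero => simp [hermiteVar]
  | succ k ih =>
    rw [hermiteVar, ih, hermite_succ]
    simp only [Polynomial.map_sub, Polynomial.map_mul, map_X, sub_comp, mul_comp, X_comp,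
      derivative_map, derivative_mul, derivative_C, derivative_comp, derivative_X]
    have h1 : (C (s ^ (k + 1)) * C s⁻¹ : ℝ[X]) = C (s ^ k) := by
      rw [← C_mul]
      congr 1
      field_simp
      ring
    have h2 : (C (s ^ 2) * C (s ^ k) * C s⁻¹ : ℝ[X]) = C (s ^ (k + 1)) := by
      rw [← C_mul, ← C_mul]
      congr 1
      field_simp
      ring
    simp only [zero_mul, zero_add, mul_one]
    linear_combination (- X * ((hermite k).map (Int.castRingHom ℝ)).comp (C s⁻¹ * X)) * h1
      - (((derivative (hermite k)).map (Int.castRingHom ℝ)).comp (C s⁻¹ * X)) * h2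

theorem scaledHermite_eq_eval (k : ℕ) {s : ℝ} (hs : s ≠ 0) (u : ℝ) :
    scaledHermite k s u = (hermiteVar (s ^ 2) k).eval u := by
  rw [scaledHermite_eq k hs, hermiteVar_sq s hs]
  simp [Polynomial.aeval_def, Polynomial.eval_map, div_eq_inv_mul]

open Polynomial in
theorem derivative_hermiteVar (v : ℝ) (k : ℕ) :
    derivative (hermiteVar v (k + 1)) = (k + 1 : ℝ) • hermiteVar v k := by
  induction k with
  | zero => simp [hermiteVar]
  | succ k ih =>
    rw [hermiteVar, derivative_sub, derivative_mul, derivative_C_mul, ih, derivative_smul]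
    conv_rhs => rw [hermiteVar]
    simp only [derivative_X, smul_eq_C_mul, Nat.cast_add, Nat.cast_one, C_add, C_1]
    rw [hermiteVar]
    ring

open Polynomial in
theorem iterate_derivative_hermiteVar (v : ℝ) (i k : ℕ) :
    derivative^[i] (hermiteVar v (k + i)) = ((k + i).descFactorial i : ℝ) • hermiteVar v k := by
  induction i with
  | zero => simp
  | succ i ih =>
    rw [Function.iterate_succ_apply, ← add_assoc, derivative_hermiteVar, iterate_derivative_smul,
      ih, smul_smul]
    congr 1
    rw [Nat.succ_descFactorial_succ]
    push_cast
    ring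

open Polynomial in
/-- The operator `m + v D` on polynomials. -/
noncomputable def shiftOp (m v : ℝ) : Module.End ℝ ℝ[X] :=
  m • (1 : Module.End ℝ ℝ[X]) + v • derivative

-- By Stein's identity, multiplication by x under the integral is dual to the operator g ↦ m g + v
-- g' up to the term in which the derivative falls on the Hermite factor; the recursion for
-- `hermiteVar` cancels exactly that term. Taking g = 1 gives unbiasedness for m^k, and taking g
-- equal to the polynomial itself gives its second moment.
open Polynomial in
theorem integral_hermiteVar_mul (m : ℝ) {v : ℝ≥0} (hv : v ≠ 0) (k : ℕ) (g : ℝ[X]) :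
    ∫ x, (hermiteVar v k * g).eval x ∂(gaussianReal m v)
      = ∫ x, ((shiftOp m v ^ k) g).eval x
          ∂(gaussianReal m v) := by
  induction k generalizing g with
  | zero => simp [hermiteVar]
  | succ k ih =>
    rw [pow_succ, Module.End.mul_apply, ← ih]
    have h := integral_sub_mul_eval_gaussianReal m hv (hermiteVar v k * g)
    have hI := fun q => integrable_eval_gaussianReal m v q
    have e1 : ∀ x, (hermiteVar v (k + 1) * g).eval x
        = (x - m) * (hermiteVar v k * g).eval x + m * (hermiteVar v k * g).eval x
          - v * (derivative (hermiteVar v k) * g).eval x := by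
      intro x
      simp only [hermiteVar, eval_mul, eval_sub, eval_X, eval_C]
      ring
    have hI0 : Integrable (fun x => (x - m) * (hermiteVar v k * g).eval x) (gaussianReal m v) := by
      have := hI ((X - C m) * (hermiteVar v k * g))
      simpa only [eval_mul, eval_sub, eval_X, eval_C] using this
    have hI1 : Integrable (fun x => (x - m) * (hermiteVar v k * g).eval x
        + m * (hermiteVar v k * g).eval x) (gaussianReal m v) := hI0.add ((hI _).const_mul _)
    have hI2 : Integrable (fun x => v * (derivative (hermiteVar v k * g)).eval x
        - v * (derivative (hermiteVar v k) * g).eval x) (gaussianReal m v) :=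
      ((hI _).const_mul _).sub ((hI _).const_mul _)
    simp_rw [e1]
    rw [integral_sub hI1 ((hI _).const_mul _), integral_add hI0 ((hI _).const_mul _), h, integral_const_mul, integral_const_mul]
    have e2 : ∀ x, (hermiteVar v k * (shiftOp m v g)).eval x
        = m * (hermiteVar v k * g).eval x + (v * (derivative (hermiteVar v k * g)).eval x
          - v * (derivative (hermiteVar v k) * g).eval x) := by
      intro x
      simp only [shiftOp, LinearMap.add_apply, LinearMap.smul_apply, Module.End.one_apply, eval_mul,
        eval_add, eval_smul, derivative_mul, smul_eq_mul]
      ring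
    simp_rw [e2]
    rw [integral_add ((hI _).const_mul _) hI2,
      integral_sub ((hI _).const_mul _) ((hI _).const_mul _), integral_const_mul,
      integral_const_mul, integral_const_mul]
    ring

open Polynomial in
theorem shift_pow_apply (m v : ℝ) (k : ℕ) (g : ℝ[X]) :
    (shiftOp m v ^ k) g
      = ∑ j ∈ Finset.range (k + 1), (m ^ j * v ^ (k - j) * (k.choose j : ℝ)) •
          derivative^[k - j] g := by
  have hc : Commute (m • (1 : Module.End ℝ ℝ[X])) (v • derivative) :=
    ((Commute.one_left _).smul_left m).smul_right v
  rw [shiftOp, hc.add_pow, LinearMap.sum_apply]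
  refine Finset.sum_congr rfl fun j _ => ?_
  rw [_root_.smul_pow, _root_.smul_pow, one_pow, ← nsmul_eq_mul', LinearMap.smul_apply,
    smul_mul_smul_comm, one_mul, LinearMap.smul_apply, Module.End.pow_apply,
    ← Nat.cast_smul_eq_nsmul ℝ, smul_smul, mul_comm (k.choose j : ℝ)]

theorem integral_hermiteVar (m : ℝ) {v : ℝ≥0} (hv : v ≠ 0) (k : ℕ) :
    ∫ x, (hermiteVar v k).eval x ∂(gaussianReal m v) = m ^ k := by
  have h := integral_hermiteVar_mul m hv k 1
  rw [mul_one, shift_pow_apply] at h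
  rw [h, Finset.sum_eq_single k]
  · simp
  · intro j hj hjk
    have : 0 < k - j := by have := Finset.mem_range.mp hj; omega
    obtain ⟨i, hi⟩ := Nat.exists_eq_succ_of_ne_zero this.ne'
    rw [hi, Function.iterate_succ_apply, Polynomial.derivative_one,
      Polynomial.iterate_derivative_zero, smul_zero]
  · simp

/-- Expand (m + vD)^k by the binomial theorem. Since D^(k-j) maps the k-th polynomial to k!/j! times
the j-th, whose mean is m^j, every term is explicit. -/
theorem integral_hermiteVar_sq (m : ℝ) {v : ℝ≥0} (hv : v ≠ 0) (k : ℕ) :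
    ∫ x, (hermiteVar v k).eval x ^ 2 ∂(gaussianReal m v)
      = ∑ j ∈ Finset.range (k + 1), (k.factorial : ℝ) * ((m ^ 2) ^ j / j.factorial) * v ^ (k - j)
          * (k.choose j : ℝ) := by
  have h := integral_hermiteVar_mul m hv k (hermiteVar v k)
  simp_rw [sq, ← Polynomial.eval_mul]
  rw [h, shift_pow_apply]
  simp_rw [Polynomial.eval_finsetSum, Polynomial.eval_smul, smul_eq_mul]
  rw [integral_finsetSum _ (fun j _ => (integrable_eval_gaussianReal m v _).const_mul _)]
  refine Finset.sum_congr rfl fun j hj => ?_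
  have hjk : j ≤ k := Nat.lt_succ_iff.mp (Finset.mem_range.mp hj)
  have hd : Polynomial.derivative^[k - j] (hermiteVar v k)
      = (k.descFactorial (k - j) : ℝ) • hermiteVar v j := by
    have := iterate_derivative_hermiteVar v (k - j) j
    rwa [Nat.add_sub_cancel' hjk] at this
  simp_rw [hd, Polynomial.eval_smul, smul_eq_mul]
  rw [integral_const_mul, integral_const_mul, integral_hermiteVar m hv]
  have hf : (k.descFactorial (k - j) : ℝ) = k.factorial / j.factorial := by
    rw [eq_div_iff (by positivity)]
    have := Nat.factorial_mul_descFactorial (Nat.sub_le k j)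
    rw [Nat.sub_sub_self hjk] at this
    exact_mod_cast (mul_comm _ _).trans this
  rw [hf]
  ring

/-- Bounding (m²)^j / j! by q^j exp(m²/q) lets the binomial sum close up to (q + v)^k. The parameter
q trades growth in k against growth in m. -/
theorem integral_hermiteVar_sq_le (m : ℝ) {v : ℝ≥0} (hv : v ≠ 0) {q : ℝ} (hq : 0 < q) (k : ℕ) :
    ∫ x, (hermiteVar v k).eval x ^ 2 ∂(gaussianReal m v)
      ≤ k.factorial * (q + v) ^ k * Real.exp (m ^ 2 / q) := by
  rw [integral_hermiteVar_sq m hv, add_pow, Finset.mul_sum, Finset.sum_mul]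
  refine Finset.sum_le_sum fun j _ => ?_
  have h := Real.pow_div_factorial_le_exp (m ^ 2 / q) (by positivity) j
  have h2 : (m ^ 2) ^ j / j.factorial ≤ q ^ j * Real.exp (m ^ 2 / q) := by
    calc (m ^ 2) ^ j / j.factorial = q ^ j * ((m ^ 2 / q) ^ j / j.factorial) := by
          rw [div_pow]; field_simp
      _ ≤ _ := by gcongr
  calc (k.factorial : ℝ) * ((m ^ 2) ^ j / j.factorial) * v ^ (k - j) * (k.choose j : ℝ)
      ≤ k.factorial * (q ^ j * Real.exp (m ^ 2 / q)) * v ^ (k - j) * (k.choose j : ℝ) := by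
        gcongr
    _ = _ := by ring

/-! ### Taylor coefficients of `G` and the second moment of the Hermite estimate. -/

theorem hermite_eval_zero_odd (j : ℕ) : ((Polynomial.hermite (2 * j + 1)).eval 0 : ℤ) = 0 := by
  rw [← Polynomial.coeff_zero_eq_eval_zero]
  exact Polynomial.coeff_hermite_of_odd_add ⟨j, by ring⟩

theorem hermite_eval_zero_even (j : ℕ) :
    (((Polynomial.hermite (2 * j)).eval 0 : ℤ) : ℝ) = (-1) ^ j * ((2 * j).factorial / (2 ^ j * j.factorial)) := by
  rw [← Polynomial.coeff_zero_eq_eval_zero]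
  have h := Polynomial.coeff_hermite_explicit j 0
  rw [add_zero] at h
  rw [h]
  have h2 : (2 * j).factorial = 2 ^ j * j.factorial * (2 * j - 1).doubleFactorial := by
    rw [← Nat.doubleFactorial_two_mul]
    cases j with
    | zero => simp
    | succ j =>
      have := Nat.factorial_eq_mul_doubleFactorial (2 * j + 1)
      exact this
  rw [h2]
  push_cast
  field_simp
  simp

/-- In even degree 2j the square is (2j)! · C(2j, j) / 4^j, and a binomial coefficient of 2j is at
most 4^j. -/
theorem hermite_eval_zero_sq_le (k : ℕ) :
    (((Polynomial.hermite k).eval 0 : ℤ) : ℝ) ^ 2 ≤ k.factorial := by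
  rcases Nat.even_or_odd' k with ⟨j, rfl | rfl⟩
  · rw [hermite_eval_zero_even]
    have h1 : ((2 * j).factorial : ℝ) = (2 * j).choose j * j.factorial * j.factorial := by
      have := Nat.choose_mul_factorial_mul_factorial (show j ≤ 2 * j by omega)
      rw [show 2 * j - j = j by omega] at this
      exact_mod_cast this.symm
    have h2 : ((2 * j).choose j : ℝ) ≤ (2 ^ j) ^ 2 := by
      rw [← pow_mul, mul_comm j 2]
      exact_mod_cast Nat.choose_le_two_pow (2 * j) j
    rw [mul_pow, ← pow_mul, mul_comm j 2, pow_mul, neg_one_sq, one_pow, one_mul, div_pow,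
      div_le_iff₀ (by positivity), sq, mul_pow]
    refine mul_le_mul_of_nonneg_left ?_ (by positivity)
    rw [h1]
    have : (0 : ℝ) ≤ j.factorial * j.factorial := by positivity
    nlinarith
  · rw [hermite_eval_zero_odd]
    simp

/-- The Taylor coefficients of `G(·, β)` at `0`. -/
noncomputable def taylorCoeff (β : ℝ) : ℕ → ℝ
  | 0 => stdPdf 0
  | 1 => stdCdf 0 - β
  | k + 2 => stdPdf 0 * ((-1) ^ k * (((Polynomial.hermite k).eval 0 : ℤ) : ℝ)
      / ((k + 2).factorial : ℝ))

/-- This cancels the k! in the second moment of the k-th Hermite polynomial. -/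
theorem taylorCoeff_sq_mul_factorial_le {β : ℝ} (h0 : 0 ≤ β) (h1 : β ≤ 1) (k : ℕ) :
    taylorCoeff β k ^ 2 * k.factorial ≤ 1 := by
  match k with
  | 0 =>
    have := stdPdf_le_one 0
    have := stdPdf_nonneg 0
    simp only [taylorCoeff, Nat.factorial_zero, Nat.cast_one, mul_one]
    nlinarith
  | 1 =>
    have := stdCdf_le_one 0
    have := stdCdf_nonneg 0
    simp only [taylorCoeff, Nat.factorial_one, Nat.cast_one, mul_one]
    nlinarith
  | k + 2 =>
    have hp := stdPdf_le_one 0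
    have hp0 := stdPdf_nonneg 0
    have hk := hermite_eval_zero_sq_le k
    have hf : (k.factorial : ℝ) ≤ (k + 2).factorial := by
      exact_mod_cast Nat.factorial_le (by omega)
    have hpos : (0 : ℝ) < (k + 2).factorial := by positivity
    simp only [taylorCoeff]
    set H := (((Polynomial.hermite k).eval 0 : ℤ) : ℝ)
    have e : (stdPdf 0 * ((-1) ^ k * H / ((k + 2).factorial : ℝ))) ^ 2 * (k + 2).factorial
        = stdPdf 0 ^ 2 * (H ^ 2 / (k + 2).factorial) := by
      have : ((-1 : ℝ) ^ k) ^ 2 = 1 := by rw [← pow_mul, mul_comm, pow_mul]; simp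
      rw [mul_pow, div_pow, mul_pow, this]
      field_simp
    rw [e]
    have h2 : H ^ 2 / (k + 2).factorial ≤ 1 := (div_le_one hpos).mpr (hk.trans hf)
    have h3 : stdPdf 0 ^ 2 ≤ 1 := by nlinarith
    exact mul_le_one₀ h3 (by positivity) h2

open Polynomial in
/-- The Taylor polynomial of `G(·, β)` with powers replaced by Hermite polynomials. -/
noncomputable def estPoly (β v : ℝ) (N : ℕ) : ℝ[X] :=
  ∑ k ∈ Finset.range N, C (taylorCoeff β k) * hermiteVar v k

theorem eval_estPoly (β v : ℝ) (N : ℕ) (u : ℝ) :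
    (estPoly β v N).eval u = ∑ k ∈ Finset.range N, taylorCoeff β k * (hermiteVar v k).eval u := by
  simp [estPoly, Polynomial.eval_finsetSum]

theorem integral_estPoly (β m : ℝ) {v : ℝ≥0} (hv : v ≠ 0) (N : ℕ) :
    ∫ u, (estPoly β v N).eval u ∂(gaussianReal m v)
      = ∑ k ∈ Finset.range N, taylorCoeff β k * m ^ k := by
  simp_rw [eval_estPoly]
  rw [integral_finsetSum _ (fun j _ => (integrable_eval_gaussianReal m v _).const_mul _)]
  simp_rw [integral_const_mul, integral_hermiteVar m hv]

/-- Cauchy–Schwarz with the weights (19/20)^k, whose sum is at most 20. With q = 7/10 the k-th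
second moment, weighted by its coefficient, again decays like (19/20)^k; the second geometric sum
makes the constant 20 · 20 = 400. The bound does not depend on the number of terms. -/
theorem integral_estPoly_sq_le {β : ℝ} (h0 : 0 ≤ β) (h1 : β ≤ 1) (m : ℝ) {v : ℝ≥0} (hv : v ≠ 0)
    (hv2 : (v : ℝ) ≤ 3 / 16) (N : ℕ) :
    ∫ u, (estPoly β v N).eval u ^ 2 ∂(gaussianReal m v) ≤ 400 * Real.exp (m ^ 2 / (7 / 10)) := by
  have hgeom : ∑ k ∈ Finset.range N, (19 / 20 : ℝ) ^ k ≤ 20 := by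
    have := (summable_geometric_of_lt_one (show (0:ℝ) ≤ 19 / 20 by norm_num) (by norm_num)).sum_le_tsum
      (Finset.range N) (fun i _ => by positivity)
    rw [tsum_geometric_of_lt_one (by norm_num) (by norm_num)] at this
    linarith
  have hsq : ∀ k, Integrable (fun u => (hermiteVar v k).eval u ^ 2) (gaussianReal m v) := by
    intro k
    have := integrable_eval_gaussianReal m v (hermiteVar v k ^ 2)
    simpa only [Polynomial.eval_pow] using this
  have hpt : ∀ u, (estPoly β v N).eval u ^ 2 ≤ 20 * ∑ k ∈ Finset.range N,
      ((19 / 20 : ℝ) ^ k)⁻¹ * taylorCoeff β k ^ 2 * (hermiteVar v k).eval u ^ 2 := by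
    intro u
    rw [eval_estPoly]
    refine (Finset.sum_sq_le_sum_mul_sum_of_sq_le_mul (Finset.range N)
      (f := fun k => (19 / 20 : ℝ) ^ k)
      (g := fun k => ((19 / 20 : ℝ) ^ k)⁻¹ * taylorCoeff β k ^ 2 * (hermiteVar v k).eval u ^ 2)
      (fun k _ => by positivity) (fun k _ => by positivity) (fun k _ => ?_)).trans ?_
    · exact le_of_eq (by field_simp)
    · gcongr
  have hint : Integrable (fun u => 20 * ∑ k ∈ Finset.range N,
      ((19 / 20 : ℝ) ^ k)⁻¹ * taylorCoeff β k ^ 2 * (hermiteVar v k).eval u ^ 2)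
      (gaussianReal m v) :=
    (integrable_finsetSum _ fun k _ => (hsq k).const_mul _).const_mul _
  have hS : Integrable (fun u => (estPoly β v N).eval u ^ 2) (gaussianReal m v) := by
    have := integrable_eval_gaussianReal m v (estPoly β v N ^ 2)
    simpa only [Polynomial.eval_pow] using this
  refine (integral_mono hS hint hpt).trans ?_
  rw [integral_const_mul, integral_finsetSum _ (fun k _ => (hsq k).const_mul _)]
  simp_rw [integral_const_mul]
  have hterm : ∀ k, ((19 / 20 : ℝ) ^ k)⁻¹ * taylorCoeff β k ^ 2
        * ∫ u, (hermiteVar v k).eval u ^ 2 ∂(gaussianReal m v)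
      ≤ (19 / 20 : ℝ) ^ k * Real.exp (m ^ 2 / (7 / 10)) := by
    intro k
    have hA := integral_hermiteVar_sq_le m hv (show (0 : ℝ) < 7 / 10 by norm_num) k
    -- Here 7/10 + 3/16 = 0.8875 is below (19/20)² = 0.9025.
    have hq : (7 / 10 + (v : ℝ)) ^ k ≤ ((19 / 20 : ℝ) ^ k) * (19 / 20 : ℝ) ^ k := by
      rw [← mul_pow]
      gcongr
      linarith
    have hc := taylorCoeff_sq_mul_factorial_le h0 h1 k
    calc ((19 / 20 : ℝ) ^ k)⁻¹ * taylorCoeff β k ^ 2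
          * ∫ u, (hermiteVar v k).eval u ^ 2 ∂(gaussianReal m v)
        ≤ ((19 / 20 : ℝ) ^ k)⁻¹ * taylorCoeff β k ^ 2 * (k.factorial
          * (((19 / 20 : ℝ) ^ k) * (19 / 20 : ℝ) ^ k) * Real.exp (m ^ 2 / (7 / 10))) := by
          refine mul_le_mul_of_nonneg_left (hA.trans ?_) (by positivity)
          gcongr
      _ = (taylorCoeff β k ^ 2 * k.factorial)
          * ((19 / 20 : ℝ) ^ k * Real.exp (m ^ 2 / (7 / 10))) := by
          field_simp
      _ ≤ 1 * ((19 / 20 : ℝ) ^ k * Real.exp (m ^ 2 / (7 / 10))) := by gcongr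
      _ = _ := one_mul _
  have := Finset.sum_le_sum fun k (_ : k ∈ Finset.range N) => hterm k
  rw [← Finset.sum_mul] at this
  have h3 : (∑ k ∈ Finset.range N, (19 / 20 : ℝ) ^ k) * Real.exp (m ^ 2 / (7 / 10))
      ≤ 20 * Real.exp (m ^ 2 / (7 / 10)) := by gcongr
  linarith

/-! ### The Taylor remainder of `G`. -/

theorem nonneg_of_hasDerivAt_nonneg {f f' : ℝ → ℝ} (h : ∀ x, HasDerivAt f (f' x) x)
    (h0 : f 0 = 0) (hn : ∀ x, 0 ≤ x → 0 ≤ f' x) {x : ℝ} (hx : 0 ≤ x) : 0 ≤ f x := by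
  have hm : MonotoneOn f (Set.Ici 0) := by
    refine monotoneOn_of_deriv_nonneg (convex_Ici 0)
      (fun y _ => (h y).continuousAt.continuousWithinAt)
      (fun y _ => (h y).differentiableAt.differentiableWithinAt) fun y hy => ?_
    rw [interior_Ici] at hy
    rw [(h y).deriv]
    exact hn y (le_of_lt hy)
  have := hm (Set.mem_Ici.mpr le_rfl) (Set.mem_Ici.mpr hx) hx
  rwa [h0] at this

theorem hasDerivAt_pow_div_factorial (J : ℕ) (x : ℝ) :
    HasDerivAt (fun x : ℝ => x ^ (J + 1) / (J + 1).factorial) (x ^ J / J.factorial) x := by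
  refine ((hasDerivAt_pow (J + 1) x).div_const _).congr_deriv ?_
  rw [Nat.factorial_succ]
  push_cast
  field_simp

/-- The partial sums of the series of `exp (-y)` enclose it. -/
theorem exp_neg_sub_sum_mem (J : ℕ) {y : ℝ} (hy : 0 ≤ y) :
    0 ≤ (-1) ^ J * (Real.exp (-y) - ∑ j ∈ Finset.range J, (-1) ^ j * (y ^ j / j.factorial)) ∧
    (-1) ^ J * (Real.exp (-y) - ∑ j ∈ Finset.range J, (-1) ^ j * (y ^ j / j.factorial))
      ≤ y ^ J / J.factorial := by
  induction J generalizing y with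
  | zero =>
    simp only [pow_zero, one_mul, Finset.range_zero, Finset.sum_empty, sub_zero,
      Nat.factorial_zero, Nat.cast_one, div_one]
    exact ⟨(Real.exp_pos _).le, Real.exp_le_one_iff.mpr (by linarith)⟩
  | succ J ih =>
    have hsum : ∀ x, HasDerivAt (fun y : ℝ => ∑ j ∈ Finset.range (J + 1),
        (-1) ^ j * (y ^ j / j.factorial))
        (∑ j ∈ Finset.range J, (-1) ^ (j + 1) * (x ^ j / j.factorial)) x := by
      intro x
      simp_rw [Finset.sum_range_succ' _ J]
      simp only [pow_zero, Nat.factorial_zero, Nat.cast_one, div_one, mul_one]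
      refine HasDerivAt.add_const _ (HasDerivAt.fun_sum fun j _ => ?_)
      exact (hasDerivAt_pow_div_factorial j x).const_mul _
    -- The signed remainder of order J + 1 vanishes at 0 and its derivative is the signed remainder
    -- of order J, so both bounds of the induction hypothesis integrate.
    have hder : ∀ x, HasDerivAt (fun y : ℝ => (-1) ^ (J + 1) * (Real.exp (-y)
          - ∑ j ∈ Finset.range (J + 1), (-1) ^ j * (y ^ j / j.factorial)))
        ((-1) ^ J * (Real.exp (-x) - ∑ j ∈ Finset.range J, (-1) ^ j * (x ^ j / j.factorial))) x := by
      intro x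
      have he : HasDerivAt (fun y : ℝ => Real.exp (-y)) (-Real.exp (-x)) x := by
        simpa using (hasDerivAt_neg x).exp
      refine ((he.sub (hsum x)).const_mul ((-1 : ℝ) ^ (J + 1))).congr_deriv ?_
      simp only [pow_succ, mul_neg_one, neg_mul, Finset.sum_neg_distrib]
      ring
    have hz : ∑ j ∈ Finset.range (J + 1), (-1 : ℝ) ^ j * ((0 : ℝ) ^ j / j.factorial) = 1 := by
      rw [Finset.sum_range_succ']
      simp
    constructor
    · exact nonneg_of_hasDerivAt_nonneg hder (by rw [hz]; simp) (fun x hx => (ih hx).1) hy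
    · have hd2 := fun x => (hasDerivAt_pow_div_factorial J x).sub (hder x)
      have := nonneg_of_hasDerivAt_nonneg hd2 (by simp only [Pi.sub_apply]; rw [hz]; simp)
        (fun x hx => by linarith [(ih hx).2]) hy
      simp only [Pi.sub_apply] at this
      linarith

theorem abs_exp_neg_sub_sum_le (J : ℕ) {y : ℝ} (hy : 0 ≤ y) :
    |Real.exp (-y) - ∑ j ∈ Finset.range J, (-1) ^ j * (y ^ j / j.factorial)|
      ≤ y ^ J / J.factorial := by
  obtain ⟨h1, h2⟩ := exp_neg_sub_sum_mem J hy
  calc _ = |(-1) ^ J * (Real.exp (-y)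
        - ∑ j ∈ Finset.range J, (-1) ^ j * (y ^ j / j.factorial))| := by
        rw [abs_mul, abs_pow, abs_neg, abs_one, one_pow, one_mul]
    _ = _ := abs_of_nonneg h1
    _ ≤ _ := h2

theorem sum_hermite_even (J : ℕ) (t : ℝ) :
    ∑ k ∈ Finset.range (2 * J), (-1) ^ k * (((Polynomial.hermite k).eval 0 : ℤ) : ℝ)
        / (k.factorial : ℝ) * t ^ k
      = ∑ j ∈ Finset.range J, (-1) ^ j * ((t ^ 2 / 2) ^ j / j.factorial) := by
  induction J with
  | zero => simp
  | succ J ih =>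
    rw [show 2 * (J + 1) = 2 * J + 1 + 1 by ring, Finset.sum_range_succ, Finset.sum_range_succ,
      Finset.sum_range_succ, ih, hermite_eval_zero_odd, hermite_eval_zero_even]
    have : (-1 : ℝ) ^ (2 * J) = 1 := by rw [pow_mul]; simp
    rw [this, Int.cast_zero, div_pow, ← pow_mul]
    field_simp
    ring

/-- The odd terms vanish, so N Hermite terms are the first ⌈N/2⌉ terms of the series of exp(-t²/2).
-/
theorem sum_hermite (N : ℕ) (t : ℝ) :
    ∑ k ∈ Finset.range N, (-1) ^ k * (((Polynomial.hermite k).eval 0 : ℤ) : ℝ)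
        / (k.factorial : ℝ) * t ^ k
      = ∑ j ∈ Finset.range ((N + 1) / 2), (-1) ^ j * ((t ^ 2 / 2) ^ j / j.factorial) := by
  rcases Nat.even_or_odd' N with ⟨J, rfl | rfl⟩
  · rw [show (2 * J + 1) / 2 = J by omega, sum_hermite_even]
  · rw [show (2 * J + 1 + 1) / 2 = J + 1 by omega, ← sum_hermite_even,
      show 2 * (J + 1) = 2 * J + 1 + 1 by ring, Finset.sum_range_succ _ (2 * J + 1),
      hermite_eval_zero_odd]
    simp

theorem abs_le_of_hasDerivAt_of_abs_le {f f' : ℝ → ℝ} (h : ∀ x, HasDerivAt f (f' x) x)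
    (h0 : f 0 = 0) {M B : ℝ} (hB : ∀ x, |x| ≤ M → |f' x| ≤ B) {x : ℝ} (hx : |x| ≤ M) :
    |f x| ≤ B * |x| := by
  have hM : 0 ≤ M := (abs_nonneg x).trans hx
  have := (convex_Icc (-M) M).norm_image_sub_le_of_norm_hasDerivWithin_le
    (f := f) (f' := f') (C := B) (x := 0) (y := x)
    (fun y _ => (h y).hasDerivWithinAt) (fun y hy => hB y (abs_le.mpr hy))
    ⟨by linarith, hM⟩ (abs_le.mp hx)
  simpa [h0] using this

/-- The remainder of the Taylor polynomials of `G(·, β)`. -/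
theorem abs_G_sub_taylor_le (β m : ℝ) (N : ℕ) :
    |G m β - ∑ k ∈ Finset.range (N + 2), taylorCoeff β k * m ^ k|
      ≤ m ^ 2 * ((m ^ 2 / 2) ^ ((N + 1) / 2) / ((N + 1) / 2).factorial) := by
  set J := (N + 1) / 2
  set a : ℕ → ℝ := fun k => (-1) ^ k * (((Polynomial.hermite k).eval 0 : ℤ) : ℝ) with ha
  set B := (m ^ 2 / 2) ^ J / J.factorial
  -- The second derivative of `G` is φ = φ(0) exp(-x²/2), whose series has an alternating remainder.
  -- Two applications of the mean value inequality carry the bound back to `G`, each costing a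
  -- factor |m|.
  have hB2 : ∀ x, |x| ≤ |m| →
      |stdPdf x - stdPdf 0 * ∑ k ∈ Finset.range N, a k / (k.factorial : ℝ) * x ^ k| ≤ B := by
    intro x hx
    have e : stdPdf x = stdPdf 0 * Real.exp (-(x ^ 2 / 2)) := by
      rw [stdPdf_eq, stdPdf_eq]
      simp [neg_div]
    rw [ha, sum_hermite, e, ← mul_sub, abs_mul, abs_of_nonneg (stdPdf_nonneg 0)]
    have h1 := abs_exp_neg_sub_sum_le J (show 0 ≤ x ^ 2 / 2 by positivity)
    have h2 : (x ^ 2 / 2) ^ J / J.factorial ≤ B := by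
      have := sq_le_sq.mpr hx
      simp only [B]
      gcongr
    exact (mul_le_of_le_one_left (abs_nonneg _) (stdPdf_le_one 0)).trans (h1.trans h2)
  have hd1 : ∀ x, HasDerivAt (fun x => stdCdf x - stdCdf 0
      - stdPdf 0 * ∑ k ∈ Finset.range N, a k * (x ^ (k + 1) / (k + 1).factorial))
      (stdPdf x - stdPdf 0 * ∑ k ∈ Finset.range N, a k / (k.factorial : ℝ) * x ^ k) x := by
    intro x
    refine ((hasDerivAt_stdCdf x).sub_const _).sub
      ((HasDerivAt.fun_sum fun k _ => ?_).const_mul _)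
    exact ((hasDerivAt_pow_div_factorial k x).const_mul (a k)).congr_deriv (by ring)
  have hB1 : ∀ x, |x| ≤ |m| → |stdCdf x - stdCdf 0
      - stdPdf 0 * ∑ k ∈ Finset.range N, a k * (x ^ (k + 1) / (k + 1).factorial)| ≤ B * |m| := by
    intro x hx
    refine (abs_le_of_hasDerivAt_of_abs_le hd1 (by simp) hB2 hx).trans ?_
    have : 0 ≤ B := by positivity
    gcongr
  have hd0 : ∀ x, HasDerivAt (fun x => G x β - stdPdf 0 - (stdCdf 0 - β) * x
      - stdPdf 0 * ∑ k ∈ Finset.range N, a k * (x ^ (k + 1 + 1) / (k + 1 + 1).factorial))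
      (stdCdf x - stdCdf 0
      - stdPdf 0 * ∑ k ∈ Finset.range N, a k * (x ^ (k + 1) / (k + 1).factorial)) x := by
    intro x
    have h1 := (((hasDerivAt_G x β).sub_const (stdPdf 0)).sub
      ((hasDerivAt_id x).const_mul (stdCdf 0 - β))).sub
      ((HasDerivAt.fun_sum fun k (_ : k ∈ Finset.range N) =>
        (hasDerivAt_pow_div_factorial (k + 1) x).const_mul (a k)).const_mul (stdPdf 0))
    exact h1.congr_deriv (by ring)
  have hfin := abs_le_of_hasDerivAt_of_abs_le hd0 (by simp [G, stdPdf]) hB1 le_rfl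
  have e : ∑ k ∈ Finset.range (N + 2), taylorCoeff β k * m ^ k
      = stdPdf 0 + (stdCdf 0 - β) * m
        + stdPdf 0 * ∑ k ∈ Finset.range N, a k * (m ^ (k + 1 + 1) / (k + 1 + 1).factorial) := by
    rw [Finset.sum_range_succ', Finset.sum_range_succ', Finset.mul_sum]
    simp only [taylorCoeff, zero_add, pow_zero, mul_one, pow_one]
    have h : ∀ k, stdPdf 0 * ((-1) ^ k * (((Polynomial.hermite k).eval 0 : ℤ) : ℝ)
        / ((k + 2).factorial : ℝ)) * m ^ (k + 1 + 1)
        = stdPdf 0 * (a k * (m ^ (k + 1 + 1) / (k + 1 + 1).factorial)) := by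
      intro k
      simp only [ha]
      ring
    simp_rw [h]
    ring
  rw [e]
  refine le_trans (le_of_eq ?_) (hfin.trans (le_of_eq ?_))
  · congr 1
    ring
  · rw [mul_assoc, abs_mul_abs_self]
    ring

/-! ### Bias and second moment of the threshold estimate. -/

/-- The second coordinate only selects the branch and the first only supplies the value, so by
independence each branch contributes a product. It serves both the estimate and its centered square.
-/
theorem integrable_piecewise_prod {ν : Measure ℝ} [IsProbabilityMeasure ν] {f g h : ℝ → ℝ}
    (hf : Integrable f ν) (hg : Integrable g ν) (hh : Integrable h ν) {l : ℝ} (hl : 0 ≤ l) :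
    Integrable (fun w : ℝ × ℝ => if w.2 < -l then f w.1 else if w.2 ≤ l then g w.1 else h w.1)
      (ν.prod ν) ∧
    ∫ w, (if w.2 < -l then f w.1 else if w.2 ≤ l then g w.1 else h w.1) ∂(ν.prod ν)
      = (∫ u, f u ∂ν) * ν.real (Set.Iio (-l)) + (∫ u, g u ∂ν) * ν.real (Set.Icc (-l) l)
        + (∫ u, h u ∂ν) * ν.real (Set.Ioi l) := by
  have e : (fun w : ℝ × ℝ => if w.2 < -l then f w.1 else if w.2 ≤ l then g w.1 else h w.1)
      = fun w : ℝ × ℝ => f w.1 * (Set.Iio (-l)).indicator (fun _ => (1 : ℝ)) w.2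
        + g w.1 * (Set.Icc (-l) l).indicator (fun _ => (1 : ℝ)) w.2
        + h w.1 * (Set.Ioi l).indicator (fun _ => (1 : ℝ)) w.2 := by
    funext w
    simp only [Set.indicator_apply, Set.mem_Iio, Set.mem_Icc, Set.mem_Ioi]
    by_cases h1 : w.2 < -l
    · have h2 : ¬ (-l ≤ w.2) := not_le.mpr h1
      have h3 : ¬ (l < w.2) := by linarith
      simp [h1, h2, h3]
    · by_cases h2 : w.2 ≤ l
      · simp [h1, h2, not_lt.mp h1, not_lt.mpr h2]
      · simp [h1, h2, not_le.mp h2]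
  have hI : ∀ s : Set ℝ, MeasurableSet s → Integrable (s.indicator (fun _ => (1 : ℝ))) ν :=
    fun s hs => (integrable_const 1).indicator hs
  have i1 := hf.mul_prod (hI (Set.Iio (-l)) measurableSet_Iio)
  have i2 := hg.mul_prod (hI (Set.Icc (-l) l) measurableSet_Icc)
  have i3 := hh.mul_prod (hI (Set.Ioi l) measurableSet_Ioi)
  rw [e]
  refine ⟨(i1.add i2).add i3, ?_⟩
  have i12 : Integrable (fun w : ℝ × ℝ => f w.1 * (Set.Iio (-l)).indicator (fun _ => (1 : ℝ)) w.2
        + g w.1 * (Set.Icc (-l) l).indicator (fun _ => (1 : ℝ)) w.2) (ν.prod ν) := i1.add i2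
  rw [integral_add i12 i3, integral_add i1 i2, integral_prod_mul, integral_prod_mul,
    integral_prod_mul, integral_indicator_const _ measurableSet_Iio,
    integral_indicator_const _ measurableSet_Icc, integral_indicator_const _ measurableSet_Ioi]
  simp

/-- Truncation to `[-c, c]`. -/
noncomputable def trunc (c y : ℝ) : ℝ := SignType.sign y * min |y| c

theorem trunc_eq {c : ℝ} (hc : 0 ≤ c) (y : ℝ) : trunc c y = max (-c) (min y c) := by
  unfold trunc
  rcases lt_trichotomy y 0 with h | rfl | h
  · rw [sign_neg h, abs_of_neg h]
    rw [min_eq_left (by linarith : y ≤ c)]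
    rcases le_total (-y) c with h2 | h2
    · rw [min_eq_left h2, max_eq_right (by linarith)]; simp
    · rw [min_eq_right h2, max_eq_left (by linarith)]; simp
  · simp [hc]
  · rw [sign_pos h, abs_of_pos h, max_eq_right]
    · simp
    · exact le_min (by linarith) (by linarith)

theorem abs_trunc_le {c : ℝ} (hc : 0 ≤ c) (y : ℝ) : |trunc c y| ≤ |y| := by
  rw [trunc_eq hc, abs_le]
  constructor
  · refine le_max_of_le_right (le_min (neg_abs_le y) ?_)
    linarith [abs_nonneg y]
  · refine max_le ?_ ((min_le_left _ _).trans (le_abs_self y))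
    linarith [abs_nonneg y]

/-- Truncation acts only when |y| > c, and there |y| ≤ y²/c. The bias due to truncation is thus paid
for by a second moment. -/
theorem abs_trunc_sub_le {c : ℝ} (hc : 0 < c) (y : ℝ) : |trunc c y - y| ≤ y ^ 2 / c := by
  rw [trunc_eq hc.le]
  have hpos : 0 ≤ y ^ 2 / c := by positivity
  rcases le_total y c with h1 | h1
  · rw [min_eq_left h1]
    rcases le_total (-c) y with h2 | h2
    · rw [max_eq_right h2]; simpa using hpos
    · rw [max_eq_left h2, abs_of_nonneg (by linarith), le_div_iff₀ hc]
      nlinarith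
  · rw [min_eq_right h1, max_eq_right (by linarith), abs_of_nonpos (by linarith), le_div_iff₀ hc]
    nlinarith

theorem continuous_trunc {c : ℝ} (hc : 0 ≤ c) : Continuous (trunc c) := by
  rw [funext (trunc_eq hc)]
  fun_prop

/-- The upper tail of `posMean` against the lower tail of a normal law. -/
theorem posMean_mul_tail_le (m : ℝ) {v : ℝ≥0} (hv : v ≠ 0) (hv2 : (v : ℝ) ≤ 3 / 16) {l : ℝ}
    (hl : 0 ≤ l) :
    posMean m * (gaussianReal m v).real (Set.Iic (-l)) ≤ 2 * Real.exp (-l ^ 2 / 8) := by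
  have hv0 : (0 : ℝ) < v := by positivity
  -- Left of -l/2 `posMean` itself is small; right of it the normal variable must fall y = m + l ≥
  -- l/2 below its mean, and the linear growth 1 + y is absorbed by half of the exponent y².
  rcases le_total m (-l / 2) with h | h
  · have h1 : posMean m ≤ Real.exp (-l ^ 2 / 8) :=
      (posMean_le_stdPdf (by linarith)).trans ((stdPdf_le_exp m).trans
        (Real.exp_le_exp.mpr (by nlinarith)))
    have h2 : (gaussianReal m v).real (Set.Iic (-l)) ≤ 1 := measureReal_le_one
    have h3 := Real.exp_pos (-l ^ 2 / 8)
    calc posMean m * (gaussianReal m v).real (Set.Iic (-l))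
        ≤ Real.exp (-l ^ 2 / 8) * 1 := by
          gcongr
      _ ≤ _ := by linarith
  · have hy : l / 2 ≤ m + l := by linarith
    have h1 : posMean m ≤ 1 + (m + l) := by
      rcases le_total m 0 with hm | hm
      · linarith [posMean_le_stdPdf hm, stdPdf_le_one m]
      · linarith [posMean_le_of_nonneg hm]
    have h2 : (gaussianReal m v).real (Set.Iic (-l)) ≤ Real.exp (-(m + l) ^ 2) := by
      refine (gaussianReal_real_Iic_le m hv (by linarith)).trans (Real.exp_le_exp.mpr ?_)
      rw [div_le_iff₀ (by positivity)]
      nlinarith [sq_nonneg (m + l)]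
    have h3 : 1 + (m + l) ≤ 2 * Real.exp ((m + l) ^ 2 / 2) := by
      nlinarith [Real.add_one_le_exp ((m + l) ^ 2 / 2), sq_nonneg (m + l - 1)]
    calc posMean m * (gaussianReal m v).real (Set.Iic (-l))
        ≤ (2 * Real.exp ((m + l) ^ 2 / 2)) * Real.exp (-(m + l) ^ 2) :=
          mul_le_mul (h1.trans h3) h2 measureReal_nonneg (by positivity)
      _ = 2 * Real.exp (-(m + l) ^ 2 / 2) := by
          rw [mul_assoc, ← Real.exp_add]
          ring_nf
      _ ≤ _ := by
          gcongr ?_ * Real.exp ?_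
          nlinarith

theorem posMean_neg_mul_tail_le (m : ℝ) {v : ℝ≥0} (hv : v ≠ 0) (hv2 : (v : ℝ) ≤ 3 / 16) {l : ℝ}
    (hl : 0 ≤ l) :
    posMean (-m) * (gaussianReal m v).real (Set.Ici l) ≤ 2 * Real.exp (-l ^ 2 / 8) := by
  have h2 : gaussianReal m v (Set.Ici l) = gaussianReal (-m) v (Set.Iic (-l)) := by
    rw [← gaussianReal_map_neg, Measure.map_apply measurable_neg measurableSet_Iic]
    congr 1
    ext x
    simp
  rw [Measure.real, h2]
  exact posMean_mul_tail_le (-m) hv hv2 hl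

/-- The threshold estimate as a function of its two pseudo-samples. -/
noncomputable def thresh (β l : ℝ) (f : ℝ → ℝ) (w : ℝ × ℝ) : ℝ :=
  if w.2 < -l then -β * w.1 else if w.2 ≤ l then f w.1 else (1 - β) * w.1

theorem abs_le_add_max (m l : ℝ) : |m| ≤ l + max (|m| - l) 0 := by
  linarith [le_max_left (|m| - l) 0]

/-- The second moment of the Hermite estimate grows like exp(10m²/7), but reaching the middle region
from |m| = l + t has probability at most exp(-8t²/3). As 10/7 < 8/3, the maximum over t is finite;
it is attained at t = 15l/13 with exponent 40l²/13. -/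
theorem exp_sq_mul_Icc_le (m : ℝ) {v : ℝ≥0} (hv : v ≠ 0) (hv2 : (v : ℝ) ≤ 3 / 16) {l : ℝ} :
    Real.exp (m ^ 2 / (7 / 10)) * (gaussianReal m v).real (Set.Icc (-l) l)
      ≤ Real.exp (40 / 13 * l ^ 2) := by
  set t := max (|m| - l) 0
  have ht : |m| ≤ l + t := abs_le_add_max m l
  have h2 : m ^ 2 ≤ (l + t) ^ 2 := by
    rw [← sq_abs m]
    exact pow_le_pow_left₀ (abs_nonneg m) ht 2
  calc _ ≤ Real.exp (m ^ 2 / (7 / 10)) * Real.exp (-(8 / 3) * t ^ 2) := by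
        gcongr
        exact gaussianReal_real_Icc_le m hv hv2 l
    _ = Real.exp (m ^ 2 / (7 / 10) + -(8 / 3) * t ^ 2) := (Real.exp_add _ _).symm
    _ ≤ _ := by
        apply Real.exp_le_exp.mpr
        nlinarith [sq_nonneg (t - 15 / 13 * l)]

/-- The same trade-off for the growth exp(6m²/5) of the Taylor remainder; the maximizer is t =
9l/11. -/
theorem exp_sq_mul_Icc_le' (m : ℝ) {v : ℝ≥0} (hv : v ≠ 0) (hv2 : (v : ℝ) ≤ 3 / 16) {l : ℝ} :
    Real.exp (6 / 5 * m ^ 2) * (gaussianReal m v).real (Set.Icc (-l) l)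
      ≤ Real.exp (24 / 11 * l ^ 2) := by
  set t := max (|m| - l) 0
  have ht : |m| ≤ l + t := abs_le_add_max m l
  have h2 : m ^ 2 ≤ (l + t) ^ 2 := by
    rw [← sq_abs m]
    exact pow_le_pow_left₀ (abs_nonneg m) ht 2
  calc _ ≤ Real.exp (6 / 5 * m ^ 2) * Real.exp (-(8 / 3) * t ^ 2) := by
        gcongr
        exact gaussianReal_real_Icc_le m hv hv2 l
    _ = Real.exp (6 / 5 * m ^ 2 + -(8 / 3) * t ^ 2) := (Real.exp_add _ _).symm
    _ ≤ _ := by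
        apply Real.exp_le_exp.mpr
        nlinarith [sq_nonneg (t - 9 / 11 * l)]

/-- Keeps the factor 2^(-J), which the choice of the truncation order makes small, at the price of
exp(6x/5). The additional fifth in the exponent absorbs the factor x. -/
theorem pow_div_factorial_half_le (x : ℝ) (hx : 0 ≤ x) (J : ℕ) :
    x * ((x / 2) ^ J / J.factorial) ≤ 5 * (1 / 2) ^ J * Real.exp (6 / 5 * x) := by
  have h1 := Real.pow_div_factorial_le_exp x hx J
  have h2 : x ≤ 5 * Real.exp (x / 5) := by linarith [Real.add_one_le_exp (x / 5)]
  calc x * ((x / 2) ^ J / J.factorial) = (1 / 2) ^ J * (x * (x ^ J / J.factorial)) := by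
        rw [div_pow, div_pow, one_pow]; ring
    _ ≤ (1 / 2) ^ J * ((5 * Real.exp (x / 5)) * Real.exp x) := by gcongr
    _ = 5 * (1 / 2) ^ J * (Real.exp (x / 5) * Real.exp x) := by ring
    _ = _ := by
        rw [← Real.exp_add]
        ring_nf

section unit

variable {β m l : ℝ} {v : ℝ≥0} {n N : ℕ}

theorem integrable_estPoly_sq (β m : ℝ) (v : ℝ≥0) (N : ℕ) :
    Integrable (fun u => (estPoly β v N).eval u ^ 2) (gaussianReal m v) := by
  have := integrable_eval_gaussianReal m v (estPoly β v N ^ 2)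
  simpa only [Polynomial.eval_pow] using this

theorem integrable_trunc_estPoly (β m : ℝ) (v : ℝ≥0) (n N : ℕ) :
    Integrable (fun u => trunc n ((estPoly β v N).eval u)) (gaussianReal m v) := by
  refine (integrable_eval_gaussianReal m v (estPoly β v N)).mono ?_ (ae_of_all _ fun u => ?_)
  · exact ((continuous_trunc (Nat.cast_nonneg n)).comp (by fun_prop)).aestronglyMeasurable
  · exact abs_trunc_le (Nat.cast_nonneg n) _

theorem measure_partition (ν : Measure ℝ) [IsProbabilityMeasure ν] (hl : 0 ≤ l) :
    ν.real (Set.Iio (-l)) + ν.real (Set.Icc (-l) l) + ν.real (Set.Ioi l) = 1 := by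
  have h := (integrable_piecewise_prod (ν := ν) (integrable_const 1) (integrable_const 1)
    (integrable_const 1) hl).2
  simp at h
  linarith

/-- The bias of the threshold estimate. -/
theorem abs_integral_thresh_sub_le (h0 : 0 ≤ β) (h1 : β ≤ 1) (hv : v ≠ 0)
    (hv2 : (v : ℝ) ≤ 3 / 16) (hl : 0 ≤ l) (hn : 0 < n)
    (hN : 5 / 2 * l ^ 2 ≤ ((N + 1) / 2 : ℕ) * Real.log 2) :
    |∫ w, thresh β l (fun u => trunc n ((estPoly β v (N + 2)).eval u)) w
        ∂((gaussianReal m v).prod (gaussianReal m v)) - G m β|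
      ≤ 9 * Real.exp (-l ^ 2 / 8) + 400 * Real.exp (40 / 13 * l ^ 2) / n := by
  set ν := gaussianReal m v
  set S : ℝ → ℝ := fun u => (estPoly β v (N + 2)).eval u with hS
  have hn0 : (0 : ℝ) < n := by exact_mod_cast hn
  have hid := integrable_id_gaussianReal m v
  have hIS : Integrable S ν := integrable_eval_gaussianReal m v _
  have hIT : Integrable (fun u => trunc n (S u)) ν := integrable_trunc_estPoly β m v n (N + 2)
  have hmain := (integrable_piecewise_prod (hid.const_mul (-β)) hIT (hid.const_mul (1 - β)) hl).2
  have hpart := measure_partition ν hl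
  have e : ∫ w, thresh β l (fun u => trunc n (S u)) w ∂(ν.prod ν)
      = (∫ u, -β * u ∂ν) * ν.real (Set.Iio (-l))
        + (∫ u, trunc n (S u) ∂ν) * ν.real (Set.Icc (-l) l)
        + (∫ u, (1 - β) * u ∂ν) * ν.real (Set.Ioi l) := hmain
  rw [e, integral_const_mul, integral_const_mul, integral_id_gaussianReal]
  set P1 := ν.real (Set.Iio (-l))
  set P0 := ν.real (Set.Icc (-l) l)
  set P2 := ν.real (Set.Ioi l)
  have hP0 : 0 ≤ P0 := measureReal_nonneg
  have b1 : posMean m * P1 ≤ 2 * Real.exp (-l ^ 2 / 8) := by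
    refine le_trans ?_ (posMean_mul_tail_le m hv hv2 hl)
    exact mul_le_mul_of_nonneg_left (measureReal_mono Set.Iio_subset_Iic_self) (posMean_nonneg m)
  have b2 : posMean (-m) * P2 ≤ 2 * Real.exp (-l ^ 2 / 8) := by
    refine le_trans ?_ (posMean_neg_mul_tail_le m hv hv2 hl)
    exact mul_le_mul_of_nonneg_left (measureReal_mono Set.Ioi_subset_Ici_self) (posMean_nonneg _)
  have c1 : 0 ≤ posMean m * P1 := mul_nonneg (posMean_nonneg m) measureReal_nonneg
  have c2 : 0 ≤ posMean (-m) * P2 := mul_nonneg (posMean_nonneg _) measureReal_nonneg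
  have b3 : |∫ u, trunc n (S u) ∂ν - ∫ u, S u ∂ν| * P0 ≤ 400 * Real.exp (40 / 13 * l ^ 2) / n := by
    have h2 : |∫ u, trunc n (S u) ∂ν - ∫ u, S u ∂ν|
        ≤ 400 * Real.exp (m ^ 2 / (7 / 10)) / n := by
      rw [← integral_sub hIT hIS]
      refine (abs_integral_le_integral_abs).trans ?_
      refine (integral_mono (hIT.sub hIS).abs ((integrable_estPoly_sq β m v (N + 2)).div_const n)
        (fun u => abs_trunc_sub_le hn0 (S u))).trans ?_
      rw [integral_div]
      gcongr
      exact integral_estPoly_sq_le h0 h1 m hv hv2 _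
    calc _ ≤ 400 * Real.exp (m ^ 2 / (7 / 10)) / n * P0 := by gcongr
      _ = 400 * (Real.exp (m ^ 2 / (7 / 10)) * P0) / n := by ring
      _ ≤ _ := by
        gcongr
        exact exp_sq_mul_Icc_le m hv hv2
  -- The order condition gives 2^(-J) ≤ exp(-5l²/2), which beats exp(24l²/11) with more than l²/8 to
  -- spare.
  have b4 : |∫ u, S u ∂ν - G m β| * P0 ≤ 5 * Real.exp (-l ^ 2 / 8) := by
    rw [hS, integral_estPoly β m hv, abs_sub_comm]
    set J := (N + 1) / 2
    have hJ : ((1 : ℝ) / 2) ^ J ≤ Real.exp (-(5 / 2) * l ^ 2) := by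
      have : ((1 : ℝ) / 2) ^ J = Real.exp (-(J * Real.log 2)) := by
        rw [← mul_neg, ← Real.log_inv, Real.exp_nat_mul, Real.exp_log (by norm_num)]
        norm_num
      rw [this]
      apply Real.exp_le_exp.mpr
      linarith
    calc _ ≤ (5 * (1 / 2) ^ J * Real.exp (6 / 5 * m ^ 2)) * P0 := by
          gcongr
          exact (abs_G_sub_taylor_le β m N).trans (pow_div_factorial_half_le _ (sq_nonneg m) J)
      _ = 5 * (1 / 2) ^ J * (Real.exp (6 / 5 * m ^ 2) * P0) := by ring
      _ ≤ 5 * Real.exp (-(5 / 2) * l ^ 2) * Real.exp (24 / 11 * l ^ 2) := by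
          gcongr
          exact exp_sq_mul_Icc_le' m hv hv2
      _ = 5 * Real.exp (-(5 / 2) * l ^ 2 + 24 / 11 * l ^ 2) := by rw [mul_assoc, ← Real.exp_add]
      _ ≤ _ := by
          gcongr
          nlinarith [sq_nonneg l]
  -- On the left tail -βm differs from G(m, β) by `posMean m`, on the right tail (1 - β)m differs by
  -- `posMean (-m)`; in the middle the truncation and Taylor errors remain.
  have hsplit : -β * m * P1 + (∫ u, trunc n (S u) ∂ν) * P0 + (1 - β) * m * P2 - G m β
      = -(posMean m * P1) + posMean (-m) * (-P2)
        + (∫ u, trunc n (S u) ∂ν - ∫ u, S u ∂ν) * P0 + (∫ u, S u ∂ν - G m β) * P0 := by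
    rw [posMean_neg, G_eq]
    linear_combination (β * m - posMean m) * (- hpart) 
  rw [hsplit]
  have a3 : |(∫ u, trunc n (S u) ∂ν - ∫ u, S u ∂ν) * P0| ≤ 400 * Real.exp (40 / 13 * l ^ 2) / n := by
    rw [abs_mul, abs_of_nonneg hP0]
    exact b3
  have a4 : |(∫ u, S u ∂ν - G m β) * P0| ≤ 5 * Real.exp (-l ^ 2 / 8) := by
    rw [abs_mul, abs_of_nonneg hP0]
    exact b4
  rw [abs_le] at *
  constructor <;> linarith [a3.1, a3.2, a4.1, a4.2]

/-- The slope of the linear piece on the side of the mean. -/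
noncomputable def sideSlope (β m : ℝ) : ℝ := if m ≤ 0 then -β else 1 - β

theorem sq_mul_exp_le (t : ℝ) : t ^ 2 * Real.exp (-(8 / 3) * t ^ 2) ≤ 1 := by
  have h := Real.add_one_le_exp (8 / 3 * t ^ 2)
  have : Real.exp (-(8 / 3) * t ^ 2) = (Real.exp (8 / 3 * t ^ 2))⁻¹ := by
    rw [← Real.exp_neg]
    ring_nf
  rw [this, ← div_eq_mul_inv, div_le_one (Real.exp_pos _)]
  nlinarith [sq_nonneg t]

/-- Means are not bounded, so m² has to be compensated by the probability of an event that lies far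
from m. -/
theorem sq_mul_le_of_le_exp {P : ℝ} (hP : P ≤ Real.exp (-(8 / 3) * (max (|m| - l) 0) ^ 2)) :
    m ^ 2 * P ≤ 2 * l ^ 2 + 2 := by
  set t := max (|m| - l) 0
  have ht0 : 0 ≤ t := le_max_right _ _
  have ht : |m| ≤ l + t := abs_le_add_max m l
  have h2 : m ^ 2 ≤ 2 * l ^ 2 + 2 * t ^ 2 := by
    rw [← sq_abs m]
    nlinarith [pow_le_pow_left₀ (abs_nonneg m) ht 2, sq_nonneg (l - t)]
  have hE : Real.exp (-(8 / 3) * t ^ 2) ≤ 1 := Real.exp_le_one_iff.mpr (by nlinarith [sq_nonneg t])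
  calc m ^ 2 * P ≤ (2 * l ^ 2 + 2 * t ^ 2) * Real.exp (-(8 / 3) * t ^ 2) := by
        refine (mul_le_mul_of_nonneg_left hP (sq_nonneg m)).trans ?_
        gcongr
    _ = 2 * l ^ 2 * Real.exp (-(8 / 3) * t ^ 2) + 2 * (t ^ 2 * Real.exp (-(8 / 3) * t ^ 2)) := by
        ring
    _ ≤ 2 * l ^ 2 * 1 + 2 * 1 := by
        gcongr
        exact sq_mul_exp_le t
    _ = _ := by ring

theorem integrable_sub_sq_gaussianReal (m : ℝ) (v : ℝ≥0) (a b : ℝ) :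
    Integrable (fun u => (a * u - b) ^ 2) (gaussianReal m v) := by
  have := integrable_eval_gaussianReal m v ((Polynomial.C a * Polynomial.X - Polynomial.C b) ^ 2)
  simpa using this

theorem integral_sub_sq_gaussianReal (m : ℝ) (v : ℝ≥0) :
    ∫ u, (u - m) ^ 2 ∂(gaussianReal m v) = v := by
  have := variance_fun_id_gaussianReal (μ := m) (v := v)
  rwa [variance_eq_integral aemeasurable_id', integral_id_gaussianReal] at this

theorem integral_linear_sub_sq_le {a b : ℝ} (ha : a ^ 2 ≤ 1) :
    ∫ u, (a * u - b * m) ^ 2 ∂(gaussianReal m v) ≤ 2 * v + 2 * ((a - b) * m) ^ 2 := by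
  have hI : Integrable (fun u => (u - m) ^ 2) (gaussianReal m v) := by
    simpa using integrable_sub_sq_gaussianReal m v 1 m
  have h := integral_mono (integrable_sub_sq_gaussianReal m v a (b * m))
    ((hI.const_mul 2).add (integrable_const (2 * ((a - b) * m) ^ 2))) (fun u => ?_)
  · refine h.trans (le_of_eq ?_)
    simp only [Pi.add_apply]
    rw [integral_add (hI.const_mul 2) (integrable_const _), integral_const_mul,
      integral_sub_sq_gaussianReal]
    simp
  · simp only [Pi.add_apply]
    nlinarith [sq_nonneg (a * (u - m) - (a - b) * m), sq_nonneg (u - m)]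

/-- The second moment of the threshold estimate about the value of the linear piece on the side
of the mean. -/
theorem integral_thresh_sub_sq_le (h0 : 0 ≤ β) (h1 : β ≤ 1) (hv : v ≠ 0)
    (hv2 : (v : ℝ) ≤ 3 / 16) (hl : 0 ≤ l) :
    Integrable (fun w => (thresh β l (fun u => trunc n ((estPoly β v N).eval u)) w
        - sideSlope β m * m) ^ 2) ((gaussianReal m v).prod (gaussianReal m v)) ∧
    ∫ w, (thresh β l (fun u => trunc n ((estPoly β v N).eval u)) w - sideSlope β m * m) ^ 2
        ∂((gaussianReal m v).prod (gaussianReal m v))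
      ≤ 900 * Real.exp (40 / 13 * l ^ 2) := by
  set ν := gaussianReal m v
  set S : ℝ → ℝ := fun u => (estPoly β v N).eval u with hS
  -- Centering at κm rather than at 0 removes the dependence on m, which is unbounded: the linear
  -- piece on the side of m then contributes only the noise variance.
  set κ := sideSlope β m with hκ
  have hκ2 : κ ^ 2 ≤ 1 := by
    rw [hκ, sideSlope]
    split_ifs <;> nlinarith
  have hpt : ∀ u, (trunc n (S u) - κ * m) ^ 2 ≤ 2 * S u ^ 2 + 2 * m ^ 2 := by
    intro u
    have ha := sq_le_sq.mpr (abs_trunc_le (Nat.cast_nonneg n) (S u))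
    nlinarith [sq_nonneg (trunc n (S u) + κ * m), sq_nonneg m]
  have hIS := integrable_estPoly_sq β m v N
  have hIb : Integrable (fun u => 2 * S u ^ 2 + 2 * m ^ 2) ν :=
    (hIS.const_mul 2).add (integrable_const _)
  have hIT : Integrable (fun u => (trunc n (S u) - κ * m) ^ 2) ν := by
    refine hIb.mono ?_ (ae_of_all _ fun u => ?_)
    · exact ((((continuous_trunc (Nat.cast_nonneg n)).comp (by fun_prop)).sub
        continuous_const).pow 2).aestronglyMeasurable
    · rw [Real.norm_of_nonneg (sq_nonneg _), Real.norm_of_nonneg (by positivity)]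
      exact hpt u
  have hI1 := integrable_sub_sq_gaussianReal m v (-β) (κ * m)
  have hI2 := integrable_sub_sq_gaussianReal m v (1 - β) (κ * m)
  have hmain := integrable_piecewise_prod hI1 hIT hI2 hl
  have e : (fun w => (thresh β l (fun u => trunc n (S u)) w - κ * m) ^ 2)
      = fun w : ℝ × ℝ => if w.2 < -l then (-β * w.1 - κ * m) ^ 2 else
        if w.2 ≤ l then (trunc n (S w.1) - κ * m) ^ 2 else ((1 - β) * w.1 - κ * m) ^ 2 := by
    funext w
    unfold thresh
    split_ifs <;> rfl
  rw [e]
  refine ⟨hmain.1, hmain.2.le.trans ?_⟩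
  set P1 := ν.real (Set.Iio (-l))
  set P0 := ν.real (Set.Icc (-l) l)
  set P2 := ν.real (Set.Ioi l)
  have hP0 : 0 ≤ P0 := measureReal_nonneg
  have hP1 : 0 ≤ P1 := measureReal_nonneg
  have hP2 : 0 ≤ P2 := measureReal_nonneg
  have hP0' : P0 ≤ 1 := measureReal_le_one
  have hP1' : P1 ≤ 1 := measureReal_le_one
  have hP2' : P2 ≤ 1 := measureReal_le_one
  set E := Real.exp (40 / 13 * l ^ 2)
  have hE : 1 + 40 / 13 * l ^ 2 ≤ E := by linarith [Real.add_one_le_exp (40 / 13 * l ^ 2)]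
  have m0 : m ^ 2 * P0 ≤ 2 * l ^ 2 + 2 :=
    sq_mul_le_of_le_exp (gaussianReal_real_Icc_le m hv hv2 l)
  have q0 : (∫ u, (trunc n (S u) - κ * m) ^ 2 ∂ν) * P0 ≤ 800 * E + 2 * (2 * l ^ 2 + 2) := by
    have h2 : ∫ u, (trunc n (S u) - κ * m) ^ 2 ∂ν
        ≤ 2 * (400 * Real.exp (m ^ 2 / (7 / 10))) + 2 * m ^ 2 := by
      refine (integral_mono hIT hIb hpt).trans ?_
      rw [integral_add (hIS.const_mul 2) (integrable_const _), integral_const_mul]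
      simp only [integral_const, probReal_univ, smul_eq_mul, one_mul]
      gcongr
      exact integral_estPoly_sq_le h0 h1 m hv hv2 N
    have h3 := exp_sq_mul_Icc_le m hv hv2 (l := l)
    calc _ ≤ (2 * (400 * Real.exp (m ^ 2 / (7 / 10))) + 2 * m ^ 2) * P0 := by gcongr
      _ = 800 * (Real.exp (m ^ 2 / (7 / 10)) * P0) + 2 * (m ^ 2 * P0) := by ring
      _ ≤ _ := by gcongr
  have s1 : (-β) ^ 2 ≤ 1 := by nlinarith
  have s2 : (1 - β) ^ 2 ≤ 1 := by nlinarith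
  have tailexp : ∀ t : ℝ, -t ^ 2 / (2 * v) ≤ -(8 / 3) * t ^ 2 := by
    intro t
    have hv0 : (0 : ℝ) < v := by positivity
    rw [div_le_iff₀ (by positivity)]
    nlinarith [sq_nonneg t]
  have q1 : (∫ u, (-β * u - κ * m) ^ 2 ∂ν) * P1 ≤ 1 + 2 * (2 * l ^ 2 + 2) := by
    have h2 := integral_linear_sub_sq_le (m := m) (v := v) (b := κ) s1
    -- The slopes agree when m ≤ 0. When m > 0, falling below -l is an event whose Gaussian tail
    -- beats m².
    have h3 : ((-β - κ) * m) ^ 2 * P1 ≤ 2 * l ^ 2 + 2 := by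
      rw [hκ, sideSlope]
      split_ifs with hm
      · simp; positivity
      · push Not at hm
        have : m ^ 2 * P1 ≤ 2 * l ^ 2 + 2 := by
          refine sq_mul_le_of_le_exp ?_
          refine (measureReal_mono Set.Iio_subset_Iic_self).trans
            ((gaussianReal_real_Iic_le m hv (by linarith)).trans (Real.exp_le_exp.mpr ?_))
          refine (tailexp _).trans ?_
          rw [abs_of_pos hm]
          have : max (m - l) 0 ^ 2 ≤ (-l - m) ^ 2 := by
            rcases le_total (m - l) 0 with h | h
            · rw [max_eq_right h]; nlinarith [sq_nonneg (-l - m)]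
            · rw [max_eq_left h]; nlinarith
          linarith
        linarith [show ((-β - (1 - β)) * m) ^ 2 * P1 = m ^ 2 * P1 by ring]
    calc _ ≤ (2 * v + 2 * ((-β - κ) * m) ^ 2) * P1 := by gcongr
      _ = 2 * v * P1 + 2 * (((-β - κ) * m) ^ 2 * P1) := by ring
      _ ≤ _ := by nlinarith
  have q2 : (∫ u, ((1 - β) * u - κ * m) ^ 2 ∂ν) * P2 ≤ 1 + 2 * (2 * l ^ 2 + 2) := by
    have h2 := integral_linear_sub_sq_le (m := m) (v := v) (b := κ) s2
    have h3 : ((1 - β - κ) * m) ^ 2 * P2 ≤ 2 * l ^ 2 + 2 := by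
      rw [hκ, sideSlope]
      split_ifs with hm
      · have : m ^ 2 * P2 ≤ 2 * l ^ 2 + 2 := by
          refine sq_mul_le_of_le_exp ?_
          refine (measureReal_mono Set.Ioi_subset_Ici_self).trans
            ((gaussianReal_real_Ici_le m hv (by linarith)).trans (Real.exp_le_exp.mpr ?_))
          refine (tailexp _).trans ?_
          rw [abs_of_nonpos hm]
          have : max (-m - l) 0 ^ 2 ≤ (l - m) ^ 2 := by
            rcases le_total (-m - l) 0 with h | h
            · rw [max_eq_right h]; nlinarith [sq_nonneg (l - m)]
            · rw [max_eq_left h]; nlinarith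
          linarith
        linarith [show ((1 - β - -β) * m) ^ 2 * P2 = m ^ 2 * P2 by ring]
      · simp; positivity
    calc _ ≤ (2 * v + 2 * ((1 - β - κ) * m) ^ 2) * P2 := by gcongr
      _ = 2 * v * P2 + 2 * (((1 - β - κ) * m) ^ 2 * P2) := by ring
      _ ≤ _ := by nlinarith
  linarith [sq_nonneg l]

end unit

/-! ### Transfer to a single coordinate of the model. -/

/-- The conditions on a single coordinate. -/
structure Coord.Regular (p : Coord) : Prop where
  b_pos : 0 < p.b
  h_pos : 0 < p.h
  σp_pos : 0 < p.σp
  σf_pos : 0 < p.σf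
  var_ratio : p.σp / p.σf ≤ 1 / (4 * Real.exp 1)

namespace Coord.Regular

variable {p : Coord} (hp : p.Regular)
include hp

theorem ratio_nonneg : 0 ≤ p.ratio :=
  div_nonneg hp.b_pos.le (add_pos hp.b_pos hp.h_pos).le

theorem ratio_le_one : p.ratio ≤ 1 := by
  rw [Coord.ratio, div_le_one (add_pos hp.b_pos hp.h_pos)]
  linarith [hp.h_pos]

theorem shrink_nonneg (τ : ℝ≥0∞) : 0 ≤ p.shrink τ := by
  have := hp.σp_pos
  unfold Coord.shrink
  split_ifs <;> positivity

theorem shrink_le_one (τ : ℝ≥0∞) : p.shrink τ ≤ 1 := by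
  have := hp.σp_pos
  have h0 : 0 ≤ τ.toReal := ENNReal.toReal_nonneg
  unfold Coord.shrink
  split_ifs
  · exact le_rfl
  · rw [div_le_one (by linarith)]
    linarith

theorem shrink_lt_one {τ : ℝ≥0∞} (hτ : τ ≠ ∞) : p.shrink τ < 1 := by
  have := hp.σp_pos
  have h0 : 0 ≤ τ.toReal := ENNReal.toReal_nonneg
  rw [Coord.shrink, if_neg hτ, div_lt_one (by linarith)]
  linarith

theorem σp_le_σf : p.σp ≤ p.σf := by
  have h := hp.var_ratio
  have h1 : 1 / (4 * Real.exp 1) ≤ 1 := by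
    rw [div_le_one (by positivity)]
    linarith [Real.add_one_le_exp 1]
  have := (div_le_one hp.σf_pos).mp (h.trans h1)
  exact this

theorem scale_arg_pos (τ : ℝ≥0∞) : 0 < p.σf + p.σp * p.shrink τ ^ 2 := by
  have := hp.σp_pos
  have := hp.σf_pos
  positivity

theorem scale_pos (τ : ℝ≥0∞) : 0 < p.scale τ := Real.sqrt_pos.mpr (hp.scale_arg_pos τ)

theorem scale_sq (τ : ℝ≥0∞) : p.scale τ ^ 2 = p.σf + p.σp * p.shrink τ ^ 2 :=
  Real.sq_sqrt (hp.scale_arg_pos τ).le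

theorem scale_le (τ : ℝ≥0∞) : p.scale τ ≤ √(2 * p.σf) := by
  apply Real.sqrt_le_sqrt
  have h1 := hp.shrink_le_one τ
  have h0 := hp.shrink_nonneg τ
  have : p.shrink τ ^ 2 ≤ 1 := by nlinarith
  nlinarith [hp.σp_le_σf, hp.σp_pos]

theorem scale_mul_d (τ : ℝ≥0∞) : p.scale τ * p.d τ = -(1 - p.shrink τ) := by
  have := (hp.scale_pos τ).ne'
  unfold Coord.d
  field_simp

theorem scale_mul_c (τ : ℝ≥0∞) :
    p.scale τ * p.c τ = √(p.σf + p.shrink τ * p.σp) * stdQuantile p.ratio := by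
  have h := hp.scale_arg_pos τ
  have h0 := hp.shrink_nonneg τ
  have := hp.σp_pos
  have := hp.σf_pos
  rw [Coord.c, Coord.scale, ← mul_assoc, ← Real.sqrt_mul h.le]
  congr 2
  rw [mul_comm p.σp]
  have : p.σf + p.shrink τ ^ 2 * p.σp ≠ 0 := by positivity
  field_simp

theorem d_ne_zero {τ : ℝ≥0∞} (hτ : τ ≠ ∞) : p.d τ ≠ 0 := by
  intro h
  have := hp.scale_mul_d τ
  rw [h, mul_zero] at this
  linarith [hp.shrink_lt_one hτ]

theorem noise_pos {τ : ℝ≥0∞} (hτ : τ ≠ ∞) : 0 < 2 * p.σp * p.d τ ^ 2 := by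
  have := hp.σp_pos
  have := hp.d_ne_zero hτ
  positivity

/-- Since d² ≤ 1/σf, the variance of the pseudo-samples is at most 2σp/σf ≤ 1/(2e) < 3/16. -/
theorem noise_le (τ : ℝ≥0∞) : 2 * p.σp * p.d τ ^ 2 ≤ 3 / 16 := by
  have h1 := hp.scale_sq τ
  have h2 : p.scale τ ^ 2 * p.d τ ^ 2 = (1 - p.shrink τ) ^ 2 := by
    rw [← mul_pow, hp.scale_mul_d, neg_sq]
  have h3 : (1 - p.shrink τ) ^ 2 ≤ 1 := by
    nlinarith [hp.shrink_le_one τ, hp.shrink_nonneg τ]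
  have h4 : p.σf * p.d τ ^ 2 ≤ 1 := by
    have : 0 ≤ p.σp * p.shrink τ ^ 2 * p.d τ ^ 2 := by
      have := hp.σp_pos
      positivity
    nlinarith
  have h5 : p.σp ≤ 3 / 32 * p.σf := by
    rw [← div_le_iff₀ hp.σf_pos]
    refine hp.var_ratio.trans ?_
    rw [div_le_iff₀ (by positivity)]
    linarith [Real.exp_one_gt_d9]
  nlinarith [sq_nonneg (p.d τ)]

end Coord.Regular

/-- The two lowest coefficients stand outside the sum in `Coord.S`, hence the index shift by 2. For
finite τ the noise variance is positive, as the Hermite moment formulas require; all scales on the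
grid are finite. -/
theorem Coord.Regular.S_eq {p : Coord} (hp : p.Regular) (γ : ℝ) (n : ℕ) {τ : ℝ≥0∞} (hτ : τ ≠ ∞)
    (u : ℝ) :
    p.S γ n τ u
      = (estPoly p.ratio ((2 * p.σp * p.d τ ^ 2).toNNReal : ℝ) (p.order γ n - 1 + 2)).eval u := by
  have hpos := hp.noise_pos hτ
  have hs : √(2 * p.σp * p.d τ ^ 2) ≠ 0 := (Real.sqrt_pos.mpr hpos).ne'
  rw [Real.coe_toNNReal _ hpos.le, eval_estPoly, Finset.sum_range_succ', Finset.sum_range_succ',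
    Coord.S, Finset.mul_sum, (hasDerivAt_G 0 p.ratio).deriv]
  simp_rw [scaledHermite_eq_eval _ hs, Real.sq_sqrt hpos.le]
  simp only [taylorCoeff, hermiteVar, G]
  have : ∀ k, stdPdf 0 * ((-1) ^ k * (((Polynomial.hermite k).eval 0 : ℤ) : ℝ)
        / ((k + 2).factorial : ℝ) * (hermiteVar (2 * p.σp * p.d τ ^ 2) (k + 2)).eval u)
      = stdPdf 0 * ((-1) ^ k * (((Polynomial.hermite k).eval 0 : ℤ) : ℝ)
        / ((k + 2).factorial : ℝ)) * (hermiteVar (2 * p.σp * p.d τ ^ 2) (k + 2)).eval u :=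
    fun k => by ring
  simp only [hermiteVar] at this ⊢
  simp_rw [this]
  simp
  ring

/-- The threshold estimate of one coordinate in terms of its pseudo-samples. -/
theorem Coord.Regular.That_eq {p : Coord} (hp : p.Regular) (γ : ℝ) (n : ℕ) {τ : ℝ≥0∞}
    (hτ : τ ≠ ∞) (w : ℝ × ℝ) :
    p.That γ n τ w.1 w.2 = thresh p.ratio (threshold γ n)
      (fun u => trunc n ((estPoly p.ratio ((2 * p.σp * p.d τ ^ 2).toNNReal : ℝ)
        (p.order γ n - 1 + 2)).eval u))
      (p.c τ + p.d τ * (w.1 + √p.σp * w.2), p.c τ + p.d τ * (w.1 - √p.σp * w.2)) := by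
  simp only [Coord.That, thresh, Coord.Strunc, hp.S_eq γ n hτ, trunc]

theorem measurable_thresh (β l : ℝ) {f : ℝ → ℝ} (hf : Measurable f) :
    Measurable (thresh β l f) := by
  unfold thresh
  refine Measurable.ite (measurableSet_lt measurable_snd measurable_const) (by fun_prop) ?_
  exact Measurable.ite (measurableSet_le measurable_snd measurable_const)
    (hf.comp measurable_fst) (by fun_prop)

/-- Jensen's inequality, in the form of nonnegativity of the variance. -/
theorem sq_integral_sub_le {α : Type*} [MeasurableSpace α] {ν : Measure α}
    [IsProbabilityMeasure ν] {f : α → ℝ} (hf : AEStronglyMeasurable f ν) {κ : ℝ}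
    (hI : Integrable (fun x => (f x - κ) ^ 2) ν) :
    (∫ x, f x ∂ν - κ) ^ 2 ≤ ∫ x, (f x - κ) ^ 2 ∂ν := by
  have hm : MemLp (fun x => f x - κ) 2 ν :=
    (memLp_two_iff_integrable_sq (hf.sub aestronglyMeasurable_const)).mpr hI
  have h := variance_eq_sub hm
  have h2 := variance_nonneg (fun x => f x - κ) ν
  have h3 : Integrable f ν := by
    have := (hm.integrable (by norm_num)).add (integrable_const κ)
    refine this.congr (ae_of_all _ fun x => ?_)
    simp
  have e : ∫ x, f x ∂ν - κ = ∫ x, (f x - κ) ∂ν := by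
    rw [integral_sub h3 (integrable_const κ)]
    simp
  rw [e]
  have e2 : ∫ x, (f x - κ) ^ 2 ∂ν = ∫ x, ((fun x => f x - κ) ^ 2) x ∂ν := rfl
  rw [e2]
  linarith

theorem threshold_nonneg {γ : ℝ} (hγ : 0 ≤ γ) (n : ℕ) : 0 ≤ threshold γ n :=
  mul_nonneg hγ (Real.sqrt_nonneg _)

/-- The order is at least e² times the squared threshold. Half of e² > 7.3 times log 2 exceeds 5/2,
the rate that the Taylor remainder needs. -/
theorem Coord.Regular.order_bound {p : Coord} (_hp : p.Regular) {γ : ℝ} (hγ : 0 ≤ γ) {n : ℕ}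
    (hn : 0 < n) :
    5 / 2 * threshold γ n ^ 2 ≤ ((p.order γ n - 1 + 1) / 2 : ℕ) * Real.log 2 := by
  have hlog : 0 ≤ Real.log n := Real.log_nonneg (by exact_mod_cast hn)
  set N := p.order γ n - 1 with hN
  have h1 : Real.exp 2 * (γ + √(2 * p.σp / p.σf)) ^ 2 * (2 * Real.log n) ≤ N := by
    rw [hN, Coord.order, Nat.add_sub_cancel_left]
    exact Nat.le_ceil _
  have h2 : threshold γ n ^ 2 = γ ^ 2 * (2 * Real.log n) := by
    rw [threshold, mul_pow, Real.sq_sqrt (by positivity)]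
  have h3 : γ ^ 2 ≤ (γ + √(2 * p.σp / p.σf)) ^ 2 := by
    have := Real.sqrt_nonneg (2 * p.σp / p.σf)
    gcongr
    linarith
  have he : 73 / 10 ≤ Real.exp 2 := by
    have : Real.exp 2 = Real.exp 1 * Real.exp 1 := by rw [← Real.exp_add]; norm_num
    rw [this]
    nlinarith [Real.exp_one_gt_d9]
  have h4 : 73 / 10 * threshold γ n ^ 2 ≤ N := by
    rw [h2]
    refine le_trans ?_ h1
    rw [← mul_assoc]
    gcongr
  have h5 : (N : ℝ) / 2 ≤ ((N + 1) / 2 : ℕ) := by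
    have : N ≤ 2 * ((N + 1) / 2) := by omega
    have : (N : ℝ) ≤ 2 * ((N + 1) / 2 : ℕ) := by exact_mod_cast this
    linarith
  have h6 := Real.log_two_gt_d9
  have h7 : 73 / 20 * threshold γ n ^ 2 ≤ ((N + 1) / 2 : ℕ) := by linarith
  have h8 := mul_le_mul_of_nonneg_left h6.le (Nat.cast_nonneg (α := ℝ) ((N + 1) / 2))
  linarith [sq_nonneg (threshold γ n)]

section coord

variable {p : Coord}

theorem Coord.Regular.measurable_That (hp : p.Regular) (γ : ℝ) (n : ℕ) {τ : ℝ≥0∞} (hτ : τ ≠ ∞) :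
    Measurable (fun w : ℝ × ℝ => p.That γ n τ w.1 w.2) := by
  simp_rw [hp.That_eq γ n hτ]
  refine (measurable_thresh _ _ ?_).comp (by fun_prop)
  exact ((continuous_trunc (Nat.cast_nonneg n)).comp (by fun_prop)).measurable

theorem Coord.Regular.measurable_ThatRB (hp : p.Regular) (γ : ℝ) (n : ℕ) {τ : ℝ≥0∞}
    (hτ : τ ≠ ∞) : Measurable (p.ThatRB γ n τ) :=
  ((hp.measurable_That γ n hτ).stronglyMeasurable.integral_prod_right
    (ν := gaussianReal 0 1)).measurable

/-- Bias and second moment of the averaged threshold estimate. -/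
theorem Coord.Regular.ThatRB_moments (hp : p.Regular) {γ : ℝ} (hγ : 0 ≤ γ) {n : ℕ} (hn : 0 < n)
    {τ : ℝ≥0∞} (hτ : τ ≠ ∞) (θ : ℝ) :
    (Integrable (p.ThatRB γ n τ) (gaussianReal θ p.σp.toNNReal) ∧
      |∫ x, p.ThatRB γ n τ x ∂(gaussianReal θ p.σp.toNNReal) - G (p.c τ + p.d τ * θ) p.ratio|
        ≤ 9 * Real.exp (-threshold γ n ^ 2 / 8)
          + 400 * Real.exp (40 / 13 * threshold γ n ^ 2) / n) ∧
    ∃ κ : ℝ, Integrable (fun x => (p.ThatRB γ n τ x - κ) ^ 2) (gaussianReal θ p.σp.toNNReal) ∧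
      ∫ x, (p.ThatRB γ n τ x - κ) ^ 2 ∂(gaussianReal θ p.σp.toNNReal)
        ≤ 900 * Real.exp (40 / 13 * threshold γ n ^ 2) := by
  have hpos := hp.noise_pos hτ
  set v := (2 * p.σp * p.d τ ^ 2).toNNReal with hvdef
  have hv : v ≠ 0 := (Real.toNNReal_pos.mpr hpos).ne'
  have hv2 : (v : ℝ) ≤ 3 / 16 := by
    rw [hvdef, Real.coe_toNNReal _ hpos.le]
    exact hp.noise_le τ
  set m := p.c τ + p.d τ * θ with hm
  set N := p.order γ n - 1 with hN
  set T := thresh p.ratio (threshold γ n)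
    (fun u => trunc n ((estPoly p.ratio (v : ℝ) (N + 2)).eval u)) with hT
  set Φ : ℝ × ℝ → ℝ × ℝ := fun w =>
    (p.c τ + p.d τ * (w.1 + √p.σp * w.2), p.c τ + p.d τ * (w.1 - √p.σp * w.2)) with hΦ
  set μX := gaussianReal θ p.σp.toNNReal
  set μZ := gaussianReal 0 1
  have hΦm : Measurable Φ := by fun_prop
  have hTm : Measurable T := measurable_thresh _ _
    ((continuous_trunc (Nat.cast_nonneg n)).comp (by fun_prop)).measurable
  have hmap : (μX.prod μZ).map Φ = (gaussianReal m v).prod (gaussianReal m v) :=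
    map_add_sub_gaussianReal θ (p.c τ) (p.d τ) hp.σp_pos.le
  have hThat : ∀ w : ℝ × ℝ, p.That γ n τ w.1 w.2 = T (Φ w) := fun w => hp.That_eq γ n hτ w
  have hl := threshold_nonneg hγ n
  have hbias := abs_integral_thresh_sub_le (m := m) hp.ratio_nonneg hp.ratio_le_one hv hv2 hl hn
    (N := N) (hp.order_bound hγ hn)
  obtain ⟨hIsq, hsq⟩ := integral_thresh_sub_sq_le (m := m) (n := n) (N := N + 2) hp.ratio_nonneg
    hp.ratio_le_one hv hv2 hl
  set κ := sideSlope p.ratio m * m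
  rw [← hmap] at hbias hIsq hsq
  rw [integral_map hΦm.aemeasurable hTm.aestronglyMeasurable] at hbias
  have hTm2 : Measurable (fun w => (T w - κ) ^ 2) := (hTm.sub_const κ).pow_const 2
  rw [integral_map hΦm.aemeasurable hTm2.aestronglyMeasurable] at hsq
  rw [integrable_map_measure hTm2.aestronglyMeasurable hΦm.aemeasurable] at hIsq
  have hIsq2 : Integrable (fun w : ℝ × ℝ => (p.That γ n τ w.1 w.2 - κ) ^ 2) (μX.prod μZ) := by
    simp_rw [hThat]
    exact hIsq
  have hFm := hp.measurable_That γ n hτ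
  have hI1 : Integrable (fun w : ℝ × ℝ => p.That γ n τ w.1 w.2) (μX.prod μZ) := by
    have hm2 : MemLp (fun w : ℝ × ℝ => p.That γ n τ w.1 w.2 - κ) 2 (μX.prod μZ) :=
      (memLp_two_iff_integrable_sq (hFm.sub_const κ).aestronglyMeasurable).mpr hIsq2
    have := (hm2.integrable (by norm_num)).add (integrable_const κ)
    refine this.congr (ae_of_all _ fun x => ?_)
    simp
  have hRB : ∫ x, p.ThatRB γ n τ x ∂μX = ∫ w, T (Φ w) ∂(μX.prod μZ) := by
    simp_rw [← hThat]
    rw [integral_prod _ hI1]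
    rfl
  refine ⟨⟨hI1.integral_prod_left, ?_⟩, κ, ?_⟩
  · rw [hRB]
    exact hbias
  -- Averaging over the added noise z does not increase the second moment, while by Fubini it
  -- preserves the mean.
  have hae : ∀ᵐ x ∂μX, (p.ThatRB γ n τ x - κ) ^ 2 ≤ ∫ z, (p.That γ n τ x z - κ) ^ 2 ∂μZ := by
    filter_upwards [hIsq2.prod_right_ae] with x hx
    exact sq_integral_sub_le (hFm.comp measurable_prodMk_left).aestronglyMeasurable hx
  have hIL := hIsq2.integral_prod_left
  have hIR : Integrable (fun x => (p.ThatRB γ n τ x - κ) ^ 2) μX := by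
    refine hIL.mono (((hp.measurable_ThatRB γ n hτ).sub_const κ).pow_const 2).aestronglyMeasurable ?_
    filter_upwards [hae] with x hx
    rw [Real.norm_of_nonneg (sq_nonneg _), Real.norm_of_nonneg ((sq_nonneg _).trans hx)]
    exact hx
  refine ⟨hIR, (integral_mono_ae hIR hIL hae).trans ?_⟩
  rw [← integral_prod _ hIsq2]
  simp_rw [hThat]
  exact hsq

end coord

/-! ### The predictive loss and the risk of the shrinkage rule. -/

section loss

variable {p : Coord}

theorem integrable_loss (p : Coord) (θ q : ℝ) :
    Integrable (fun y => p.b * max (y - q) 0 + p.h * max (q - y) 0)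
      (gaussianReal θ p.σf.toNNReal) := by
  have hid := integrable_id_gaussianReal θ p.σf.toNNReal
  exact (((hid.sub (integrable_const q)).pos_part).const_mul _).add
    ((((integrable_const q).sub hid).pos_part).const_mul _)

theorem Coord.Regular.abs_loss_sub_le (hp : p.Regular) (θ q q' : ℝ) :
    |p.loss θ q - p.loss θ q'| ≤ (p.b + p.h) * |q - q'| := by
  have hb := hp.b_pos
  have hh := hp.h_pos
  unfold Coord.loss
  rw [← integral_sub (integrable_loss p θ q) (integrable_loss p θ q')]
  have h := norm_integral_le_of_norm_le_const (μ := gaussianReal θ p.σf.toNNReal)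
    (f := fun y => p.b * max (y - q) 0 + p.h * max (q - y) 0
      - (p.b * max (y - q') 0 + p.h * max (q' - y) 0)) (C := (p.b + p.h) * |q - q'|)
    (ae_of_all _ fun y => ?_)
  · simpa using h
  · have h1 : |max (y - q) 0 - max (y - q') 0| ≤ |q - q'| := by
      refine (abs_max_sub_max_le_abs _ _ _).trans (le_of_eq ?_)
      rw [abs_sub_comm]
      congr 1
      ring
    have h2 : |max (q - y) 0 - max (q' - y) 0| ≤ |q - q'| := by
      refine (abs_max_sub_max_le_abs _ _ _).trans (le_of_eq ?_)
      congr 1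
      ring
    rw [Real.norm_eq_abs]
    calc _ = |p.b * (max (y - q) 0 - max (y - q') 0)
          + p.h * (max (q - y) 0 - max (q' - y) 0)| := by
          congr 1
          ring
      _ ≤ p.b * |max (y - q) 0 - max (y - q') 0| + p.h * |max (q - y) 0 - max (q' - y) 0| := by
          refine (abs_add_le _ _).trans (le_of_eq ?_)
          rw [abs_mul, abs_mul, abs_of_pos hb, abs_of_pos hh]
      _ ≤ p.b * |q - q'| + p.h * |q - q'| := by gcongr
      _ = _ := by ring

/-- Writing (y - q)⁺ = (y - q) + (q - y)⁺ leaves a single positive part, whose Gaussian mean is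
known. -/
theorem loss_eq (p : Coord) (θ q : ℝ) :
    p.loss θ q = p.b * (θ - q)
      + (p.b + p.h) * ∫ y, max (q - y) 0 ∂(gaussianReal θ p.σf.toNNReal) := by
  have hid := integrable_id_gaussianReal θ p.σf.toNNReal
  have h1 : Integrable (fun y => y - q) (gaussianReal θ p.σf.toNNReal) :=
    hid.sub (integrable_const q)
  have h2 : Integrable (fun y => max (q - y) 0) (gaussianReal θ p.σf.toNNReal) :=
    ((integrable_const q).sub hid).pos_part
  have e : ∀ y, p.b * max (y - q) 0 + p.h * max (q - y) 0
      = p.b * (y - q) + (p.b + p.h) * max (q - y) 0 := by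
    intro y
    rcases le_total (y - q) 0 with h | h
    · rw [max_eq_right h, max_eq_left (by linarith)]; ring
    · rw [max_eq_left h, max_eq_right (by linarith)]; ring
  unfold Coord.loss
  simp_rw [e]
  rw [integral_add (h1.const_mul _) (h2.const_mul _), integral_const_mul, integral_const_mul,
    integral_sub hid (integrable_const q), integral_id_gaussianReal]
  simp

theorem Coord.Regular.continuous_loss (hp : p.Regular) (θ : ℝ) : Continuous (p.loss θ) := by
  have h0 : 0 ≤ p.b + p.h := (add_pos hp.b_pos hp.h_pos).le
  refine (LipschitzWith.of_dist_le_mul (K := ⟨p.b + p.h, h0⟩) fun q q' => ?_).continuous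
  rw [Real.dist_eq, Real.dist_eq]
  exact hp.abs_loss_sub_le θ q q'

/-- The risk of the shrinkage predictor. -/
theorem Coord.Regular.integral_loss_predictor (hp : p.Regular) (θ η : ℝ) (τ : ℝ≥0∞) :
    Integrable (fun x => p.loss θ (p.predictor η τ x)) (gaussianReal θ p.σp.toNNReal) ∧
    ∫ x, p.loss θ (p.predictor η τ x) ∂(gaussianReal θ p.σp.toNNReal)
      = (p.b + p.h) * p.scale τ * G (p.c τ + p.d τ * (θ - η)) p.ratio := by
  set μX := gaussianReal θ p.σp.toNNReal
  set μY := gaussianReal θ p.σf.toNNReal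
  set α := p.shrink τ with hα
  set r := (1 - α) * η + √(p.σf + α * p.σp) * stdQuantile p.ratio with hr
  have hpred : ∀ x, p.predictor η τ x = α * x + r := by
    intro x
    rw [Coord.predictor, hr]
    ring
  have hidX : Integrable (fun x : ℝ => x) μX := integrable_id_gaussianReal θ _
  have hidY : Integrable (fun x : ℝ => x) μY := integrable_id_gaussianReal θ _
  have hW : Integrable (fun w : ℝ × ℝ => max (α * w.1 + r - w.2) 0) (μX.prod μY) :=
    ((((hidX.comp_fst μY).const_mul α).add (integrable_const r)).sub (hidY.comp_snd μX)).pos_part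
  -- The prediction error is a difference of independent normals; c and d are chosen so that its
  -- mean divided by its standard deviation `scale` is c + d(θ - η).
  have hmap : (μX.prod μY).map (fun w : ℝ × ℝ => α * w.1 + r - w.2)
      = gaussianReal (p.scale τ * (p.c τ + p.d τ * (θ - η))) (p.scale τ ^ 2).toNNReal := by
    have h1 : HasLaw (fun w : ℝ × ℝ => w.1) μX (μX.prod μY) := ⟨by fun_prop, by simp⟩
    have h2 : HasLaw (fun w : ℝ × ℝ => w.2) μY (μX.prod μY) := ⟨by fun_prop, by simp⟩
    have hind : IndepFun (fun w : ℝ × ℝ => w.1) (fun w : ℝ × ℝ => w.2) (μX.prod μY) :=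
      indepFun_prod (X := id) (Y := id) measurable_id measurable_id
    have hl1 := gaussianReal_add_const (gaussianReal_const_mul h1 α) r
    have hl2 := gaussianReal_neg h2
    have hi : IndepFun (fun w : ℝ × ℝ => α * w.1 + r) (fun w : ℝ × ℝ => -w.2) (μX.prod μY) :=
      hind.comp (φ := fun x => α * x + r) (ψ := fun x => -x) (by fun_prop) (by fun_prop)
    have h := gaussianReal_add_gaussianReal_of_indepFun hi hl1.map_eq hl2.map_eq
    have e : (fun w : ℝ × ℝ => α * w.1 + r - w.2)
        = (fun w : ℝ × ℝ => α * w.1 + r) + (fun w : ℝ × ℝ => -w.2) := by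
      ext w
      simp [sub_eq_add_neg]
    rw [e, h]
    congr 1
    · rw [mul_add, ← mul_assoc, hp.scale_mul_c, hp.scale_mul_d, hr]
      ring
    · ext
      rw [hp.scale_sq, Real.coe_toNNReal _ (hp.scale_arg_pos τ).le]
      simp only [NNReal.coe_add, NNReal.coe_mul, Real.coe_toNNReal _ hp.σp_pos.le,
        Real.coe_toNNReal _ hp.σf_pos.le, NNReal.coe_mk]
      ring
  have hprod : ∫ x, ∫ y, max (α * x + r - y) 0 ∂μY ∂μX
      = p.scale τ * posMean (p.c τ + p.d τ * (θ - η)) := by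
    rw [← integral_prod (fun w : ℝ × ℝ => max (α * w.1 + r - w.2) 0) hW,
      ← integral_max_gaussianReal _ (hp.scale_pos τ).le, ← hmap, integral_map (by fun_prop)
      (Continuous.aestronglyMeasurable (by fun_prop))]
  simp_rw [hpred, loss_eq]
  have i1 : Integrable (fun x => p.b * (θ - (α * x + r))) μX :=
    ((integrable_const θ).sub ((hidX.const_mul α).add (integrable_const r))).const_mul p.b
  have i2 : Integrable (fun x => (p.b + p.h) * ∫ y, max (α * x + r - y) 0 ∂μY) μX :=
    hW.integral_prod_left.const_mul _
  refine ⟨i1.add i2, ?_⟩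
  have hax : Integrable (fun x => α * x + r) μX := (hidX.const_mul α).add (integrable_const r)
  rw [integral_add i1 i2, integral_const_mul, integral_const_mul, hprod,
    integral_sub (integrable_const θ) hax,
    integral_add (hidX.const_mul α) (integrable_const r), integral_const_mul,
    integral_id_gaussianReal, G_eq]
  simp only [integral_const, probReal_univ, smul_eq_mul, one_mul]
  have hs : p.scale τ * (p.c τ + p.d τ * (θ - η)) = α * θ + r - θ := by
    rw [mul_add, ← mul_assoc, hp.scale_mul_c, hp.scale_mul_d, hr]
    ring
  have hβ : (p.b + p.h) * p.ratio = p.b := by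
    rw [Coord.ratio, mul_div_cancel₀ _ (add_pos hp.b_pos hp.h_pos).ne']
  linear_combination p.b * hs + p.scale τ * (p.c τ + p.d τ * (θ - η)) * hβ

end loss

/-! ### Error moments and the growth of the exponential terms. -/

/-- The error of the risk estimate of one coordinate, as a function of the past observation. -/
noncomputable def Coord.err (p : Coord) (γ : ℝ) (n : ℕ) (θ η : ℝ) (τ : ℝ≥0∞) (x : ℝ) : ℝ :=
  (p.b + p.h) * p.scale τ * p.ThatRB γ n τ (x - η) - p.loss θ (p.predictor η τ x)

theorem Coord.Regular.measurable_err {p : Coord} (hp : p.Regular) (γ : ℝ) (n : ℕ) (θ η : ℝ)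
    {τ : ℝ≥0∞} (hτ : τ ≠ ∞) : Measurable (p.err γ n θ η τ) := by
  have h1 := (hp.measurable_ThatRB γ n hτ).comp (measurable_id.sub_const η)
  have h2 : Measurable (fun x => p.loss θ (p.predictor η τ x)) :=
    (hp.continuous_loss θ).measurable.comp (by unfold Coord.predictor; fun_prop)
  exact (h1.const_mul _).sub h2

/-- Bias and second moment of the error of the risk estimate of one coordinate. -/
theorem Coord.Regular.err_moments {p : Coord} (hp : p.Regular) {γ : ℝ} (hγ : 0 ≤ γ) {n : ℕ}
    (hn : 0 < n) {τ : ℝ≥0∞} (hτ : τ ≠ ∞) (θ η : ℝ) {D : ℝ} (hD1 : p.b + p.h ≤ D)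
    (hD2 : p.σf ≤ D) (hD : 1 ≤ D) :
    |∫ x, p.err γ n θ η τ x ∂(gaussianReal θ p.σp.toNNReal)|
        ≤ D * (2 * D) * (9 * Real.exp (-threshold γ n ^ 2 / 8)
          + 400 * Real.exp (40 / 13 * threshold γ n ^ 2) / n) ∧
    ∃ κ : ℝ, Integrable (fun x => (p.err γ n θ η τ x - κ) ^ 2)
        (gaussianReal θ p.σp.toNNReal) ∧
      ∫ x, (p.err γ n θ η τ x - κ) ^ 2 ∂(gaussianReal θ p.σp.toNNReal)
        ≤ 2 * (D * (2 * D)) ^ 2 * (900 * Real.exp (40 / 13 * threshold γ n ^ 2))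
          + 2 * D ^ 2 * D := by
  obtain ⟨⟨hI, hB⟩, κ, hκI, hκ⟩ := hp.ThatRB_moments hγ hn hτ (θ - η)
  obtain ⟨hL, hLe⟩ := hp.integral_loss_predictor θ η τ
  have hbh : 0 < p.b + p.h := add_pos hp.b_pos hp.h_pos
  have hsc := hp.scale_pos τ
  set μX := gaussianReal θ p.σp.toNNReal with hμX
  have hmap : μX.map (fun x => x - η) = gaussianReal (θ - η) p.σp.toNNReal :=
    gaussianReal_map_sub_const η
  have hmeas : Measurable (fun x : ℝ => x - η) := by fun_prop
  have hTm := hp.measurable_ThatRB γ n hτ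
  rw [← hmap] at hI hB hκI hκ
  have hκm : Measurable (fun x => (p.ThatRB γ n τ x - κ) ^ 2) := (hTm.sub_const κ).pow_const 2
  rw [integrable_map_measure hTm.aestronglyMeasurable hmeas.aemeasurable] at hI
  rw [integrable_map_measure hκm.aestronglyMeasurable hmeas.aemeasurable] at hκI
  rw [integral_map hmeas.aemeasurable hTm.aestronglyMeasurable] at hB
  rw [integral_map hmeas.aemeasurable hκm.aestronglyMeasurable] at hκ
  have hI' : Integrable (fun x => p.ThatRB γ n τ (x - η)) μX := hI
  have hκI' : Integrable (fun x => (p.ThatRB γ n τ (x - η) - κ) ^ 2) μX := hκI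
  have hs2 : p.scale τ ≤ 2 * D := by
    refine (hp.scale_le τ).trans (Real.sqrt_le_iff.mpr ⟨by linarith, by nlinarith⟩)
  have hw : (p.b + p.h) * p.scale τ ≤ D * (2 * D) := by gcongr
  have hw0 : 0 ≤ (p.b + p.h) * p.scale τ := by positivity
  constructor
  · have e : ∫ x, p.err γ n θ η τ x ∂μX = (p.b + p.h) * p.scale τ *
        (∫ x, p.ThatRB γ n τ (x - η) ∂μX - G (p.c τ + p.d τ * (θ - η)) p.ratio) := by
      unfold Coord.err
      rw [integral_sub (hI'.const_mul _) hL, hLe, integral_const_mul]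
      ring
    rw [e, abs_mul, abs_of_nonneg hw0]
    gcongr
  · set q0 := p.loss θ (p.predictor η τ θ)
    have hI2 : Integrable (fun x => (x - θ) ^ 2) μX := by
      simpa using integrable_sub_sq_gaussianReal θ p.σp.toNNReal 1 θ
    have hpt : ∀ x, (p.err γ n θ η τ x - ((p.b + p.h) * p.scale τ * κ - q0)) ^ 2
        ≤ 2 * (D * (2 * D)) ^ 2 * (p.ThatRB γ n τ (x - η) - κ) ^ 2 + 2 * D ^ 2 * (x - θ) ^ 2 := by
      intro x
      have h1 : |p.loss θ (p.predictor η τ x) - q0| ≤ D * |x - θ| := by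
        refine (hp.abs_loss_sub_le θ _ _).trans ?_
        have : p.predictor η τ x - p.predictor η τ θ = p.shrink τ * (x - θ) := by
          unfold Coord.predictor
          ring
        rw [this, abs_mul, abs_of_nonneg (hp.shrink_nonneg τ)]
        have := hp.shrink_le_one τ
        have h2 : p.shrink τ * |x - θ| ≤ |x - θ| := mul_le_of_le_one_left (abs_nonneg _) this
        exact mul_le_mul hD1 h2 (mul_nonneg (hp.shrink_nonneg τ) (abs_nonneg _)) (by linarith)
      have h2 : (p.loss θ (p.predictor η τ x) - q0) ^ 2 ≤ D ^ 2 * (x - θ) ^ 2 := by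
        rw [← sq_abs (p.loss θ (p.predictor η τ x) - q0), ← sq_abs (x - θ), ← mul_pow]
        exact pow_le_pow_left₀ (abs_nonneg _) h1 2
      have h3 : ((p.b + p.h) * p.scale τ) ^ 2 * (p.ThatRB γ n τ (x - η) - κ) ^ 2
          ≤ (D * (2 * D)) ^ 2 * (p.ThatRB γ n τ (x - η) - κ) ^ 2 := by gcongr
      have h4 : ∀ a b : ℝ, (a - b) ^ 2 ≤ 2 * a ^ 2 + 2 * b ^ 2 := fun a b => by
        nlinarith [sq_nonneg (a + b)]
      have h5 := h4 ((p.b + p.h) * p.scale τ * (p.ThatRB γ n τ (x - η) - κ))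
        (p.loss θ (p.predictor η τ x) - q0)
      rw [mul_pow] at h5
      have e : p.err γ n θ η τ x - ((p.b + p.h) * p.scale τ * κ - q0)
          = (p.b + p.h) * p.scale τ * (p.ThatRB γ n τ (x - η) - κ)
            - (p.loss θ (p.predictor η τ x) - q0) := by
        unfold Coord.err
        ring
      rw [e]
      linarith
    have hIb : Integrable (fun x => 2 * (D * (2 * D)) ^ 2 * (p.ThatRB γ n τ (x - η) - κ) ^ 2
        + 2 * D ^ 2 * (x - θ) ^ 2) μX := (hκI'.const_mul _).add (hI2.const_mul _)
    have hIe : Integrable (fun x =>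
        (p.err γ n θ η τ x - ((p.b + p.h) * p.scale τ * κ - q0)) ^ 2) μX := by
      refine hIb.mono (((hp.measurable_err γ n θ η hτ).sub_const _).pow_const
        2).aestronglyMeasurable (ae_of_all _ fun x => ?_)
      rw [Real.norm_of_nonneg (sq_nonneg _), Real.norm_of_nonneg ((sq_nonneg _).trans (hpt x))]
      exact hpt x
    refine ⟨_, hIe, (integral_mono hIe hIb hpt).trans ?_⟩
    rw [integral_add (hκI'.const_mul _) (hI2.const_mul _), integral_const_mul, integral_const_mul,
      integral_sub_sq_gaussianReal, Real.coe_toNNReal _ hp.σp_pos.le]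
    have := hp.σp_le_σf
    gcongr
    linarith

/-- With γ² ≤ 1/(4e) ≤ 39/400 the exponent is at most (40/13) · 2 · (39/400) log n = (3/5) log n.
Any power of n below 1 would suffice for Chebyshev's inequality. -/
theorem exp_threshold_sq_le {γ : ℝ} (hγ : 0 < γ) (hγ2 : γ ≤ 1 / √(4 * Real.exp 1)) {n : ℕ}
    (hn : 0 < n) : Real.exp (40 / 13 * threshold γ n ^ 2) ≤ (n : ℝ) ^ (3 / 5 : ℝ) := by
  have hn0 : (0 : ℝ) < n := by exact_mod_cast hn
  have hlog : 0 ≤ Real.log n := Real.log_nonneg (by exact_mod_cast hn)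
  have h2 : threshold γ n ^ 2 = γ ^ 2 * (2 * Real.log n) := by
    rw [threshold, mul_pow, Real.sq_sqrt (by positivity)]
  have h3 : γ ^ 2 ≤ 1 / (4 * Real.exp 1) := by
    have := pow_le_pow_left₀ hγ.le hγ2 2
    rwa [div_pow, Real.sq_sqrt (by positivity), one_pow] at this
  have h4 : 1 / (4 * Real.exp 1) ≤ 39 / 400 := by
    rw [div_le_iff₀ (by positivity)]
    linarith [Real.exp_one_gt_d9]
  rw [Real.rpow_def_of_pos hn0, h2]
  apply Real.exp_le_exp.mpr
  nlinarith

theorem exp_neg_threshold_sq_le {γ γ₀ : ℝ} (hγ₀ : 0 < γ₀) (hγ : γ₀ ≤ γ) {n : ℕ} (hn : 0 < n) :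
    Real.exp (-threshold γ n ^ 2 / 8) ≤ (n : ℝ) ^ (-(γ₀ ^ 2 / 4)) := by
  have hn0 : (0 : ℝ) < n := by exact_mod_cast hn
  have hlog : 0 ≤ Real.log n := Real.log_nonneg (by exact_mod_cast hn)
  have h2 : threshold γ n ^ 2 = γ ^ 2 * (2 * Real.log n) := by
    rw [threshold, mul_pow, Real.sq_sqrt (by positivity)]
  have h3 : γ₀ ^ 2 ≤ γ ^ 2 := by gcongr
  rw [Real.rpow_def_of_pos hn0, h2]
  apply Real.exp_le_exp.mpr
  nlinarith

/-! ### Chebyshev's inequality for averages. -/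

section chebyshev

variable {Ω : Type*} [MeasurableSpace Ω] {μ : Measure Ω} [IsProbabilityMeasure μ]

/-- Chebyshev's inequality for averages of independent variables with small means. -/
theorem measure_le_abs_average_le {X : ℕ → Ω → ℝ} (hX : iIndepFun X μ) {ν : ℕ → Measure ℝ}
    (hlaw : ∀ i, HasLaw (X i) (ν i) μ) {F : ℕ → ℝ → ℝ} (hF : ∀ i, Measurable (F i))
    {n : ℕ} (hn : 0 < n) {ε V : ℝ} (hε : 0 < ε) (hmean : ∀ i, |∫ x, F i x ∂(ν i)| ≤ ε / 2)
    (hvar : ∀ i, ∃ κ : ℝ, Integrable (fun x => (F i x - κ) ^ 2) (ν i) ∧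
      ∫ x, (F i x - κ) ^ 2 ∂(ν i) ≤ V) :
    μ {ω | ε ≤ |(1 / (n : ℝ)) * ∑ i ∈ Finset.range n, F i (X i ω)|}
      ≤ ENNReal.ofReal (4 * V / (n * ε ^ 2)) := by
  have hn0 : (0 : ℝ) < n := by exact_mod_cast hn
  have hXm : ∀ i, AEMeasurable (X i) μ := fun i => (hlaw i).aemeasurable
  set Y : ℕ → Ω → ℝ := fun i ω => F i (X i ω) with hY
  have hYm : ∀ i, AEStronglyMeasurable (Y i) μ := fun i =>
    ((hF i).comp_aemeasurable (hXm i)).aestronglyMeasurable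
  have hsq : ∀ i, MemLp (Y i) 2 μ ∧ Var[Y i; μ] ≤ V := by
    intro i
    obtain ⟨κ, hI, hV⟩ := hvar i
    have hm : Measurable (fun x => (F i x - κ) ^ 2) := ((hF i).sub_const κ).pow_const 2
    rw [← (hlaw i).map_eq] at hI hV
    rw [integrable_map_measure hm.aestronglyMeasurable (hXm i)] at hI
    rw [integral_map (hXm i) hm.aestronglyMeasurable] at hV
    have h2 : MemLp (fun ω => Y i ω - κ) 2 μ :=
      (memLp_two_iff_integrable_sq ((hYm i).sub aestronglyMeasurable_const)).mpr hI
    refine ⟨?_, ?_⟩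
    · have := h2.add (memLp_const κ)
      refine this.congr_norm (hYm i) (ae_of_all _ fun ω => ?_)
      simp
    · rw [← variance_sub_const (hYm i) κ]
      exact (variance_le_expectation_sq h2.aestronglyMeasurable).trans hV
  have hmemW : MemLp (∑ i ∈ Finset.range n, Y i) 2 μ :=
    memLp_finsetSum' _ fun i _ => (hsq i).1
  have hEY : ∀ i, |∫ ω, Y i ω ∂μ| ≤ ε / 2 := by
    intro i
    have := hmean i
    rwa [← (hlaw i).map_eq, integral_map (hXm i) (hF i).aestronglyMeasurable] at this
  have hE : |∫ ω, (∑ i ∈ Finset.range n, Y i) ω ∂μ| ≤ n * (ε / 2) := by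
    simp_rw [Finset.sum_apply]
    rw [integral_finsetSum _ fun i _ => (hsq i).1.integrable (by norm_num)]
    refine (Finset.abs_sum_le_sum_abs _ _).trans ((Finset.sum_le_sum fun i _ => hEY i).trans ?_)
    simp
  have hvarW : Var[∑ i ∈ Finset.range n, Y i; μ] ≤ n * V := by
    rw [IndepFun.variance_sum (fun i _ => (hsq i).1) ?_]
    · refine (Finset.sum_le_sum fun i _ => (hsq i).2).trans ?_
      simp
    · intro i _ j _ hij
      exact (hX.indepFun hij).comp (hF i) (hF j)
  -- The means use up at most half of nε, leaving a deviation of nε/2 from the expectation; this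
  -- gives the factor 4.
  have hch := meas_ge_le_variance_div_sq hmemW (c := n * (ε / 2)) (by positivity)
  refine (measure_mono fun ω hω => ?_).trans (hch.trans (ENNReal.ofReal_le_ofReal ?_))
  · simp only [Set.mem_ofPred_eq, abs_mul] at hω ⊢
    have e : (∑ i ∈ Finset.range n, Y i) ω = ∑ i ∈ Finset.range n, F i (X i ω) := by
      rw [Finset.sum_apply]
    rw [e]
    rw [abs_of_nonneg (by positivity : (0 : ℝ) ≤ 1 / n), one_div, inv_mul_eq_div,
      le_div_iff₀ hn0] at hω
    have h1 := abs_sub_abs_le_abs_sub (∑ i ∈ Finset.range n, F i (X i ω))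
      (∫ ω, (∑ i ∈ Finset.range n, Y i) ω ∂μ)
    linarith
  · rw [div_le_div_iff₀ (by positivity) (by positivity)]
    have : 0 ≤ n * ε ^ 2 := by positivity
    nlinarith

end chebyshev

/-! ### Empirical quantiles. -/

section quantile

variable {n : ℕ} {x : ℕ → ℝ}

theorem card_filter_mul_le {P : ℕ → Prop} [DecidablePred P] {r S : ℝ}
    (hP : ∀ i, P i → r ≤ |x i|) (hS : ∑ i ∈ Finset.range n, |x i| ≤ S) :
    (((Finset.range n).filter P).card : ℝ) * r ≤ S := by
  calc (((Finset.range n).filter P).card : ℝ) * r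
      = ∑ i ∈ (Finset.range n).filter P, r := by simp
    _ ≤ ∑ i ∈ (Finset.range n).filter P, |x i| :=
        Finset.sum_le_sum fun i hi => hP i (Finset.mem_filter.mp hi).2
    _ ≤ ∑ i ∈ Finset.range n, |x i| :=
        Finset.sum_le_sum_of_subset_of_nonneg (Finset.filter_subset _ _)
          fun i _ _ => abs_nonneg _
    _ ≤ S := hS

/-- If t < -r, the at least αn observations below t would by themselves make the sum of |x_i| at
least αnr > nR. -/
theorem lower_bound_of_mem_quantileSet (hn : 0 < n) {R r α t : ℝ} (hr : 0 < r)
    (hS : ∑ i ∈ Finset.range n, |x i| ≤ n * R) (h1 : R < α * r)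
    (ht : α ≤ (((Finset.range n).filter fun i => x i ≤ t).card : ℝ) / n) : -r ≤ t := by
  by_contra! hlt
  have hn0 : (0 : ℝ) < n := by exact_mod_cast hn
  have h := card_filter_mul_le (P := fun i => x i ≤ t) (r := r) (fun i hi => by
    rw [abs_of_neg (by linarith)]
    linarith) hS
  rw [le_div_iff₀ hn0] at ht
  have : α * n * r ≤ n * R := (mul_le_mul_of_nonneg_right ht hr.le).trans h
  nlinarith

theorem mem_quantileSet (hn : 0 < n) {R r α : ℝ} (hr : 0 < r)
    (hS : ∑ i ∈ Finset.range n, |x i| ≤ n * R) (h2 : R < (1 - α) * r) :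
    α ≤ (((Finset.range n).filter fun i => x i ≤ r).card : ℝ) / n := by
  have hn0 : (0 : ℝ) < n := by exact_mod_cast hn
  have h := card_filter_mul_le (P := fun i => ¬ x i ≤ r) (r := r) (fun i hi => by
    rw [not_le] at hi
    exact hi.le.trans (le_abs_self _)) hS
  have hc := Finset.card_filter_add_card_filter_not (s := Finset.range n) (fun i => x i ≤ r)
  rw [Finset.card_range] at hc
  have hc' : (((Finset.range n).filter fun i => x i ≤ r).card : ℝ)
      + (((Finset.range n).filter fun i => ¬ x i ≤ r).card : ℝ) = n := by exact_mod_cast hc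
  rw [le_div_iff₀ hn0]
  by_contra! hlt
  have : (1 - α) * n * r ≤ n * R := by
    refine le_trans ?_ h
    gcongr
    linarith
  nlinarith

theorem abs_empQuantile_le (hn : 0 < n) {R r α : ℝ} (hr : 0 < r)
    (hS : ∑ i ∈ Finset.range n, |x i| ≤ n * R) (h1 : R < α * r) (h2 : R < (1 - α) * r) :
    |empQuantile n x α| ≤ r := by
  have hmem := mem_quantileSet hn hr hS h2
  have hlow := fun t => lower_bound_of_mem_quantileSet (t := t) hn hr hS h1
  rw [abs_le]
  exact ⟨le_csInf ⟨r, hmem⟩ hlow, csInf_le ⟨-r, hlow⟩ hmem⟩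

/-- If two empirical quantiles are close, then many pairs of observations are close. -/
theorem card_pairs_of_empQuantile_lt (hn : 0 < n) {R r α β g : ℝ} (hr : 0 < r) (hαβ : α ≤ β)
    (hS : ∑ i ∈ Finset.range n, |x i| ≤ n * R) (h1 : R < α * r) (h2 : R < (1 - β) * r)
    (hlt : empQuantile n x β < empQuantile n x α + g) :
    (n * (β - α)) ^ 2 ≤ ((((Finset.range n) ×ˢ (Finset.range n)).filter
      fun k => |x k.1 - x k.2| ≤ g).card : ℝ) := by
  have hn0 : (0 : ℝ) < n := by exact_mod_cast hn
  obtain ⟨t, ht, htlt⟩ := exists_lt_of_csInf_lt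
    (s := {t : ℝ | β ≤ (((Finset.range n).filter fun i => x i ≤ t).card : ℝ) / n})
    ⟨r, mem_quantileSet hn hr hS h2⟩ hlt
  have hnot : t - g ∉ {t : ℝ | α ≤ (((Finset.range n).filter fun i => x i ≤ t).card : ℝ) / n} :=
    notMem_of_lt_csInf (by unfold empQuantile at htlt; linarith)
      ⟨-r, fun t => lower_bound_of_mem_quantileSet (t := t) hn hr hS h1⟩
  simp only [Set.mem_ofPred_eq, not_le] at ht hnot
  -- The level β is reached at t while α is not reached at t - g, so this window of length g holds
  -- at least n(β - α) observations, and any two of them are within g.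
  set A := (Finset.range n).filter fun i => t - g < x i ∧ x i ≤ t with hA
  have hsub : ((Finset.range n).filter fun i => x i ≤ t)
      ⊆ ((Finset.range n).filter fun i => x i ≤ t - g) ∪ A := by
    intro i hi
    rw [Finset.mem_filter] at hi
    rw [Finset.mem_union, Finset.mem_filter, hA, Finset.mem_filter]
    rcases le_or_gt (x i) (t - g) with h | h
    · exact Or.inl ⟨hi.1, h⟩
    · exact Or.inr ⟨hi.1, h, hi.2⟩
  have hcard := (Finset.card_le_card hsub).trans (Finset.card_union_le _ _)
  have hcard' : (((Finset.range n).filter fun i => x i ≤ t).card : ℝ)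
      ≤ ((Finset.range n).filter fun i => x i ≤ t - g).card + A.card := by exact_mod_cast hcard
  rw [le_div_iff₀ hn0] at ht
  rw [div_lt_iff₀ hn0] at hnot
  have hAcard : n * (β - α) ≤ (A.card : ℝ) := by linarith
  have hpairs : A ×ˢ A ⊆ ((Finset.range n) ×ˢ (Finset.range n)).filter
      fun k => |x k.1 - x k.2| ≤ g := by
    intro k hk
    rw [Finset.mem_product, hA, Finset.mem_filter, Finset.mem_filter] at hk
    rw [Finset.mem_filter, Finset.mem_product]
    refine ⟨⟨hk.1.1, hk.2.1⟩, abs_le.mpr ⟨?_, ?_⟩⟩ <;> linarith [hk.1.2.1, hk.1.2.2, hk.2.2.1, hk.2.2.2]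
  have hcp := Finset.card_le_card hpairs
  rw [Finset.card_product] at hcp
  have hcp' : (A.card : ℝ) * A.card ≤ ((((Finset.range n) ×ˢ (Finset.range n)).filter
      fun k => |x k.1 - x k.2| ≤ g).card : ℝ) := by exact_mod_cast hcp
  have h0 : 0 ≤ n * (β - α) := mul_nonneg hn0.le (by linarith)
  rw [sq]
  exact (mul_le_mul hAcard hAcard h0 (h0.trans hAcard)).trans hcp'

end quantile

/-! ### Anticoncentration of pairs of observations. -/

theorem gaussianReal_Icc_le (m : ℝ) {v : ℝ≥0} {c : ℝ} (hc : 0 < c) (hv : c ≤ v) (g : ℝ) :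
    gaussianReal m v (Set.Icc (-g) g) ≤ ENNReal.ofReal (2 * g / √c) := by
  have hv0 : (0 : ℝ) < v := hc.trans_le hv
  have hv1 : v ≠ 0 := by
    rintro rfl
    simp at hv0
  rw [gaussianReal_apply _ hv1]
  have hpdf : ∀ x, gaussianPDF m v x ≤ ENNReal.ofReal (1 / √c) := by
    intro x
    apply ENNReal.ofReal_le_ofReal
    rw [gaussianPDFReal]
    have h1 : (√(2 * Real.pi * v))⁻¹ ≤ 1 / √c := by
      rw [one_div]
      apply inv_anti₀ (Real.sqrt_pos.mpr hc)
      apply Real.sqrt_le_sqrt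
      nlinarith [Real.pi_gt_three]
    have h2 : Real.exp (-(x - m) ^ 2 / (2 * v)) ≤ 1 := by
      rw [Real.exp_le_one_iff]
      exact div_nonpos_of_nonpos_of_nonneg (by nlinarith [sq_nonneg (x - m)]) (by positivity)
    exact (mul_le_of_le_one_right (by positivity) h2).trans h1
  calc ∫⁻ x in Set.Icc (-g) g, gaussianPDF m v x
      ≤ ∫⁻ _ in Set.Icc (-g) g, ENNReal.ofReal (1 / √c) := lintegral_mono hpdf
    _ = ENNReal.ofReal (1 / √c) * ENNReal.ofReal (g - -g) := by
        rw [setLIntegral_const, Real.volume_Icc]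
    _ = _ := by
        rw [← ENNReal.ofReal_mul (by positivity)]
        congr 1
        ring

section pairs

variable {Ω : Type*} [MeasurableSpace Ω] {μ : Measure Ω} [IsProbabilityMeasure μ]

omit [IsProbabilityMeasure μ] in
theorem measure_abs_sub_le {X Y : Ω → ℝ} (hXY : IndepFun X Y μ) {a b : ℝ} {u v : ℝ≥0}
    (hX : HasLaw X (gaussianReal a u) μ) (hY : HasLaw Y (gaussianReal b v) μ) {c : ℝ}
    (hc : 0 < c) (hu : c ≤ u) (g : ℝ) :
    μ {ω | |X ω - Y ω| ≤ g} ≤ ENNReal.ofReal (2 * g / √c) := by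
  have hY2 := gaussianReal_neg hY
  have hi : IndepFun X (fun ω => -Y ω) μ := hXY.comp measurable_id measurable_neg
  have h := gaussianReal_add_gaussianReal_of_indepFun hi hX.map_eq hY2.map_eq
  have hset : {ω | |X ω - Y ω| ≤ g} = (X + fun ω => -Y ω) ⁻¹' (Set.Icc (-g) g) := by
    ext ω
    simp only [Set.mem_ofPred_eq, Set.mem_preimage, Pi.add_apply, Set.mem_Icc, abs_le,
      sub_eq_add_neg]
  have hm : AEMeasurable (X + fun ω => -Y ω) μ := hX.aemeasurable.add hY2.aemeasurable
  rw [hset, ← Measure.map_apply_of_aemeasurable hm measurableSet_Icc, h]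
  refine gaussianReal_Icc_le _ hc ?_ g
  rw [NNReal.coe_add]
  linarith [v.coe_nonneg]

/-- Few pairs of independent normal variables are close to each other. -/
theorem measure_card_pairs_le {X : ℕ → Ω → ℝ} (hX : iIndepFun X μ) {θ : ℕ → ℝ} {v : ℕ → ℝ≥0}
    (hlaw : ∀ i, HasLaw (X i) (gaussianReal (θ i) (v i)) μ) {c : ℝ} (hc : 0 < c)
    (hv : ∀ i, c ≤ v i) {n : ℕ} (hn : 0 < n) {g ρ : ℝ} (hg : 0 ≤ g) (hρ : 0 < ρ) :
    μ {ω | (n * ρ) ^ 2 ≤ ((((Finset.range n) ×ˢ (Finset.range n)).filter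
        fun k => |X k.1 ω - X k.2 ω| ≤ g).card : ℝ)}
      ≤ ENNReal.ofReal ((1 / n + 2 * g / √c) / ρ ^ 2) := by
  have hn0 : (0 : ℝ) < n := by exact_mod_cast hn
  set s : ℕ × ℕ → Set Ω := fun k => {ω | |X k.1 ω - X k.2 ω| ≤ g} with hs
  have hnull : ∀ k, NullMeasurableSet (s k) μ := by
    intro k
    have hm : AEMeasurable (fun ω => |X k.1 ω - X k.2 ω|) μ :=
      ((hlaw k.1).aemeasurable.sub (hlaw k.2).aemeasurable).abs
    exact hm.nullMeasurable measurableSet_Iic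
  set Q := (Finset.range n) ×ˢ (Finset.range n) with hQ
  have hcard : ∀ ω, ((Q.filter fun k => |X k.1 ω - X k.2 ω| ≤ g).card : ℝ≥0∞)
      = ∑ k ∈ Q, (s k).indicator (fun _ => (1 : ℝ≥0∞)) ω := by
    intro ω
    rw [Finset.card_filter, Nat.cast_sum]
    refine Finset.sum_congr rfl fun k _ => ?_
    simp only [Set.indicator_apply, hs, Set.mem_ofPred_eq]
    split_ifs <;> simp
  have hbound : ∀ k, μ (s k) ≤ ENNReal.ofReal (2 * g / √c) + if k.1 = k.2 then 1 else 0 := by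
    intro k
    by_cases hk : k.1 = k.2
    · rw [if_pos hk]
      exact prob_le_one.trans le_add_self
    · rw [if_neg hk, add_zero]
      exact measure_abs_sub_le (hX.indepFun hk) (hlaw _) (hlaw _) hc (hv _) g
  -- First moment method. The n diagonal pairs are always close; they account for the term 1/n in
  -- the final bound.
  have hlin : ∫⁻ ω, ∑ k ∈ Q, (s k).indicator (fun _ => (1 : ℝ≥0∞)) ω ∂μ
      ≤ ENNReal.ofReal (n ^ 2 * (2 * g / √c) + n) := by
    rw [lintegral_finsetSum' _ fun k _ => aemeasurable_const.indicator₀ (hnull k)]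
    calc ∑ k ∈ Q, ∫⁻ ω, (s k).indicator (fun _ => (1 : ℝ≥0∞)) ω ∂μ
        ≤ ∑ k ∈ Q, (ENNReal.ofReal (2 * g / √c) + if k.1 = k.2 then 1 else 0) := by
          refine Finset.sum_le_sum fun k _ => ?_
          rw [lintegral_indicator₀ (hnull k)]
          simpa using hbound k
      _ = ENNReal.ofReal (n ^ 2 * (2 * g / √c) + n) := by
          rw [Finset.sum_add_distrib, hQ, Finset.sum_const, Finset.card_product,
            Finset.card_range, Finset.sum_product]
          have : ∀ i ∈ Finset.range n, ∑ j ∈ Finset.range n, (if i = j then (1 : ℝ≥0∞) else 0) = 1 := by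
            intro i hi
            rw [Finset.sum_ite_eq, if_pos hi]
          rw [Finset.sum_congr rfl this, ENNReal.ofReal_add (by positivity) hn0.le,
            ENNReal.ofReal_mul (by positivity)]
          simp [sq, ENNReal.ofReal_mul]
  have hpos : 0 < (n * ρ) ^ 2 := by positivity
  have hmk := mul_meas_ge_le_lintegral₀ (μ := μ)
    (f := fun ω => ∑ k ∈ Q, (s k).indicator (fun _ => (1 : ℝ≥0∞)) ω)
    (Finset.aemeasurable_fun_sum _ fun k _ => aemeasurable_const.indicator₀ (hnull k))
    (ENNReal.ofReal ((n * ρ) ^ 2))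
  have hsub : {ω | (n * ρ) ^ 2 ≤ ((Q.filter fun k => |X k.1 ω - X k.2 ω| ≤ g).card : ℝ)}
      ⊆ {ω | ENNReal.ofReal ((n * ρ) ^ 2)
        ≤ ∑ k ∈ Q, (s k).indicator (fun _ => (1 : ℝ≥0∞)) ω} := by
    intro ω hω
    simp only [Set.mem_ofPred_eq] at hω ⊢
    rw [← hcard]
    exact (ENNReal.ofReal_le_ofReal hω).trans (by simp)
  refine (measure_mono hsub).trans ?_
  have hdiv := (ENNReal.le_div_iff_mul_le (Or.inl (ENNReal.ofReal_pos.mpr hpos).ne')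
    (Or.inl ENNReal.ofReal_ne_top)).mpr ((mul_comm _ _).trans_le (hmk.trans hlin))
  refine hdiv.trans ?_
  rw [← ENNReal.ofReal_div_of_pos hpos]
  apply ENNReal.ofReal_le_ofReal
  apply le_of_eq
  field_simp
  ring

end pairs

/-! ### Lipschitz dependence of the loss on the hyperparameters. -/

/-- The map `τ ↦ τ / (τ + 1)` from `[0, ∞]` onto `[0, 1]`. -/
noncomputable def toUnit (τ : ℝ≥0∞) : ℝ := if τ = ∞ then 1 else τ.toReal / (τ.toReal + 1)

theorem toUnit_nonneg (τ : ℝ≥0∞) : 0 ≤ toUnit τ := by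
  unfold toUnit
  split_ifs <;> positivity

theorem toUnit_le_one (τ : ℝ≥0∞) : toUnit τ ≤ 1 := by
  have h0 : 0 ≤ τ.toReal := ENNReal.toReal_nonneg
  unfold toUnit
  split_ifs
  · exact le_rfl
  · rw [div_le_one (by linarith)]
    linarith

theorem shrink_eq_toUnit {p : Coord} (hp : p.Regular) (τ : ℝ≥0∞) :
    p.shrink τ = toUnit τ / (toUnit τ + (1 - toUnit τ) * p.σp) := by
  have h0 : 0 ≤ τ.toReal := ENNReal.toReal_nonneg
  have hσ := hp.σp_pos
  unfold toUnit Coord.shrink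
  split_ifs
  · simp
  · have h1 : τ.toReal + 1 ≠ 0 := by positivity
    have h2 : τ.toReal + p.σp ≠ 0 := by positivity
    have h3 : 1 - τ.toReal / (τ.toReal + 1) = 1 / (τ.toReal + 1) := by
      field_simp
      ring
    rw [h3]
    field_simp

/-- In the coordinate t = τ/(τ + 1) the shrinkage factor is t/(t + (1 - t)σp). Its denominator is a
convex combination of 1 and σp, hence at least c. -/
theorem abs_shrink_sub_le {p : Coord} (hp : p.Regular) {c D : ℝ} (hc : 0 < c) (hc1 : c ≤ 1)
    (hcσ : c ≤ p.σp) (hD : p.σp ≤ D) (τ τ' : ℝ≥0∞) :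
    |p.shrink τ - p.shrink τ'| ≤ D / c ^ 2 * |toUnit τ - toUnit τ'| := by
  rw [shrink_eq_toUnit hp, shrink_eq_toUnit hp]
  have key : ∀ t : ℝ, 0 ≤ t → t ≤ 1 → c ≤ t + (1 - t) * p.σp := fun t h0 h1 => by
    nlinarith [mul_nonneg h0 (sub_nonneg.mpr hc1), mul_nonneg (sub_nonneg.mpr h1) (sub_nonneg.mpr hcσ)]
  have h1 := key _ (toUnit_nonneg τ) (toUnit_le_one τ)
  have h2 := key _ (toUnit_nonneg τ') (toUnit_le_one τ')
  set t := toUnit τ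
  set t' := toUnit τ'
  set A := t + (1 - t) * p.σp with hA
  set B := t' + (1 - t') * p.σp with hB
  have hA0 : 0 < A := hc.trans_le h1
  have hB0 : 0 < B := hc.trans_le h2
  have e : t / A - t' / B = p.σp * (t - t') / (A * B) := by
    rw [div_sub_div _ _ hA0.ne' hB0.ne', hA, hB]
    ring
  rw [e, abs_div, abs_mul, abs_of_pos hp.σp_pos, abs_of_pos (mul_pos hA0 hB0), div_mul_eq_mul_div]
  have h3 : c ^ 2 ≤ A * B := by
    rw [sq]
    gcongr
  have : 0 ≤ D := hp.σp_pos.le.trans hD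
  gcongr

theorem abs_predictor_sub_le {p : Coord} (hp : p.Regular) {D Q : ℝ} (hD1 : 1 ≤ D)
    (hD : p.σf ≤ D) (hQ : |stdQuantile p.ratio| ≤ Q) (η η' : ℝ) (τ τ' : ℝ≥0∞) (x : ℝ) :
    |p.predictor η τ x - p.predictor η' τ' x|
      ≤ |p.shrink τ - p.shrink τ'| * (|x| + |η| + D * Q) + |η - η'| := by
  set α := p.shrink τ with hα
  set α' := p.shrink τ' with hα'
  have hσf := hp.σf_pos
  have hσp := hp.σp_pos
  have h0 : 0 ≤ α := hp.shrink_nonneg τ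
  have h0' : 0 ≤ α' := hp.shrink_nonneg τ'
  have h1' : α' ≤ 1 := hp.shrink_le_one τ'
  have hQ0 : 0 ≤ Q := (abs_nonneg _).trans hQ
  -- Rationalize: the sum of the two roots is at least √σf and σp ≤ σf, so the difference is at most
  -- |α - α'| √σf.
  have hsqrt : |√(p.σf + α * p.σp) - √(p.σf + α' * p.σp)| ≤ |α - α'| * D := by
    have hA : √p.σf ≤ √(p.σf + α * p.σp) := Real.sqrt_le_sqrt (by nlinarith)
    have hB : 0 ≤ √(p.σf + α' * p.σp) := Real.sqrt_nonneg _
    have hf : 0 < √p.σf := Real.sqrt_pos.mpr hσf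
    have hfD : √p.σf ≤ D := Real.sqrt_le_iff.mpr ⟨by linarith, by nlinarith⟩
    have hff := Real.mul_self_sqrt hσf.le
    have e : (√(p.σf + α * p.σp) - √(p.σf + α' * p.σp))
        * (√(p.σf + α * p.σp) + √(p.σf + α' * p.σp)) = (α - α') * p.σp := by
      have e1 := Real.mul_self_sqrt (show 0 ≤ p.σf + α * p.σp by positivity)
      have e2 := Real.mul_self_sqrt (show 0 ≤ p.σf + α' * p.σp by positivity)
      linear_combination e1 - e2
    have e' := congrArg abs e
    rw [abs_mul, abs_mul, abs_of_pos hσp, abs_of_pos (by linarith :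
      0 < √(p.σf + α * p.σp) + √(p.σf + α' * p.σp))] at e'
    have h2 : |√(p.σf + α * p.σp) - √(p.σf + α' * p.σp)| * √p.σf ≤ |α - α'| * √p.σf * √p.σf := by
      calc _ ≤ |√(p.σf + α * p.σp) - √(p.σf + α' * p.σp)|
            * (√(p.σf + α * p.σp) + √(p.σf + α' * p.σp)) := by gcongr; linarith
        _ = |α - α'| * p.σp := e'
        _ ≤ |α - α'| * p.σf := by gcongr; exact hp.σp_le_σf
        _ = _ := by rw [mul_assoc, hff]
    have h3 := le_of_mul_le_mul_right h2 hf
    exact h3.trans (by gcongr)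
  have e : p.predictor η τ x - p.predictor η' τ' x
      = (α - α') * x + -((α - α') * η) + (1 - α') * (η - η')
        + (√(p.σf + α * p.σp) - √(p.σf + α' * p.σp)) * stdQuantile p.ratio := by
    unfold Coord.predictor
    rw [← hα, ← hα']
    ring
  rw [e]
  refine (abs_add_le _ _).trans ?_
  have a1 : |(α - α') * x + -((α - α') * η) + (1 - α') * (η - η')|
      ≤ |α - α'| * |x| + |α - α'| * |η| + |η - η'| := by
    refine (abs_add_le _ _).trans (add_le_add ((abs_add_le _ _).trans (le_of_eq ?_)) ?_)
    · rw [abs_neg, abs_mul, abs_mul]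
    · rw [abs_mul, abs_of_nonneg (by linarith)]
      exact mul_le_of_le_one_left (abs_nonneg _) (by linarith)
  have a2 : |(√(p.σf + α * p.σp) - √(p.σf + α' * p.σp)) * stdQuantile p.ratio|
      ≤ |α - α'| * D * Q := by
    rw [abs_mul]
    exact mul_le_mul hsqrt hQ (abs_nonneg _) (by positivity)
  linarith

/-- The average predictive loss is Lipschitz in the hyperparameters. -/
theorem abs_avgLoss_sub_le {p : ℕ → Coord} (hp : ∀ i, (p i).Regular) {c D Q R : ℝ} (hc : 0 < c)
    (hc1 : c ≤ 1) (hcσ : ∀ i, c ≤ (p i).σp) (hD1 : 1 ≤ D) (hD : ∀ i, (p i).σf ≤ D)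
    (hbh : ∀ i, (p i).b + (p i).h ≤ D) (hQ : ∀ i, |stdQuantile (p i).ratio| ≤ Q) (θ : ℕ → ℝ)
    {n : ℕ} (hn : 0 < n) {x : ℕ → ℝ} (hx : ∑ i ∈ Finset.range n, |x i| ≤ n * R)
    (η η' : ℝ) (τ τ' : ℝ≥0∞) :
    |avgLoss p θ n x η τ - avgLoss p θ n x η' τ'|
      ≤ D * (D / c ^ 2 * |toUnit τ - toUnit τ'| * (R + |η| + D * Q) + |η - η'|) := by
  have hn0 : (0 : ℝ) < n := by exact_mod_cast hn
  set δ := D / c ^ 2 * |toUnit τ - toUnit τ'| with hδ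
  have hδ0 : 0 ≤ δ := by positivity
  have hQ0 : 0 ≤ Q := (abs_nonneg _).trans (hQ 0)
  have hterm : ∀ i, |(p i).loss (θ i) ((p i).predictor η τ (x i))
      - (p i).loss (θ i) ((p i).predictor η' τ' (x i))|
      ≤ D * (δ * |x i| + (δ * (|η| + D * Q) + |η - η'|)) := by
    intro i
    refine ((hp i).abs_loss_sub_le _ _ _).trans ?_
    have h1 := abs_predictor_sub_le (hp i) hD1 (hD i) (hQ i) η η' τ τ' (x i)
    have h2 := abs_shrink_sub_le (hp i) hc hc1 (hcσ i) ((hp i).σp_le_σf.trans (hD i)) τ τ'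
    have h3 : |(p i).predictor η τ (x i) - (p i).predictor η' τ' (x i)|
        ≤ δ * |x i| + (δ * (|η| + D * Q) + |η - η'|) := by
      refine h1.trans ?_
      have : |(p i).shrink τ - (p i).shrink τ'| * (|x i| + |η| + D * Q)
          ≤ δ * (|x i| + |η| + D * Q) := by
        gcongr
      linarith
    exact mul_le_mul (hbh i) h3 (abs_nonneg _) (by linarith)
  unfold avgLoss
  rw [← mul_sub, ← Finset.sum_sub_distrib, abs_mul, abs_of_nonneg (by positivity), one_div,
    inv_mul_le_iff₀ hn0]
  refine (Finset.abs_sum_le_sum_abs _ _).trans ((Finset.sum_le_sum fun i _ => hterm i).trans ?_)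
  rw [← Finset.mul_sum, Finset.sum_add_distrib, ← Finset.mul_sum, Finset.sum_const,
    Finset.card_range, nsmul_eq_mul]
  have : δ * ∑ i ∈ Finset.range n, |x i| ≤ δ * (n * R) := by gcongr
  calc D * (δ * ∑ i ∈ Finset.range n, |x i| + n * (δ * (|η| + D * Q) + |η - η'|))
      ≤ D * (δ * (n * R) + n * (δ * (|η| + D * Q) + |η - η'|)) := by gcongr
    _ = _ := by ring

/-! ### Density and size of the grid; limits of the error bounds. -/

/-- Take the last grid point not exceeding η. If it falls below s, the next one lies in (s, s + δ],
with δ the spacing, and this is still inside [s, t] because the interval has length at least δ. -/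
theorem exists_grid₁_near {C₁ : ℝ} {n : ℕ} (hδ : 0 < spacing₁ C₁ n) {s t η : ℝ}
    (hs : s ≤ η) (ht : η ≤ t) (hst : s + spacing₁ C₁ n ≤ t) (hs' : -a n ≤ s) (ht' : t ≤ a n) :
    ∃ η' ∈ grid₁ C₁ n ∩ Set.Icc s t, |η - η'| ≤ spacing₁ C₁ n := by
  set δ := spacing₁ C₁ n with hδdef
  have h0 : 0 ≤ (η + a n) / δ := div_nonneg (by linarith) hδ.le
  set k := ⌊(η + a n) / δ⌋₊
  have hk1 : k * δ ≤ η + a n := by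
    rw [← le_div_iff₀ hδ]
    exact Nat.floor_le h0
  have hk2 : η + a n < (k + 1) * δ := by
    rw [← div_lt_iff₀ hδ]
    exact Nat.lt_floor_add_one _
  by_cases h : s ≤ -a n + k * δ
  · refine ⟨-a n + k * δ, ⟨⟨⟨by linarith, by linarith⟩, k, rfl⟩, h, by linarith⟩, ?_⟩
    rw [abs_of_nonneg (by linarith)]
    linarith
  · push Not at h
    refine ⟨-a n + (k + 1 : ℕ) * δ, ⟨⟨⟨?_, ?_⟩, k + 1, rfl⟩, ?_, ?_⟩, ?_⟩ <;> push_cast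
    · linarith
    · linarith
    · linarith
    · linarith
    · rw [abs_of_nonpos (by linarith)]
      linarith

theorem exists_grid₂_near {C₁ C₂ C₃ C₄ : ℝ} {n : ℕ} (hδ : 0 < spacing₂ C₁ C₂ C₃ C₄ n)
    (τ : ℝ≥0∞) :
    ∃ τ' ∈ grid₂ C₁ C₂ C₃ C₄ n, |toUnit τ - toUnit τ'| ≤ spacing₂ C₁ C₂ C₃ C₄ n := by
  set δ := spacing₂ C₁ C₂ C₃ C₄ n with hδdef
  have ht0 := toUnit_nonneg τ
  have ht1 := toUnit_le_one τ
  set t := toUnit τ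
  set N := ⌈1 / δ⌉₊ with hN
  have hNpos : 0 < N := Nat.ceil_pos.mpr (by positivity)
  -- The cap N - 1 covers the end t = 1, that is τ = ∞, and guarantees kδ < 1, so that the chosen
  -- scale is finite.
  set k := min ⌊t / δ⌋₊ (N - 1) with hk
  have hkN : k < N := by omega
  have hkδ : k * δ < 1 := by
    rw [← lt_div_iff₀ hδ]
    exact Nat.lt_ceil.mp hkN
  have hfl : (⌊t / δ⌋₊ : ℝ) * δ ≤ t := by
    rw [← le_div_iff₀ hδ]
    exact Nat.floor_le (by positivity)
  have h1 : k * δ ≤ t := by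
    refine le_trans ?_ hfl
    have : (k : ℝ) ≤ ⌊t / δ⌋₊ := by exact_mod_cast min_le_left _ _
    gcongr
  have h2 : t ≤ (k + 1) * δ := by
    rcases min_choice ⌊t / δ⌋₊ (N - 1) with h | h
    · rw [hk, h, ← div_le_iff₀ hδ]
      exact (Nat.lt_floor_add_one _).le
    · have h3 : k + 1 = N := by omega
      have h4 : ((k : ℝ) + 1) = N := by exact_mod_cast h3
      rw [h4]
      have : 1 / δ ≤ N := Nat.le_ceil _
      rw [div_le_iff₀ hδ] at this
      linarith
  refine ⟨_, ⟨k, hkN, rfl⟩, ?_⟩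
  have h5 : toUnit (ENNReal.ofReal (k * δ / (1 - k * δ))) = k * δ := by
    have hpos : 0 ≤ k * δ / (1 - k * δ) := div_nonneg (by positivity) (by linarith)
    rw [toUnit, if_neg ENNReal.ofReal_ne_top, ENNReal.toReal_ofReal hpos]
    have : 1 - k * δ ≠ 0 := by linarith
    field_simp
    ring
  rw [h5, abs_of_nonneg (by linarith)]
  linarith

theorem one_lt_log {n : ℕ} (hn : 3 ≤ n) : 1 < Real.log n := by
  rw [Real.lt_log_iff_exp_lt (by positivity)]
  have : (3 : ℝ) ≤ n := by exact_mod_cast hn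
  linarith [Real.exp_one_lt_d9]

theorem a_pos {n : ℕ} (hn : 3 ≤ n) : 0 < a n := Real.log_pos (one_lt_log hn)

theorem a_le_log {n : ℕ} (hn : 3 ≤ n) : a n ≤ Real.log n :=
  (Real.log_le_sub_one_of_pos (by linarith [one_lt_log hn])).trans (by linarith)

theorem tendsto_a : Tendsto a atTop atTop :=
  Real.tendsto_log_atTop.comp (Real.tendsto_log_atTop.comp tendsto_natCast_atTop_atTop)

theorem spacing₁_pos {C₁ : ℝ} (hC₁ : 0 < C₁) {n : ℕ} (hn : 3 ≤ n) : 0 < spacing₁ C₁ n := by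
  have := a_pos hn
  unfold spacing₁
  positivity

theorem tendsto_spacing₁ {C₁ : ℝ} (hC₁ : 0 < C₁) : Tendsto (spacing₁ C₁) atTop (𝓝 0) :=
  (tendsto_a.const_mul_atTop (by positivity : 0 < 2 * C₁)).inv_tendsto_atTop

theorem spacing₂_pos {C₁ C₂ C₃ C₄ : ℝ} (hC₁ : 0 < C₁) (hC₂ : 0 < C₂) (hC₃ : 0 ≤ C₃) (hC₄ : 0 < C₄)
    {n : ℕ} (hn : 3 ≤ n) : 0 < spacing₂ C₁ C₂ C₃ C₄ n := by
  have := a_pos hn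
  have := stdPdf_zero_pos
  unfold spacing₂
  positivity

theorem tendsto_spacing₂ {C₁ C₂ C₃ C₄ : ℝ} (hC₁ : 0 < C₁) (hC₂ : 0 < C₂) (hC₃ : 0 ≤ C₃)
    (hC₄ : 0 < C₄) : Tendsto (spacing₂ C₁ C₂ C₃ C₄) atTop (𝓝 0) := by
  refine Tendsto.inv_tendsto_atTop (Tendsto.const_mul_atTop (by positivity) ?_)
  refine tendsto_atTop_mono' _ ?_ tendsto_a
  filter_upwards [eventually_ge_atTop 3] with n hn
  have := a_pos hn
  have := stdPdf_zero_pos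
  have : 0 ≤ √(a n) * C₄ := by positivity
  have : 0 ≤ a n ^ 2 := by positivity
  linarith

/-- The numbers of locations and scales in the grid grow at most like powers of `log n`. -/
theorem grid_size_le {C₁ C₂ C₃ C₄ : ℝ} (hC₁ : 0 < C₁) (hC₂ : 0 < C₂) (hC₃ : 0 ≤ C₃)
    (hC₄ : 0 < C₄) {n : ℕ} (hn : 3 ≤ n) :
    ((⌊2 * a n / spacing₁ C₁ n⌋₊ + 1 : ℕ) : ℝ) * (⌈1 / spacing₂ C₁ C₂ C₃ C₄ n⌉₊ : ℝ)
      ≤ (4 * C₁ + 1) * (2 * C₁ * C₂ * (4 + C₃ + C₄) + 1) * Real.log n ^ 4 := by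
  have ha := a_pos hn
  have hL := one_lt_log hn
  have haL := a_le_log hn
  have hp0 := stdPdf_zero_pos
  have hp1 := stdPdf_le_one 0
  set L := Real.log n
  have hL2 : 1 ≤ L ^ 2 := by nlinarith
  have hLL : L ≤ L ^ 2 := by nlinarith
  have ha2 : a n ^ 2 ≤ L ^ 2 := by gcongr
  have hs : √(a n) ≤ L ^ 2 := by
    refine Real.sqrt_le_iff.mpr ⟨by positivity, ?_⟩
    nlinarith
  have h1 : ((⌊2 * a n / spacing₁ C₁ n⌋₊ + 1 : ℕ) : ℝ) ≤ (4 * C₁ + 1) * L ^ 2 := by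
    have h := Nat.floor_le (show 0 ≤ 2 * a n / spacing₁ C₁ n from
      div_nonneg (by linarith) (spacing₁_pos hC₁ hn).le)
    have e : 2 * a n / spacing₁ C₁ n = 4 * C₁ * a n ^ 2 := by
      rw [spacing₁, div_inv_eq_mul]
      ring
    rw [e] at h
    push_cast
    rw [e]
    have : 4 * C₁ * a n ^ 2 ≤ 4 * C₁ * L ^ 2 := by gcongr
    linarith
  have h2 : (⌈1 / spacing₂ C₁ C₂ C₃ C₄ n⌉₊ : ℝ) ≤ (2 * C₁ * C₂ * (4 + C₃ + C₄) + 1) * L ^ 2 := by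
    have h := Nat.ceil_lt_add_one (show 0 ≤ 1 / spacing₂ C₁ C₂ C₃ C₄ n from
      div_nonneg zero_le_one (spacing₂_pos hC₁ hC₂ hC₃ hC₄ hn).le)
    have e : 1 / spacing₂ C₁ C₂ C₃ C₄ n
        = 2 * C₁ * C₂ * (2 * stdPdf 0 + C₃ + √(a n) * C₄ + a n + a n ^ 2) := by
      rw [spacing₂, one_div, inv_inv]
    have h3 : 2 * stdPdf 0 + C₃ + √(a n) * C₄ + a n + a n ^ 2 ≤ (4 + C₃ + C₄) * L ^ 2 := by
      have : √(a n) * C₄ ≤ L ^ 2 * C₄ := by gcongr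
      nlinarith
    have h4 : 2 * C₁ * C₂ * (2 * stdPdf 0 + C₃ + √(a n) * C₄ + a n + a n ^ 2)
        ≤ 2 * C₁ * C₂ * ((4 + C₃ + C₄) * L ^ 2) := by gcongr
    rw [e] at h ⊢
    linarith
  calc _ ≤ ((4 * C₁ + 1) * L ^ 2) * ((2 * C₁ * C₂ * (4 + C₃ + C₄) + 1) * L ^ 2) := by gcongr
    _ = _ := by ring

theorem tendsto_log_pow_mul_rpow :
    Tendsto (fun n : ℕ => Real.log n ^ 4 * ((n : ℝ) ^ (3 / 5 : ℝ) / n)) atTop (𝓝 0) := by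
  have h := (isLittleO_log_rpow_rpow_atTop (4 : ℝ)
    (show (0 : ℝ) < 2 / 5 by norm_num)).tendsto_div_nhds_zero
  refine (h.comp tendsto_natCast_atTop_atTop).congr' ?_
  filter_upwards [eventually_gt_atTop 0] with n hn
  have hn0 : (0 : ℝ) < n := by exact_mod_cast hn
  have e : (n : ℝ) ^ (3 / 5 : ℝ) / n = ((n : ℝ) ^ (2 / 5 : ℝ))⁻¹ := by
    rw [← Real.rpow_neg hn0.le, ← Real.rpow_sub_one hn0.ne']
    norm_num
  have e2 : Real.log n ^ (4 : ℝ) = Real.log n ^ 4 := by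
    exact_mod_cast Real.rpow_natCast (Real.log n) 4
  simp only [Function.comp]
  rw [e, e2, div_eq_mul_inv]

theorem tendsto_bias_bound {γ₀ : ℝ} (hγ₀ : 0 < γ₀) (D : ℝ) :
    Tendsto (fun n : ℕ => D * (9 * (n : ℝ) ^ (-(γ₀ ^ 2 / 4)) + 400 * ((n : ℝ) ^ (3 / 5 : ℝ)) / n))
      atTop (𝓝 0) := by
  have h1 : Tendsto (fun n : ℕ => (n : ℝ) ^ (-(γ₀ ^ 2 / 4))) atTop (𝓝 0) :=
    (tendsto_rpow_neg_atTop (by positivity)).comp tendsto_natCast_atTop_atTop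
  have h2 : Tendsto (fun n : ℕ => (n : ℝ) ^ (3 / 5 : ℝ) / n) atTop (𝓝 0) := by
    have h3 : Tendsto (fun n : ℕ => (n : ℝ) ^ (-(2 / 5) : ℝ)) atTop (𝓝 0) :=
      (tendsto_rpow_neg_atTop (by norm_num)).comp tendsto_natCast_atTop_atTop
    refine h3.congr' ?_
    filter_upwards [eventually_gt_atTop 0] with n hn
    have hn0 : (0 : ℝ) < n := by exact_mod_cast hn
    rw [← Real.rpow_sub_one hn0.ne']
    norm_num
  have h := ((h1.const_mul 9).add (h2.const_mul 400)).const_mul D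
  simp only [mul_zero, add_zero] at h
  refine h.congr fun n => ?_
  ring

theorem riskEstD_sub_avgLoss (p : ℕ → Coord) (γ : ℕ → ℝ) (θ : ℕ → ℝ) (n : ℕ) (x : ℕ → ℝ) (η : ℝ)
    (τ : ℝ≥0∞) :
    riskEstD p γ n x η τ - avgLoss p θ n x η τ
      = (1 / (n : ℝ)) * ∑ i ∈ Finset.range n, (p i).err (γ i) n (θ i) η τ (x i) := by
  unfold riskEstD riskEst avgLoss Coord.err
  rw [← mul_sub, ← Finset.sum_sub_distrib]

/-! ### The three events of high probability. -/

section probability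

variable {Ω : Type*} [MeasurableSpace Ω] {μ : Measure Ω} [IsProbabilityMeasure μ]
  {p : ℕ → Coord} {θ : ℕ → ℝ} {X : ℕ → Ω → ℝ}

/-- The risk estimate is uniformly consistent over the grid. -/
theorem tendsto_measure_grid_deviation (hp : ∀ i, (p i).Regular) (hX : iIndepFun X μ)
    (hlaw : ∀ i, HasLaw (X i) (gaussianReal (θ i) (p i).σp.toNNReal) μ)
    {γ : ℕ → ℝ} {γ₀ : ℝ} (hγ₀ : 0 < γ₀) (hγ : ∀ i, γ₀ ≤ γ i)
    (hγ2 : ∀ i, γ i ≤ 1 / √(4 * Real.exp 1)) {D : ℝ} (hD : 1 ≤ D)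
    (hbh : ∀ i, (p i).b + (p i).h ≤ D) (hσf : ∀ i, (p i).σf ≤ D)
    {C₁ C₂ C₃ C₄ : ℝ} (hC₁ : 0 < C₁) (hC₂ : 0 < C₂) (hC₃ : 0 ≤ C₃) (hC₄ : 0 < C₄)
    {ε : ℝ} (hε : 0 < ε) :
    Tendsto (fun n : ℕ => μ {ω | ∃ η ∈ grid₁ C₁ n, ∃ τ ∈ grid₂ C₁ C₂ C₃ C₄ n,
      ε ≤ |riskEstD p γ n (fun i => X i ω) η τ - avgLoss p θ n (fun i => X i ω) η τ|})
      atTop (𝓝 0) := by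
  set V : ℝ := 2 * (D * (2 * D)) ^ 2 * 900 + 2 * D ^ 2 * D with hV
  set K : ℝ := (4 * C₁ + 1) * (2 * C₁ * C₂ * (4 + C₃ + C₄) + 1) with hK
  have hV0 : 0 ≤ V := by positivity
  have hK0 : 0 ≤ K := by positivity
  -- One n serves all η and all finite τ, since the moment bounds involve neither. The right side is
  -- of order n^(-2/5) and survives multiplication by the number of grid points.
  have hpoint : ∀ᶠ n : ℕ in atTop, ∀ (η : ℝ) (τ : ℝ≥0∞), τ ≠ ∞ →
      μ {ω | ε ≤ |riskEstD p γ n (fun i => X i ω) η τ - avgLoss p θ n (fun i => X i ω) η τ|}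
        ≤ ENNReal.ofReal (4 * (V * (n : ℝ) ^ (3 / 5 : ℝ)) / (n * ε ^ 2)) := by
    have hb := (tendsto_bias_bound hγ₀ (D * (2 * D))).eventually_le_const (half_pos hε)
    filter_upwards [hb, eventually_gt_atTop 0] with n hbn hn η τ hτ
    have hn0 : (0 : ℝ) < n := by exact_mod_cast hn
    have hn1 : (1 : ℝ) ≤ n := by exact_mod_cast hn
    simp_rw [riskEstD_sub_avgLoss]
    refine measure_le_abs_average_le hX hlaw
      (F := fun i => (p i).err (γ i) n (θ i) η τ)
      (fun i => (hp i).measurable_err _ _ _ _ hτ) hn hε (fun i => ?_) (fun i => ?_)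
    · refine ((hp i).err_moments (hγ₀.le.trans (hγ i)) hn hτ (θ i) η (hbh i) (hσf i) hD).1.trans
        (le_trans ?_ hbn)
      have h1 := exp_neg_threshold_sq_le hγ₀ (hγ i) hn
      have h2 := exp_threshold_sq_le (hγ₀.trans_le (hγ i)) (hγ2 i) hn
      gcongr
    · obtain ⟨κ, hI, hκ⟩ :=
        ((hp i).err_moments (hγ₀.le.trans (hγ i)) hn hτ (θ i) η (hbh i) (hσf i) hD).2
      refine ⟨κ, hI, hκ.trans ?_⟩
      have h2 := exp_threshold_sq_le (hγ₀.trans_le (hγ i)) (hγ2 i) hn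
      have h3 : 1 ≤ (n : ℝ) ^ (3 / 5 : ℝ) := Real.one_le_rpow hn1 (by norm_num)
      calc 2 * (D * (2 * D)) ^ 2 * (900 * Real.exp (40 / 13 * threshold (γ i) n ^ 2)) + 2 * D ^ 2 * D
          ≤ 2 * (D * (2 * D)) ^ 2 * (900 * (n : ℝ) ^ (3 / 5 : ℝ))
            + 2 * D ^ 2 * D * (n : ℝ) ^ (3 / 5 : ℝ) := by
            refine add_le_add (by gcongr) (le_mul_of_one_le_right (by positivity) h3)
        _ = _ := by rw [hV]; ring
  have hlim : Tendsto (fun n : ℕ => ENNReal.ofReal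
      (K * (4 * V / ε ^ 2) * (Real.log n ^ 4 * ((n : ℝ) ^ (3 / 5 : ℝ) / n)))) atTop (𝓝 0) := by
    have := ENNReal.tendsto_ofReal (tendsto_log_pow_mul_rpow.const_mul (K * (4 * V / ε ^ 2)))
    simpa using this
  refine tendsto_of_tendsto_of_tendsto_of_le_of_le' tendsto_const_nhds hlim
    (Eventually.of_forall fun n => zero_le) ?_
  filter_upwards [hpoint, eventually_ge_atTop 3] with n hpt hn
  have hn0 : (0 : ℝ) < n := by positivity
  have hδ₁ := spacing₁_pos hC₁ hn
  have hδ₂ := spacing₂_pos hC₁ hC₂ hC₃ hC₄ hn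
  set δ₁ := spacing₁ C₁ n
  set δ₂ := spacing₂ C₁ C₂ C₃ C₄ n
  set N₁ := ⌊2 * a n / δ₁⌋₊ + 1
  set N₂ := ⌈1 / δ₂⌉₊
  set E : ℝ → ℝ≥0∞ → Set Ω := fun η τ =>
    {ω | ε ≤ |riskEstD p γ n (fun i => X i ω) η τ - avgLoss p θ n (fun i => X i ω) η τ|}
  set B := ENNReal.ofReal (4 * (V * (n : ℝ) ^ (3 / 5 : ℝ)) / (n * ε ^ 2))
  have hsub : {ω | ∃ η ∈ grid₁ C₁ n, ∃ τ ∈ grid₂ C₁ C₂ C₃ C₄ n,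
      ε ≤ |riskEstD p γ n (fun i => X i ω) η τ - avgLoss p θ n (fun i => X i ω) η τ|}
      ⊆ ⋃ k ∈ Finset.range N₁ ×ˢ Finset.range N₂,
        E (-a n + k.1 * δ₁) (ENNReal.ofReal (k.2 * δ₂ / (1 - k.2 * δ₂))) := by
    rintro ω ⟨η, ⟨hη, k, rfl⟩, τ, ⟨l, hl, rfl⟩, hω⟩
    refine Set.mem_biUnion (x := (k, l)) ?_ hω
    rw [Finset.mem_coe, Finset.mem_product, Finset.mem_range, Finset.mem_range]
    refine ⟨Nat.lt_succ_of_le (Nat.le_floor ?_), hl⟩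
    rw [le_div_iff₀ hδ₁]
    linarith [hη.2]
  refine (measure_mono hsub).trans ((measure_biUnion_finset_le _ _).trans ?_)
  refine (Finset.sum_le_sum fun k _ => hpt _ _ ENNReal.ofReal_ne_top).trans ?_
  rw [Finset.sum_const, Finset.card_product, Finset.card_range, Finset.card_range, nsmul_eq_mul,
    ← ENNReal.ofReal_natCast, ← ENNReal.ofReal_mul (by positivity)]
  apply ENNReal.ofReal_le_ofReal
  have hsz : (N₁ : ℝ) * N₂ ≤ K * Real.log n ^ 4 := grid_size_le hC₁ hC₂ hC₃ hC₄ hn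
  rw [Nat.cast_mul]
  calc _ ≤ K * Real.log n ^ 4 * (4 * (V * (n : ℝ) ^ (3 / 5 : ℝ)) / (n * ε ^ 2)) := by
        exact mul_le_mul_of_nonneg_right hsz (by positivity)
    _ = _ := by
        field_simp

/-- The averages of `|X_i|` are bounded with probability tending to one. -/
theorem exists_bound_sum_abs (hp : ∀ i, (p i).Regular) (hX : iIndepFun X μ)
    (hlaw : ∀ i, HasLaw (X i) (gaussianReal (θ i) (p i).σp.toNNReal) μ)
    (hA2 : AssumptionA2 θ) {D : ℝ} (hD : ∀ i, (p i).σf ≤ D) :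
    ∃ R : ℝ, 0 ≤ R ∧ Tendsto (fun n : ℕ => μ {ω | n * R < ∑ i ∈ Finset.range n, |X i ω|})
      atTop (𝓝 0) := by
  obtain ⟨T, hT⟩ := hA2
  rw [eventually_map] at hT
  have hσD : ∀ i, (p i).σp ≤ D := fun i => (hp i).σp_le_σf.trans (hD i)
  have hD0 : 0 ≤ D := (hp 0).σf_pos.le.trans (hD 0)
  set ν : ℕ → Measure ℝ := fun i => gaussianReal (θ i) (p i).σp.toNNReal with hν
  have hIsq : ∀ i, Integrable (fun x => (x - θ i) ^ 2) (ν i) := fun i => by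
    simpa using integrable_sub_sq_gaussianReal (θ i) (p i).σp.toNNReal 1 (θ i)
  have hsq : ∀ i, ∫ x, (x - θ i) ^ 2 ∂(ν i) ≤ D := fun i => by
    rw [hν, integral_sub_sq_gaussianReal, Real.coe_toNNReal _ (hp i).σp_pos.le]
    exact hσD i
  have hIabs : ∀ i, Integrable (fun x => |x - θ i|) (ν i) := fun i =>
    ((integrable_id_gaussianReal _ _).sub (integrable_const _)).abs
  set M : ℕ → ℝ := fun i => ∫ x, |x - θ i| ∂(ν i) with hM
  have hM1 : ∀ i, M i ≤ 1 + D := by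
    intro i
    have : M i ≤ ∫ x, (1 + (x - θ i) ^ 2) ∂(ν i) :=
      integral_mono (hIabs i) ((integrable_const 1).add (hIsq i)) fun x => by
        show |x - θ i| ≤ 1 + (x - θ i) ^ 2
        rw [← sq_abs (x - θ i)]
        nlinarith [sq_nonneg (|x - θ i| - 1), abs_nonneg (x - θ i)]
    rw [integral_add (integrable_const 1) (hIsq i)] at this
    simp only [integral_const, probReal_univ, smul_eq_mul, one_mul, hν] at this
    linarith [hsq i]
  refine ⟨|T| + (1 + D) + 1, by positivity, ?_⟩
  have hlim : Tendsto (fun n : ℕ => ENNReal.ofReal (4 * D / (n * 1 ^ 2))) atTop (𝓝 0) := by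
    have := ENNReal.tendsto_ofReal (tendsto_const_div_atTop_nhds_zero_nat (4 * D))
    simpa using this
  refine tendsto_of_tendsto_of_tendsto_of_le_of_le' tendsto_const_nhds hlim
    (Eventually.of_forall fun n => zero_le) ?_
  filter_upwards [hT, eventually_gt_atTop 0] with n hTn hn
  have hn0 : (0 : ℝ) < n := by exact_mod_cast hn
  -- Chebyshev's inequality with deviation 1, applied to |X_i - θ_i| minus its mean; centering at
  -- minus that mean turns the second moment into the variance of X_i.
  refine le_trans (measure_mono fun ω hω => ?_) (measure_le_abs_average_le hX hlaw
    (F := fun i x => |x - θ i| - M i) (fun i => by fun_prop) hn one_pos (fun i => ?_) (fun i => ?_))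
  · simp only [Set.mem_ofPred_eq] at hω ⊢
    rw [one_div, inv_mul_le_iff₀ hn0] at hTn
    have h1 : ∑ i ∈ Finset.range n, |X i ω| ≤ ∑ i ∈ Finset.range n, (|X i ω - θ i| - M i)
        + ∑ i ∈ Finset.range n, M i + ∑ i ∈ Finset.range n, |θ i| := by
      rw [← Finset.sum_add_distrib, ← Finset.sum_add_distrib]
      refine Finset.sum_le_sum fun i _ => ?_
      have := abs_add_le (X i ω - θ i) (θ i)
      rw [sub_add_cancel] at this
      linarith
    have h2 : ∑ i ∈ Finset.range n, M i ≤ n * (1 + D) := by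
      refine (Finset.sum_le_sum fun i _ => hM1 i).trans (le_of_eq ?_)
      rw [Finset.sum_const, Finset.card_range, nsmul_eq_mul]
    have h3 : n * T ≤ n * |T| := by
      have := le_abs_self T
      gcongr
    refine le_trans ?_ (le_abs_self _)
    rw [one_div, le_inv_mul_iff₀ hn0]
    linarith
  · rw [integral_sub (hIabs i) (integrable_const _)]
    simp [hM, hν]
  · refine ⟨-M i, ?_, ?_⟩
    · simpa using hIsq i
    · simpa using hsq i

/-- Pairs of observations closer than the spacing of the grid are rare. -/
theorem tendsto_measure_card_pairs (hX : iIndepFun X μ)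
    (hlaw : ∀ i, HasLaw (X i) (gaussianReal (θ i) (p i).σp.toNNReal) μ)
    {c : ℝ} (hc : 0 < c) (hcσ : ∀ i, c ≤ (p i).σp) {g : ℕ → ℝ} (hg0 : ∀ᶠ n in atTop, 0 ≤ g n)
    (hg : Tendsto g atTop (𝓝 0)) {ρ : ℝ} (hρ : 0 < ρ) :
    Tendsto (fun n : ℕ => μ {ω | (n * ρ) ^ 2 ≤ ((((Finset.range n) ×ˢ (Finset.range n)).filter
        fun k => |X k.1 ω - X k.2 ω| ≤ g n).card : ℝ)}) atTop (𝓝 0) := by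
  have hlim : Tendsto (fun n : ℕ => ENNReal.ofReal ((1 / n + 2 * g n / √c) / ρ ^ 2))
      atTop (𝓝 0) := by
    have h := ((tendsto_one_div_atTop_nhds_zero_nat (𝕜 := ℝ)).add
      ((hg.const_mul 2).div_const (√c))).div_const (ρ ^ 2)
    have := ENNReal.tendsto_ofReal h
    simpa using this
  refine tendsto_of_tendsto_of_tendsto_of_le_of_le' tendsto_const_nhds hlim
    (Eventually.of_forall fun n => zero_le) ?_
  filter_upwards [hg0, eventually_gt_atTop 0] with n hgn hn
  refine measure_card_pairs_le hX hlaw hc (fun i => ?_) hn hgn hρ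
  rw [Real.coe_toNNReal _ (hc.le.trans (hcσ i))]
  exact hcσ i

end probability

/-! ### The deterministic comparison and the conclusion. -/

/-- On the event where the risk estimate is accurate on the grid and the data are spread out, the
minimizer of the risk estimate is nearly optimal. -/
theorem avgLoss_lt_of_accurate {p : ℕ → Coord} (hp : ∀ i, (p i).Regular) {c D Q R r : ℝ}
    (hc : 0 < c) (hc1 : c ≤ 1) (hcσ : ∀ i, c ≤ (p i).σp) (hD1 : 1 ≤ D) (hD : ∀ i, (p i).σf ≤ D)
    (hbh : ∀ i, (p i).b + (p i).h ≤ D) (hQ : ∀ i, |stdQuantile (p i).ratio| ≤ Q)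
    {cl cu : ℝ} (hcl : ∀ i, cl ≤ (p i).ratio) (hcu : ∀ i, (p i).ratio ≤ cu)
    (hr : 0 < r) (hr1 : R < cl * r) (hr2 : R < (1 - cu) * r)
    {i₀ j₀ : ℕ} (hij : (p i₀).ratio < (p j₀).ratio) (θ γ : ℕ → ℝ)
    {C₁ C₂ C₃ C₄ ε : ℝ} {n : ℕ} (hn : 0 < n) (hi₀ : i₀ < n) (hj₀ : j₀ < n)
    (hδ₁ : 0 < spacing₁ C₁ n) (hδ₂ : 0 < spacing₂ C₁ C₂ C₃ C₄ n) (hra : r ≤ a n)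
    (hsmall : D * (D / c ^ 2 * spacing₂ C₁ C₂ C₃ C₄ n * (R + r + D * Q) + spacing₁ C₁ n) < ε / 2)
    {x : ℕ → ℝ} (hx : ∑ i ∈ Finset.range n, |x i| ≤ n * R)
    (hpairs : ((((Finset.range n) ×ˢ (Finset.range n)).filter
      fun k => |x k.1 - x k.2| ≤ spacing₁ C₁ n).card : ℝ)
        < (n * ((p j₀).ratio - (p i₀).ratio)) ^ 2)
    (hacc : ∀ η ∈ grid₁ C₁ n, ∀ τ ∈ grid₂ C₁ C₂ C₃ C₄ n,
      |riskEstD p γ n x η τ - avgLoss p θ n x η τ| < ε / 4)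
    {ηD ηOR : ℝ} {τD τOR : ℝ≥0∞}
    (hDmin : (searchGrid p C₁ C₂ C₃ C₄ n x).Nonempty →
      IsArgmin (fun y : ℝ × ℝ≥0∞ => riskEstD p γ n x y.1 y.2)
        (searchGrid p C₁ C₂ C₃ C₄ n x) (ηD, τD))
    (hOR : ηOR ∈ locRange p n x) :
    avgLoss p θ n x ηD τD < avgLoss p θ n x ηOR τOR + ε := by
  have : Nonempty (Fin n) := ⟨⟨0, hn⟩⟩
  have hbelow : BddBelow (Set.range fun i : Fin n => (p i).ratio) :=
    ⟨cl, by rintro _ ⟨i, rfl⟩; exact hcl i⟩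
  have habove : BddAbove (Set.range fun i : Fin n => (p i).ratio) :=
    ⟨cu, by rintro _ ⟨i, rfl⟩; exact hcu i⟩
  set α := ⨅ i : Fin n, (p i).ratio with hα
  set β := ⨆ i : Fin n, (p i).ratio with hβ
  have hα1 : cl ≤ α := le_ciInf fun i => hcl i
  have hα2 : α ≤ (p i₀).ratio := ciInf_le hbelow ⟨i₀, hi₀⟩
  have hβ1 : β ≤ cu := ciSup_le fun i => hcu i
  have hβ2 : (p j₀).ratio ≤ β := le_ciSup habove ⟨j₀, hj₀⟩
  have hQα1 : R < α * r := hr1.trans_le (by gcongr)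
  have hQβ2 : R < (1 - β) * r := hr2.trans_le (by gcongr)
  have hQβ1 : R < β * r := hQα1.trans_le (by gcongr; linarith)
  have hQα2 : R < (1 - α) * r := hQβ2.trans_le (by gcongr; linarith)
  have hm1 := abs_le.mp (abs_empQuantile_le hn hr hx hQα1 hQα2)
  have hm2 := abs_le.mp (abs_empQuantile_le hn hr hx hQβ1 hQβ2)
  -- A shorter range would force more close pairs than `hpairs` permits, since β - α is at least the
  -- gap between the two fixed unequal ratios.
  have hgap : empQuantile n x α + spacing₁ C₁ n ≤ empQuantile n x β := by
    by_contra! hlt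
    have h1 := card_pairs_of_empQuantile_lt hn hr (by linarith) hx hQα1 hQβ2 hlt
    have h2 : (n * ((p j₀).ratio - (p i₀).ratio)) ^ 2 ≤ (n * (β - α)) ^ 2 := by
      have : 0 ≤ (p j₀).ratio - (p i₀).ratio := by linarith
      gcongr
    linarith
  obtain ⟨η', ⟨hη'g, hη'm⟩, hη'⟩ := exists_grid₁_near hδ₁ hOR.1 hOR.2 hgap (by linarith) (by linarith)
  obtain ⟨τ', hτ'g, hτ'⟩ := exists_grid₂_near hδ₂ τOR
  have hmem : ((η', τ') : ℝ × ℝ≥0∞) ∈ searchGrid p C₁ C₂ C₃ C₄ n x := ⟨⟨hη'g, hη'm⟩, hτ'g⟩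
  obtain ⟨hDmem, hDle⟩ := hDmin ⟨_, hmem⟩
  have h1 := abs_lt.mp (hacc ηD hDmem.1.1 τD hDmem.2)
  have h2 := abs_lt.mp (hacc η' hη'g τ' hτ'g)
  have h3 := hDle (η', τ') hmem
  dsimp only at h3
  have h4 := abs_avgLoss_sub_le hp hc hc1 hcσ hD1 hD hbh hQ θ hn hx ηOR η' τOR τ'
  have hηr : |ηOR| ≤ r := abs_le.mpr ⟨hm1.1.trans hOR.1, hOR.2.trans hm2.2⟩
  have hQ0 : 0 ≤ Q := (abs_nonneg _).trans (hQ 0)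
  have hR0 : 0 ≤ R := by
    have : 0 ≤ n * R := (Finset.sum_nonneg fun i _ => abs_nonneg (x i)).trans hx
    exact nonneg_of_mul_nonneg_right this (by exact_mod_cast hn)
  have h5 : D * (D / c ^ 2 * |toUnit τOR - toUnit τ'| * (R + |ηOR| + D * Q) + |ηOR - η'|)
      ≤ D * (D / c ^ 2 * spacing₂ C₁ C₂ C₃ C₄ n * (R + r + D * Q) + spacing₁ C₁ n) := by
    gcongr
  have h6 := abs_le.mp (h4.trans h5)
  -- Two estimation errors of ε/4, at the minimizer and at the grid neighbour of the oracle, plus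
  -- the discretization error below ε/2.
  linarith [h1.1, h2.2, h6.1]

end ARE

theorem mainTheorem8
    -- the coordinates, the unknown means and the past data
    (p : ℕ → ARE.Coord) (θ : ℕ → ℝ)
    (hA1 : ARE.AssumptionA1 p) (hA2 : ARE.AssumptionA2 θ) (hA3 : ARE.AssumptionA3 p)
    {Ω : Type*} [MeasurableSpace Ω] (μ : Measure Ω) [IsProbabilityMeasure μ]
    (X : ℕ → Ω → ℝ) (hX_indep : iIndepFun X μ)
    (hX_law : ∀ i, HasLaw (X i) (gaussianReal (θ i) (p i).σp.toNNReal) μ)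
    -- the critical ratios are not all equal
    (hratio : ∃ i j, (p i).ratio < (p j).ratio)
    -- the threshold constants
    (γ : ℕ → ℝ) (hγ_pos : ∃ γ₀ : ℝ, 0 < γ₀ ∧ ∀ i, γ₀ ≤ γ i)
    (hγ_lt : ∀ i, γ i < 1 / √(4 * Real.exp 1) - √((p i).σp / (p i).σf))
    -- the constants of the grid
    (C₁ C₂ C₃ C₄ : ℝ)
    (hC₁ : ∀ i, (p i).b + (p i).h ≤ C₁)
    (hC₂ : ∀ i, (p i).σp ≤ C₂ ∧ ((p i).σp)⁻¹ ≤ C₂)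
    (hC₃ : ∀ i j, (p i).σp / (p i).σf * |ARE.stdQuantile (p j).ratio| ≤ C₃)
    (hC₄ : 0 < C₄)
    -- the minimizer of the risk estimate over the grid
    (ηD : ℕ → Ω → ℝ) (τD : ℕ → Ω → ℝ≥0∞)
    (hD : ∀ n, 3 ≤ n → ∀ ω,
      (ARE.searchGrid p C₁ C₂ C₃ C₄ n (fun i => X i ω)).Nonempty →
      ARE.IsArgmin
        (fun y : ℝ × ℝ≥0∞ => ARE.riskEstD p γ n (fun i => X i ω) y.1 y.2)
        (ARE.searchGrid p C₁ C₂ C₃ C₄ n (fun i => X i ω))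
        (ηD n ω, τD n ω))
    -- the oracle
    (ηOR : ℕ → Ω → ℝ) (τOR : ℕ → Ω → ℝ≥0∞)
    (hOR : ∀ n, 3 ≤ n → ∀ ω,
      ARE.IsArgmin
        (fun y : ℝ × ℝ≥0∞ => ARE.avgLoss p θ n (fun i => X i ω) y.1 y.2)
        (ARE.locRange p n (fun i => X i ω) ×ˢ (Set.univ : Set ℝ≥0∞))
        (ηOR n ω, τOR n ω))
    (ε : ℝ) (hε : 0 < ε) :
    Tendsto
      (fun n : ℕ => μ {ω |
        ARE.avgLoss p θ n (fun i => X i ω) (ηOR n ω) (τOR n ω) + ε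
          ≤ ARE.avgLoss p θ n (fun i => X i ω) (ηD n ω) (τD n ω)})
      atTop (𝓝 0) := by
  obtain ⟨cl, hcl0, hcl⟩ := hA1.ratio_lower
  obtain ⟨cu, hcu1, hcu⟩ := hA1.ratio_upper
  obtain ⟨c', hc'0, hc'⟩ := hA3.σp_lower
  obtain ⟨Cf, hCf⟩ := hA3.σf_upper
  obtain ⟨κ, hκ1, hκ⟩ := hA3.var_ratio
  obtain ⟨γ₀, hγ₀, hγ⟩ := hγ_pos
  obtain ⟨i₀, j₀, hij⟩ := hratio
  have hp : ∀ i, (p i).Regular := fun i =>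
    ⟨hA1.b_pos i, hA1.h_pos i, hc'0.trans_le (hc' i), hA3.σf_pos i, (hκ i).trans hκ1.le⟩
  have hγ2 : ∀ i, γ i ≤ 1 / √(4 * Real.exp 1) := fun i => by
    linarith [hγ_lt i, Real.sqrt_nonneg ((p i).σp / (p i).σf)]
  set c := min c' 1
  have hc : 0 < c := lt_min hc'0 one_pos
  have hc1 : c ≤ 1 := min_le_right _ _
  have hcσ : ∀ i, c ≤ (p i).σp := fun i => (min_le_left _ _).trans (hc' i)
  set D := max 1 (max C₁ Cf)
  have hD1 : 1 ≤ D := le_max_left _ _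
  have hbh : ∀ i, (p i).b + (p i).h ≤ D := fun i =>
    (hC₁ i).trans ((le_max_left _ _).trans (le_max_right _ _))
  have hσf : ∀ i, (p i).σf ≤ D := fun i =>
    (hCf i).trans ((le_max_right _ _).trans (le_max_right _ _))
  have hC₁0 : 0 < C₁ := (add_pos (hp 0).b_pos (hp 0).h_pos).trans_le (hC₁ 0)
  have hC₂0 : 0 < C₂ := (hp 0).σp_pos.trans_le (hC₂ 0).1
  have hr0 : 0 < (p 0).σp / (p 0).σf := div_pos (hp 0).σp_pos (hp 0).σf_pos
  have hC₃0 : 0 ≤ C₃ := (mul_nonneg hr0.le (abs_nonneg _)).trans (hC₃ 0 0)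
  -- The bound by `C₃` runs over all pairs of indices; fixing the variance ratio of coordinate 0
  -- bounds all normal quantiles at once.
  set Q := C₃ / ((p 0).σp / (p 0).σf)
  have hQ : ∀ i, |ARE.stdQuantile (p i).ratio| ≤ Q := fun i => by
    rw [le_div_iff₀ hr0, mul_comm]
    exact hC₃ 0 i
  obtain ⟨R, hR0, hRlim⟩ := ARE.exists_bound_sum_abs hp hX_indep hX_law hA2 hσf
  set ξ := min cl (1 - cu)
  have hξ : 0 < ξ := lt_min hcl0 (by linarith)
  -- Chosen so that ξr = R + 1 > R, which is the Markov condition for both extreme quantile levels.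
  set r := (R + 1) / ξ
  have hr : 0 < r := by positivity
  have hrξ : R < ξ * r := by
    have : ξ * r = R + 1 := mul_div_cancel₀ _ hξ.ne'
    linarith
  have hr1 : R < cl * r := hrξ.trans_le (by gcongr; exact min_le_left _ _)
  have hr2 : R < (1 - cu) * r := hrξ.trans_le (by gcongr; exact min_le_right _ _)
  have hdev := ARE.tendsto_measure_grid_deviation hp hX_indep hX_law hγ₀ hγ hγ2 hD1 hbh hσf
    hC₁0 hC₂0 hC₃0 hC₄ (show 0 < ε / 4 by positivity)
  have hpairs := ARE.tendsto_measure_card_pairs hX_indep hX_law hc hcσ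
    (g := ARE.spacing₁ C₁) (by
      filter_upwards [eventually_ge_atTop 3] with n hn
      exact (ARE.spacing₁_pos hC₁0 hn).le) (ARE.tendsto_spacing₁ hC₁0) (sub_pos.mpr hij)
  have hsmall : ∀ᶠ n : ℕ in atTop, D * (D / c ^ 2 * ARE.spacing₂ C₁ C₂ C₃ C₄ n * (R + r + D * Q)
      + ARE.spacing₁ C₁ n) < ε / 2 := by
    have h := ((((ARE.tendsto_spacing₂ hC₁0 hC₂0 hC₃0 hC₄).const_mul (D / c ^ 2)).mul_const
      (R + r + D * Q)).add (ARE.tendsto_spacing₁ hC₁0)).const_mul D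
    simp only [mul_zero, zero_mul, add_zero] at h
    exact h.eventually_lt_const (by positivity)
  have hsum := (hRlim.add hpairs).add hdev
  simp only [add_zero] at hsum
  refine tendsto_of_tendsto_of_tendsto_of_le_of_le' tendsto_const_nhds hsum
    (Eventually.of_forall fun n => zero_le) ?_
  filter_upwards [hsmall, ARE.tendsto_a.eventually_ge_atTop r, eventually_ge_atTop 3,
    eventually_gt_atTop i₀, eventually_gt_atTop j₀] with n hsm han hn3 hi₀ hj₀
  -- The failure event is covered by three bad events: a large average of |X_i|, too many close
  -- pairs, and an inaccurate risk estimate somewhere on the grid.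
  refine le_trans (measure_mono ?_) ((measure_union_le _ _).trans
    (add_le_add (measure_union_le _ _) le_rfl))
  intro ω hω
  by_contra hgood
  simp only [Set.mem_union, Set.mem_ofPred_eq, not_or, not_exists, not_and, not_le, not_lt]
    at hgood
  have h := ARE.avgLoss_lt_of_accurate (τOR := τOR n ω) hp hc hc1 hcσ hD1 hσf hbh hQ
    hcl hcu hr hr1 hr2 hij θ γ (by omega) hi₀ hj₀ (ARE.spacing₁_pos hC₁0 hn3) (ARE.spacing₂_pos hC₁0 hC₂0 hC₃0 hC₄ hn3) han
    hsm hgood.1.1 hgood.1.2 hgood.2 (hD n hn3 ω) (hOR n hn3 ω).1.1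
  have hω' : ARE.avgLoss p θ n (fun i => X i ω) (ηOR n ω) (τOR n ω) + ε
      ≤ ARE.avgLoss p θ n (fun i => X i ω) (ηD n ω) (τD n ω) := hω
  exact absurd h (not_lt.mpr hω')
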